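/- Fix a real number $\gamma\neq 0$ and let $\mathscr P_\gamma$ be the class of equations $$i\psi_t+\psi_{xx}+\sigma|\psi|^\gamma\psi+V(t,x)\psi=0$$ for complex-valued $\psi=\psi(t,x)$, whose arbitrary elements $\theta=(\sigma,V)$ are a nonzero complex constant $\sigma$ and a smooth complex-valued potential $V$. Conventions. Everything is local. A point transformation $\varphi$ is a smooth injective map with nonvanishing Jacobian $(t,x,\psi)\mapsto(\tilde t,\tilde x,\tilde\psi)$ (smooth in $t,x,\psi,\psi^*$) of a domain $D$ into the set $\{\tilde\psi\ne0\}$; here a domain is a nonempty connected open set of points $(t,x,\psi)\in\mathbb R\times\mathbb R\times(\mathbb C\setminus\{0\})$ all of whose sections $t=\mathrm{const}$ are connected. Potentials are defined and smooth on the projections of $D$ and $\varphi(D)$ to the $(t,x)$-plane. A triple $(\theta,\tilde\theta,\varphi)$ is admissible if $\varphi$ maps the equation with $\theta$ to the equation with $\tilde\theta$, i.e. a 2-jet over $D$ at which the second prolongation of $\varphi$ is defined lies on the first equation if and only if its image lies on the second one. The equivalence group $G^\sim$ consists of the point transformations $\Phi$ of the variables $(t,x,\psi,\sigma,V)$, on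 $D\times(\mathbb C\setminus\{0\})\times\mathbb C$, whose $(t,x,\psi)$-components depend only on $(t,x,\psi)$, defining $\Phi|_{(t,x,\psi)}$, and such that, for all arbitrary elements $\theta$ over $D$, $\Phi\theta$ is again a pair of arbitrary elements and $(\theta,\Phi\theta,\Phi|_{(t,x,\psi)})$ is admissible. The class is normalized if for every admissible triple $(\theta,\tilde\theta,\varphi)$ there is $\Phi\in G^\sim$ with $\tilde\theta=\Phi\theta$ and $\varphi=\Phi|_{(t,x,\psi)}$. Theorem. The class $\mathscr P_\gamma$ is normalized. Its equivalence group consists exactly of the transformations (over arbitrary domains $D$) $$\tilde t=T(t),\qquad \tilde x=\varepsilon x|T_t|^{1/2}+X(t),\qquad \tilde\psi=\hat\psi\exp\Bigl(\frac i8\frac{T_{tt}}{|T_t|}x^2+\frac i2\frac{\varepsilon\varepsilon'X_t}{|T_t|^{1/2}}x+\Theta(t)+i\Psi(t)\Bigr),$$ $$\tilde\sigma=\frac{\hat\sigma}{\varkappa^\gamma},\qquad \tilde V=\frac{\hat V}{|T_t|}+\frac{2T_{ttt}T_t-3T_{tt}^2}{16\varepsilon'T_t^3}x^2+\frac{\varepsilon\varepsilon'}{2|T_t|^{1/2}}\Bigl(\frac{X_t}{T_t}\Bigr)_tx+\frac{\Psi_t}{T_t}-\frac{X_t^2}{4T_t^2}+i\gamma'\frac{T_{tt}}{T_t^2},\qquad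 \gamma'=\frac1\gamma-\frac14,$$ where $T,X,\Theta,\Psi$ are smooth real-valued functions of $t$ on the projection of $D$ to the $t$-axis, $T_t\ne0$ and $e^{\Theta}=\varkappa|T_t|^{-1/\gamma}$ there, $\varkappa>0$ is a constant, $\varepsilon=\pm1$, $\varepsilon'=\operatorname{sign}T_t$, and $\hat\beta=\beta$ if $T_t>0$, $\hat\beta=\beta^*$ if $T_t<0$. In terms of $S=\sigma|\psi|^\gamma+V$ and $\tilde S=\tilde\sigma|\tilde\psi|^\gamma+\tilde V$ these rules amount to $$\tilde S=\frac{\hat S}{|T_t|}+\frac{2T_{ttt}T_t-3T_{tt}^2}{16\varepsilon'T_t^3}x^2+\frac{\varepsilon\varepsilon'}{2|T_t|^{1/2}}\Bigl(\frac{X_t}{T_t}\Bigr)_tx+\frac{\Psi_t-i\Theta_t}{T_t}-\frac{X_t^2+iT_{tt}}{4T_t^2}.$$ -/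

import Mathlib

open scoped ContDiff Topology

noncomputable section

namespace NSchE

/-- The space of the variables `(t, x, ψ)`.  The complex coordinate `ψ` is treated as two real
coordinates, so that smooth functions on this space are smooth functions of `t, x, ψ, ψ*`. -/
abbrev Pt : Type := ℝ × ℝ × ℂ

/-- The space of values `(σ, V)` of the arbitrary elements. -/
abbrev Val : Type := ℂ × ℂ

/-- The values that the arbitrary elements `(σ, V)` can take: `σ ≠ 0`, `V` arbitrary. -/
def valSet : Set Val := {w | w.1 ≠ 0}

/-- Projection `(t, x, ψ) ↦ (t, x)`. -/
def base (z : Pt) : ℝ × ℝ := (z.1, z.2.1)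

/-- Projection of a set of points `(t, x, ψ)` to the `t`-axis. -/
def times (D : Set Pt) : Set ℝ := Prod.fst '' D

/-- Domains on which point transformations are considered: nonempty connected open sets of points
`(t, x, ψ)` with `ψ ≠ 0`, all of whose sections `t = const` are connected (or empty). -/
structure IsDomain (D : Set Pt) : Prop where
  isOpen : IsOpen D
  isConnected : IsConnected D
  section_connected : ∀ t : ℝ, IsPreconnected {z ∈ D | z.1 = t}
  ne_zero : ∀ z ∈ D, z.2.2 ≠ 0

/-- `φ` is a point transformation of the open set `D`: a smooth injective map with nonvanishing
Jacobian. -/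
structure IsPointTransformation {E : Type*} [NormedAddCommGroup E] [NormedSpace ℝ E]
    (D : Set E) (φ : E → E) : Prop where
  isOpen : IsOpen D
  smooth : ContDiffOn ℝ ∞ φ D
  injOn : Set.InjOn φ D
  jacobian : ∀ z ∈ D, (fderiv ℝ φ z).det ≠ 0

/-- A pair of arbitrary elements: a constant `σ` and a potential `V = V(t, x)`. -/
structure ArbElt where
  σ : ℂ
  V : ℝ × ℝ → ℂ

/-- The value of the arbitrary elements at a point `(t, x, ψ)`. -/
def ArbElt.val (θ : ArbElt) (z : Pt) : Val := (θ.σ, θ.V (base z))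

/-- `θ` belongs to the set of arbitrary elements of the class, over `D`: `σ` is a nonzero constant
and `V` is a smooth function of `(t, x)` on the projection of `D`. -/
def ArbElt.InClass (θ : ArbElt) (D : Set Pt) : Prop :=
  θ.σ ≠ 0 ∧ ContDiffOn ℝ ∞ θ.V (base '' D)

/-- The left-hand side `i ψ_t + ψ_xx + σ |ψ|^γ ψ + V ψ` of the equation with the arbitrary
elements `θ`, evaluated on the function `f` at the point `p = (t, x)`. -/
def lhs (γ : ℝ) (θ : ArbElt) (f : ℝ × ℝ → ℂ) (p : ℝ × ℝ) : ℂ :=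
  Complex.I * deriv (fun s : ℝ => f (s, p.2)) p.1
    + deriv (fun y : ℝ => deriv (fun y' : ℝ => f (p.1, y')) y) p.2
    + θ.σ * ((‖f p‖ ^ γ : ℝ) : ℂ) * f p + θ.V p * f p

/-- Near the point `z₀`, the map `φ` takes the graph `ψ = f(t, x)` to the graph `ψ = g(t, x)`. -/
def GraphMapsTo (φ : Pt → Pt) (z₀ : Pt) (f g : ℝ × ℝ → ℂ) : Prop :=
  ∀ᶠ z in 𝓝 z₀, z.2.2 = f (base z) ↔ (φ z).2.2 = g (base (φ z))

/-- `φ`, defined on `D`, is a point transformation that maps the equation with the arbitrary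
elements `θ` to the equation with the arbitrary elements `θ'`.

Equations are understood as submanifolds of the second-order jet space, and a 2-jet is given by a
smooth function `f` and a point `p`.  The second prolongation of `φ` takes the jet of `f` at `p` to
the jet of `g` at the image point, where the graph of `g` is locally the `φ`-image of the graph
of `f` (as `φ` is a local diffeomorphism, such a smooth `g` exists precisely if the prolongation of
`φ` is defined at this jet).  The condition is that the first jet lies on the first equation if and
only if the second jet lies on the second equation. -/
structure IsAdmissible (γ : ℝ) (θ θ' : ArbElt) (D : Set Pt) (φ : Pt → Pt) : Prop where
  isDomain : IsDomain D
  transformation : IsPointTransformation D φ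
  ne_zero : ∀ z ∈ D, (φ z).2.2 ≠ 0
  source_mem : θ.InClass D
  target_mem : θ'.InClass (φ '' D)
  maps : ∀ (p : ℝ × ℝ) (f g : ℝ × ℝ → ℂ), (p.1, p.2, f p) ∈ D →
    ContDiffAt ℝ ∞ f p → ContDiffAt ℝ ∞ g (base (φ (p.1, p.2, f p))) →
    GraphMapsTo φ (p.1, p.2, f p) f g →
    (lhs γ θ f p = 0 ↔ lhs γ θ' g (base (φ (p.1, p.2, f p))) = 0)

/-- `Φ` acts on `θ` by `Φθ = θ'`, and its projection to the `(t, x, ψ)`-space is `φ`: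
on `D`, the graph of `θ` is mapped to the graph of `θ'`. -/
def ActsTo (D : Set Pt) (Φ : Pt × Val → Pt × Val) (φ : Pt → Pt) (θ θ' : ArbElt) : Prop :=
  ∀ z ∈ D, Φ (z, θ.val z) = (φ z, θ'.val (φ z))

/-- `φ` is the projection of `Φ` to the `(t, x, ψ)`-space. -/
def ProjectsTo (D : Set Pt) (Φ : Pt × Val → Pt × Val) (φ : Pt → Pt) : Prop :=
  ∀ z ∈ D, ∀ w ∈ valSet, (Φ (z, w)).1 = φ z

/-- The (usual) equivalence group of the class of equations
`i ψ_t + ψ_xx + σ |ψ|^γ ψ + V(t, x) ψ = 0`.  Its elements are the locally defined point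
transformations `Φ` of the space of `(t, x, ψ, σ, V)`, over a domain `D` of `(t, x, ψ)`, which are
projectable to the space of `(t, x, ψ)` and such that, for every `θ` of the class, `Φθ` is in the
class and the projection of `Φ` maps the equation with `θ` to the equation with `Φθ`.
An element is represented by the pair `(D, Φ)`; the values of `Φ` off `D × valSet` are
irrelevant. -/
def equivalenceGroup (γ : ℝ) : Set (Set Pt × (Pt × Val → Pt × Val)) :=
  {G | IsDomain G.1 ∧ IsPointTransformation (G.1 ×ˢ valSet) G.2 ∧
    ∃ φ : Pt → Pt, ProjectsTo G.1 G.2 φ ∧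
      ∀ θ : ArbElt, θ.InClass G.1 →
        ∃ θ' : ArbElt, ActsTo G.1 G.2 φ θ θ' ∧ IsAdmissible γ θ θ' G.1 φ}

/-- The class is normalized: every admissible transformation `(θ, θ', φ)` is induced by a
transformation from the equivalence group. -/
def IsNormalized (γ : ℝ) : Prop :=
  ∀ (θ θ' : ArbElt) (D : Set Pt) (φ : Pt → Pt), IsAdmissible γ θ θ' D φ →
    ∃ Φ : Pt × Val → Pt × Val, (D, Φ) ∈ equivalenceGroup γ ∧
      ProjectsTo D Φ φ ∧ ActsTo D Φ φ θ θ'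

/-- Parameters: functions `T, X, Θ, Ψ` of `t` and constants `ε, κ`. -/
structure Params where
  T : ℝ → ℝ
  X : ℝ → ℝ
  Θ : ℝ → ℝ
  Ψ : ℝ → ℝ
  ε : ℝ
  κ : ℝ

namespace Params

/-- The constraints on the parameters, for `t` in the interval `I`. -/
structure Allowed (P : Params) (γ : ℝ) (I : Set ℝ) : Prop where
  smooth_T : ContDiffOn ℝ ∞ P.T I
  smooth_X : ContDiffOn ℝ ∞ P.X I
  smooth_Θ : ContDiffOn ℝ ∞ P.Θ I
  smooth_Ψ : ContDiffOn ℝ ∞ P.Ψ I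
  deriv_T_ne : ∀ t ∈ I, deriv P.T t ≠ 0
  ε_eq : P.ε = 1 ∨ P.ε = -1
  κ_pos : 0 < P.κ
  exp_Θ : ∀ t ∈ I, Real.exp (P.Θ t) = P.κ * |deriv P.T t| ^ (-1 / γ)

variable (P : Params)

/-- `T_t` -/
def T1 (t : ℝ) : ℝ := deriv P.T t
/-- `T_tt` -/
def T2 (t : ℝ) : ℝ := deriv P.T1 t
/-- `T_ttt` -/
def T3 (t : ℝ) : ℝ := deriv P.T2 t
/-- `X_t` -/
def X1 (t : ℝ) : ℝ := deriv P.X t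
/-- `Ψ_t` -/
def Ψ1 (t : ℝ) : ℝ := deriv P.Ψ t
/-- `Θ_t` -/
def Θ1 (t : ℝ) : ℝ := deriv P.Θ t
/-- `(X_t / T_t)_t` -/
def XT (t : ℝ) : ℝ := deriv (fun s => P.X1 s / P.T1 s) t
/-- `ε' = sign T_t` -/
def ε' (t : ℝ) : ℝ := Real.sign (P.T1 t)

/-- The hat: `β̂ = β` if `T_t > 0`, and `β̂ = β*` otherwise. -/
def hat (t : ℝ) (β : ℂ) : ℂ := if 0 < P.T1 t then β else (starRingEnd ℂ) β

/-- The transformation of `(t, x, ψ)`. -/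
def pointMap (z : Pt) : Pt :=
  let t := z.1
  let x := z.2.1
  let ψ := z.2.2
  (P.T t,
   P.ε * x * Real.sqrt |P.T1 t| + P.X t,
   P.hat t ψ * Complex.exp
     (Complex.I / 8 * ((P.T2 t / |P.T1 t| * x ^ 2 : ℝ) : ℂ)
      + Complex.I / 2 * ((P.ε * P.ε' t * P.X1 t / Real.sqrt |P.T1 t| * x : ℝ) : ℂ)
      + (P.Θ t : ℂ) + Complex.I * (P.Ψ t : ℂ)))

/-- The transformation of `S`, where the equation is written as `i ψ_t + ψ_xx + S ψ = 0`. -/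
def sMap (t x : ℝ) (S : ℂ) : ℂ :=
  P.hat t S / ((|P.T1 t| : ℝ) : ℂ)
    + (((2 * P.T3 t * P.T1 t - 3 * P.T2 t ^ 2) / (16 * P.ε' t * P.T1 t ^ 3) * x ^ 2 : ℝ) : ℂ)
    + ((P.ε * P.ε' t / (2 * Real.sqrt |P.T1 t|) * P.XT t * x : ℝ) : ℂ)
    + ((P.Ψ1 t : ℂ) - Complex.I * (P.Θ1 t : ℂ)) / (P.T1 t : ℂ)
    - ((P.X1 t ^ 2 : ℝ) + Complex.I * (P.T2 t : ℂ)) / (4 * (P.T1 t : ℂ) ^ 2)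

/-- The transformation of the potential, with `γ' = 1/γ - 1/4`. -/
def potentialMap (γ : ℝ) (t x : ℝ) (V : ℂ) : ℂ :=
  P.hat t V / ((|P.T1 t| : ℝ) : ℂ)
    + (((2 * P.T3 t * P.T1 t - 3 * P.T2 t ^ 2) / (16 * P.ε' t * P.T1 t ^ 3) * x ^ 2 : ℝ) : ℂ)
    + ((P.ε * P.ε' t / (2 * Real.sqrt |P.T1 t|) * P.XT t * x : ℝ) : ℂ)
    + ((P.Ψ1 t / P.T1 t : ℝ) : ℂ)
    - ((P.X1 t ^ 2 / (4 * P.T1 t ^ 2) : ℝ) : ℂ)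
    + Complex.I * (((1 / γ - 1 / 4) * (P.T2 t / P.T1 t ^ 2) : ℝ) : ℂ)

/-- The transformation of the constant `σ`. -/
def sigmaMap (γ : ℝ) (t : ℝ) (σ : ℂ) : ℂ := P.hat t σ / ((P.κ ^ γ : ℝ) : ℂ)

/-- The transformation of `(t, x, ψ, σ, V)`. -/
def fullMap (γ : ℝ) (zw : Pt × Val) : Pt × Val :=
  (P.pointMap zw.1,
    (P.sigmaMap γ zw.1.1 zw.2.1, P.potentialMap γ zw.1.1 zw.1.2.1 zw.2.2))

end Params

end NSchE

end

/-! Admissibility is a condition on 2-jets. A quadratic polynomial realises any prescribed values of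
`ψ`, `ψ_t`, `ψ_x`, `ψ_tt`, `ψ_xx` at a point, and its graph is carried to a graph by the inverse
function theorem (`exists_graphMapsTo`). With the prolongation formula `lhs_image` this turns
admissibility into an algebraic equivalence at each point, `IsAdmissible.jet`. On the first equation
`ψ_xx = -iψ_t - Sψ`, while `ψ`, `ψ_t`, `ψ_x`, `ψ_tt` stay free, so the transformed equation can be
split with respect to the free derivatives.

The derivative `ψ_tt` forces the new time to depend on `t` only (`time_aux`). The derivative `ψ_t`
forces `x̃_x² = |T_t|`, independence of `x̃` from `ψ`, and complex linearity or antilinearity of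
`ψ̃_ψ`, according to the sign of `T_t` (`space_sq`, `space_vertical`, `vertical_I`). Splitting in
`ψ_x` leaves the three equations of `determining_coeff`: the second vertical derivatives of `ψ̃`
vanish, `ψ̃_xψ` is a known imaginary multiple of `ψ̃_ψ`, and a remaining equation links `S` and
`S̃`.

So `ψ̃` is affine in `ψ` or `ψ*`. Its free term is killed by the nonlinearity: the remaining
equation says that two shifted copies of `|y|^γ y` differ by an affine function, and Wirtinger
differentiation shows that the shift is zero (`AffineRel.shift_eq_zero`, `vertical_self`). What is
left integrates to the stated form, connectedness of the sections `t = const` making the integration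
"constants" functions of `t` (`exists_params`).

Conversely, for any parameters `lhs_pointMap` writes the new left-hand side as a nonvanishing factor
times the old one, or its conjugate, plus `(S̃ - sMap S) ψ̃`. Thus the equations correspond exactly
when `S` follows `sMap`. Varying `|ψ|` separates `σ` from `V` and makes `|T_t| e^{γΘ}` constant,
which defines `κ` (`exists_allowed`). The resulting action `fullMap` on `(σ, V)` does not involve
the particular arbitrary elements, which is normalization. For an element of the equivalence group,
one equation determines the parameters and constant potentials determine all values. -/

namespace NSchE

/-! ### Derivatives along lines and curves -/

section Calculus

variable {E F : Type*} [NormedAddCommGroup E] [NormedSpace ℝ E]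
  [NormedAddCommGroup F] [NormedSpace ℝ F]

lemma hasFDerivAt_of_smooth {h : E → F} {z : E} (hh : ContDiffAt ℝ ∞ h z) :
    HasFDerivAt h (fderiv ℝ h z) z :=
  (hh.differentiableAt (by simp)).hasFDerivAt

lemma smooth_fderiv {h : E → F} {z : E} (hh : ContDiffAt ℝ ∞ h z) :
    ContDiffAt ℝ ∞ (fderiv ℝ h) z :=
  hh.fderiv_right (m := ∞) (by simp)

lemma smooth_deriv {h : ℝ → F} {s : ℝ} (hh : ContDiffAt ℝ ∞ h s) :
    ContDiffAt ℝ ∞ (deriv h) s := by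
  have : deriv h = fun x => fderiv ℝ h x 1 := by ext x; simp
  rw [this]
  exact (smooth_fderiv hh).clm_apply contDiffAt_const

lemma eventually_smooth {h : E → F} {z : E} (hh : ContDiffAt ℝ ∞ h z) :
    ∀ᶠ y in 𝓝 z, DifferentiableAt ℝ h y := by
  filter_upwards [(hh.of_le (m := 1) (by simp)).eventually (by simp)] with y hy
  exact hy.differentiableAt (by simp)

lemma deriv_comp_curve {h : E → F} {c : ℝ → E} {s : ℝ} (hh : DifferentiableAt ℝ h (c s))
    (hc : DifferentiableAt ℝ c s) :
    deriv (fun r => h (c r)) s = fderiv ℝ h (c s) (deriv c s) :=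
  (hh.hasFDerivAt.comp_hasDerivAt s hc.hasDerivAt).deriv

/-- The second derivative of a map along a curve. -/
lemma deriv_deriv_comp_curve {h : E → F} {c : ℝ → E} {s : ℝ} (hh : ContDiffAt ℝ ∞ h (c s))
    (hc : ContDiffAt ℝ ∞ c s) :
    deriv (deriv (fun r => h (c r))) s
      = fderiv ℝ (fderiv ℝ h) (c s) (deriv c s) (deriv c s)
        + fderiv ℝ h (c s) (deriv (deriv c) s) := by
  have h1 : deriv (fun r => h (c r)) =ᶠ[𝓝 s] fun r => fderiv ℝ h (c r) (deriv c r) := by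
    filter_upwards [eventually_smooth hc, hc.continuousAt.eventually (eventually_smooth hh)]
      with r hr1 hr2
    exact deriv_comp_curve hr2 hr1
  rw [h1.deriv_eq]
  have hA : HasDerivAt (fun r => fderiv ℝ h (c r)) (fderiv ℝ (fderiv ℝ h) (c s) (deriv c s)) s :=
    (hasFDerivAt_of_smooth (smooth_fderiv hh)).comp_hasDerivAt s
      (hc.differentiableAt (by simp)).hasDerivAt
  have hB : HasDerivAt (deriv c) (deriv (deriv c) s) s :=
    ((smooth_deriv hc).differentiableAt (by simp)).hasDerivAt
  exact (hA.clm_apply hB).deriv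

lemma hasDerivAt_line (z v : E) (s : ℝ) : HasDerivAt (fun r : ℝ => z + r • v) v s := by
  simpa using ((hasDerivAt_id s).smul_const v).const_add z

lemma deriv_line (z v : E) : deriv (fun r : ℝ => z + r • v) = fun _ => v :=
  funext fun s => (hasDerivAt_line z v s).deriv

lemma smooth_line (z v : E) (s : ℝ) : ContDiffAt ℝ ∞ (fun r : ℝ => z + r • v) s := by
  fun_prop

lemma hasDerivAt_comp_line {h : E → F} {z : E} (hh : DifferentiableAt ℝ h z) (v : E) :
    HasDerivAt (fun r : ℝ => h (z + r • v)) (fderiv ℝ h z v) 0 := by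
  have hz : z + (0 : ℝ) • v = z := by simp
  have hh' : HasFDerivAt h (fderiv ℝ h z) (z + (0 : ℝ) • v) := by rw [hz]; exact hh.hasFDerivAt
  exact hh'.comp_hasDerivAt 0 (hasDerivAt_line z v 0)

lemma deriv_comp_line {h : E → F} {z : E} (hh : DifferentiableAt ℝ h z) (v : E) :
    deriv (fun r : ℝ => h (z + r • v)) 0 = fderiv ℝ h z v :=
  (hasDerivAt_comp_line hh v).deriv

lemma deriv_deriv_comp_line {h : E → F} {z : E} (hh : ContDiffAt ℝ ∞ h z) (v : E) :
    deriv (deriv (fun r : ℝ => h (z + r • v))) 0 = fderiv ℝ (fderiv ℝ h) z v v := by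
  have hz : z + (0 : ℝ) • v = z := by simp
  rw [deriv_deriv_comp_curve (c := fun r : ℝ => z + r • v) (by simpa using hh) (smooth_line z v 0)]
  simp only [deriv_line]
  simp

/-- A second-order directional derivative is the derivative of a directional derivative. -/
lemma hasFDerivAt_fderiv_apply {h : E → F} {z : E} (hh : ContDiffAt ℝ ∞ h z) (v : E) :
    HasFDerivAt (fun y => fderiv ℝ h y v) ((fderiv ℝ (fderiv ℝ h) z).flip v) z := by
  have := (hasFDerivAt_of_smooth (smooth_fderiv hh)).clm_apply (hasFDerivAt_const v z)
  simpa using this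

lemma fderiv_fderiv_comm {h : E → F} {z : E} (hh : ContDiffAt ℝ ∞ h z) (v w : E) :
    fderiv ℝ (fderiv ℝ h) z v w = fderiv ℝ (fderiv ℝ h) z w v :=
  
  (hh.isSymmSndFDerivAt (by
    simpa using (WithTop.coe_le_coe.2 (le_top : (2 : ℕ∞) ≤ ⊤) : ((2 : ℕ∞) : WithTop ℕ∞) ≤ ∞))) v w

end Calculus

/-! ### The equation and its second prolongation in Fréchet form -/

/-- The coefficient `S = σ |ψ|^γ + V` of the equation `i ψ_t + ψ_xx + S ψ = 0`. -/
noncomputable def ArbElt.S (γ : ℝ) (θ : ArbElt) (z : Pt) : ℂ :=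
  θ.σ * ((‖z.2.2‖ ^ γ : ℝ) : ℂ) + θ.V (base z)

/-- The tangent vector to the graph of `f` over the tangent vector `w` at `p`. -/
noncomputable def lift (f : ℝ × ℝ → ℂ) (p w : ℝ × ℝ) : Pt := (w.1, w.2, fderiv ℝ f p w)

/-- The left-hand side of the equation in terms of Fréchet derivatives. -/
lemma lhs_eq {γ : ℝ} {θ : ArbElt} {f : ℝ × ℝ → ℂ} {p : ℝ × ℝ} (hf : ContDiffAt ℝ ∞ f p) :
    lhs γ θ f p = Complex.I * fderiv ℝ f p (1, 0) + fderiv ℝ (fderiv ℝ f) p (0, 1) (0, 1)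
      + θ.S γ (p.1, p.2, f p) * f p := by
  have h1 : deriv (fun s : ℝ => f (s, p.2)) p.1 = fderiv ℝ f p (1, 0) := by
    have hc : HasDerivAt (fun s : ℝ => ((s, p.2) : ℝ × ℝ)) (1, 0) p.1 :=
      (hasDerivAt_id p.1).prodMk (hasDerivAt_const p.1 p.2)
    have := deriv_comp_curve (h := f) (c := fun s : ℝ => ((s, p.2) : ℝ × ℝ)) (s := p.1)
      (hf.differentiableAt (by simp)) hc.differentiableAt
    rw [this, hc.deriv]
  have hc : ∀ y, HasDerivAt (fun y : ℝ => ((p.1, y) : ℝ × ℝ)) (0, 1) y := fun y =>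
      (hasDerivAt_const y p.1).prodMk (hasDerivAt_id y)
  have hc' : deriv (fun y : ℝ => ((p.1, y) : ℝ × ℝ)) = fun _ => (0, 1) :=
    funext fun y => (hc y).deriv
  have h2 : deriv (fun y : ℝ => deriv (fun y' : ℝ => f (p.1, y')) y) p.2
      = fderiv ℝ (fderiv ℝ f) p (0, 1) (0, 1) := by
    have := deriv_deriv_comp_curve (h := f) (c := fun y : ℝ => ((p.1, y) : ℝ × ℝ)) (s := p.2)
      hf (by fun_prop)
    rw [hc'] at this
    simpa using this
  unfold lhs ArbElt.S
  rw [h1, h2]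
  simp only [base]
  ring

lemma hasFDerivAt_graph {φ : Pt → Pt} {f : ℝ × ℝ → ℂ} {p : ℝ × ℝ}
    (hφ : ContDiffAt ℝ ∞ φ (p.1, p.2, f p)) (hf : ContDiffAt ℝ ∞ f p) :
    HasFDerivAt (fun q : ℝ × ℝ => φ (q.1, q.2, f q))
      ((fderiv ℝ φ (p.1, p.2, f p)).comp
        ((ContinuousLinearMap.fst ℝ ℝ ℝ).prod
          ((ContinuousLinearMap.snd ℝ ℝ ℝ).prod (fderiv ℝ f p)))) p := by
  have h1 : HasFDerivAt (fun q : ℝ × ℝ => ((q.1, q.2, f q) : Pt))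
      ((ContinuousLinearMap.fst ℝ ℝ ℝ).prod
          ((ContinuousLinearMap.snd ℝ ℝ ℝ).prod (fderiv ℝ f p))) p :=
    hasFDerivAt_fst.prodMk (hasFDerivAt_snd.prodMk (hasFDerivAt_of_smooth hf))
  have h2 : HasFDerivAt φ (fderiv ℝ φ (p.1, p.2, f p))
      ((fun q : ℝ × ℝ => ((q.1, q.2, f q) : Pt)) p) := hasFDerivAt_of_smooth hφ
  exact h2.comp p h1

/-- The second prolongation of a point transformation, evaluated on the left-hand side of the
equation. -/
lemma lhs_image {γ : ℝ} {θ' : ArbElt} {φ : Pt → Pt} {f g : ℝ × ℝ → ℂ} {p : ℝ × ℝ}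
    (hφ : ContDiffAt ℝ ∞ φ (p.1, p.2, f p)) (hf : ContDiffAt ℝ ∞ f p)
    (hg : ContDiffAt ℝ ∞ g (base (φ (p.1, p.2, f p))))
    (hfg : GraphMapsTo φ (p.1, p.2, f p) f g) (e k : ℝ × ℝ)
    (he : base (fderiv ℝ φ (p.1, p.2, f p) (lift f p e)) = (0, 1))
    (hk : base (fderiv ℝ φ (p.1, p.2, f p) (lift f p k)) = (1, 0)) :
    lhs γ θ' g (base (φ (p.1, p.2, f p)))
      = Complex.I * (fderiv ℝ φ (p.1, p.2, f p) (lift f p k)).2.2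
        + ((fderiv ℝ (fderiv ℝ φ) (p.1, p.2, f p) (lift f p e) (lift f p e)
            + fderiv ℝ φ (p.1, p.2, f p) (0, 0, fderiv ℝ (fderiv ℝ f) p e e)).2.2
          - (fderiv ℝ (fderiv ℝ φ) (p.1, p.2, f p) (lift f p e) (lift f p e)
            + fderiv ℝ φ (p.1, p.2, f p) (0, 0, fderiv ℝ (fderiv ℝ f) p e e)).1
            • (fderiv ℝ φ (p.1, p.2, f p) (lift f p k)).2.2
          - (fderiv ℝ (fderiv ℝ φ) (p.1, p.2, f p) (lift f p e) (lift f p e)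
            + fderiv ℝ φ (p.1, p.2, f p) (0, 0, fderiv ℝ (fderiv ℝ f) p e e)).2.1
            • (fderiv ℝ φ (p.1, p.2, f p) (lift f p e)).2.2)
        + θ'.S γ (φ (p.1, p.2, f p)) * (φ (p.1, p.2, f p)).2.2 := by
  have hlift : ContDiffAt ℝ ∞ (fun q : ℝ × ℝ => ((q.1, q.2, f q) : Pt)) p :=
    contDiffAt_fst.prodMk (contDiffAt_snd.prodMk hf)
  have hgraph : ∀ᶠ q in 𝓝 p, (φ (q.1, q.2, f q)).2.2 = g (base (φ (q.1, q.2, f q))) := by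
    have := hlift.continuousAt.eventually hfg
    filter_upwards [this] with q hq
    exact hq.1 rfl
  have hval := hgraph.self_of_nhds
  -- curves on the graph
  have hline : ∀ w : ℝ × ℝ, Filter.Tendsto (fun r : ℝ => p + r • w) (𝓝 0) (𝓝 p) := by
    intro w
    have : ContinuousAt (fun r : ℝ => p + r • w) 0 := by fun_prop
    simpa [ContinuousAt] using this
  let c : ℝ × ℝ → ℝ → Pt := fun w r => ((p + r • w).1, (p + r • w).2, f (p + r • w))
  have hc0 : ∀ w, c w 0 = (p.1, p.2, f p) := by intro w; simp [c]
  have hcs : ∀ w, ContDiffAt ℝ ∞ (c w) 0 := by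
    intro w
    have : ContDiffAt ℝ ∞ (fun q : ℝ × ℝ => ((q.1, q.2, f q) : Pt)) (p + (0:ℝ) • w) := by
      simpa using hlift
    exact this.comp (0:ℝ) (smooth_line p w 0)
  have hcd : ∀ w, deriv (c w) 0 = lift f p w := by
    intro w
    have h1 : HasDerivAt (fun r : ℝ => f (p + r • w)) (fderiv ℝ f p w) 0 :=
      hasDerivAt_comp_line (hf.differentiableAt (by simp)) w
    have h2 := hasDerivAt_line p w 0
    have h3 : HasDerivAt (c w) (w.1, w.2, fderiv ℝ f p w) 0 := by
      refine HasDerivAt.prodMk ?_ (HasDerivAt.prodMk ?_ h1)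
      · exact (hasFDerivAt_fst (p := p + (0:ℝ) • w)).comp_hasDerivAt 0 h2
      · exact (hasFDerivAt_snd (p := p + (0:ℝ) • w)).comp_hasDerivAt 0 h2
    exact h3.deriv
  have hcdd : ∀ w, deriv (deriv (c w)) 0 = (0, 0, fderiv ℝ (fderiv ℝ f) p w w) := by
    intro w
    have h0 : deriv (c w) =ᶠ[𝓝 0] fun r => (w.1, w.2, fderiv ℝ f (p + r • w) w) := by
      filter_upwards [(hline w).eventually (eventually_smooth hf)] with r hr
      have h2 := hasDerivAt_line p w r
      refine (HasDerivAt.prodMk ?_ (HasDerivAt.prodMk ?_ ?_)).deriv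
      · exact (hasFDerivAt_fst (p := p + r • w)).comp_hasDerivAt r h2
      · exact (hasFDerivAt_snd (p := p + r • w)).comp_hasDerivAt r h2
      · exact hr.hasFDerivAt.comp_hasDerivAt r h2
    rw [h0.deriv_eq]
    refine (HasDerivAt.prodMk (hasDerivAt_const _ _)
      (HasDerivAt.prodMk (hasDerivAt_const _ _) ?_)).deriv
    have h3 := hasFDerivAt_fderiv_apply hf w
    have h4 := hasDerivAt_comp_line h3.differentiableAt w
    rw [h3.fderiv] at h4
    simpa using h4
  let G : ℝ × ℝ → ℝ → Pt := fun w r => φ (c w r)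
  have hφ' : ∀ w, ContDiffAt ℝ ∞ φ (c w 0) := by intro w; rw [hc0]; exact hφ
  have hGs : ∀ w, ContDiffAt ℝ ∞ (G w) 0 := fun w => (hφ' w).comp (0:ℝ) (hcs w)
  have hG0 : ∀ w, G w 0 = φ (p.1, p.2, f p) := by intro w; simp only [G, hc0]
  have hGd : ∀ w, deriv (G w) 0 = fderiv ℝ φ (p.1, p.2, f p) (lift f p w) := by
    intro w
    have := deriv_comp_curve (h := φ) (c := c w) (s := 0) ((hφ' w).differentiableAt (by simp))
      ((hcs w).differentiableAt (by simp))
    rw [hc0, hcd] at this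
    exact this
  have hGdd : ∀ w, deriv (deriv (G w)) 0
      = fderiv ℝ (fderiv ℝ φ) (p.1, p.2, f p) (lift f p w) (lift f p w)
        + fderiv ℝ φ (p.1, p.2, f p) (0, 0, fderiv ℝ (fderiv ℝ f) p w w) := by
    intro w
    have := deriv_deriv_comp_curve (h := φ) (c := c w) (s := 0) (hφ' w) (hcs w)
    rw [hc0, hcd, hcdd] at this
    exact this
  have hcomp : ∀ w, (fun r => (G w r).2.2) =ᶠ[𝓝 0] fun r => g (base (G w r)) := by
    intro w
    filter_upwards [(hline w).eventually hgraph] with r hr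
    exact hr
  let L3 : Pt →L[ℝ] ℂ := (ContinuousLinearMap.snd ℝ ℝ ℂ).comp (ContinuousLinearMap.snd ℝ ℝ (ℝ × ℂ))
  let Lb : Pt →L[ℝ] ℝ × ℝ := (ContinuousLinearMap.fst ℝ ℝ (ℝ × ℂ)).prod
    ((ContinuousLinearMap.fst ℝ ℝ ℂ).comp (ContinuousLinearMap.snd ℝ ℝ (ℝ × ℂ)))
  have hLb : ∀ y, Lb y = base y := fun y => rfl
  have hlin : ∀ {H : Type} [NormedAddCommGroup H] [NormedSpace ℝ H] (L : Pt →L[ℝ] H) (w : ℝ × ℝ),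
      deriv (deriv (fun r => L (G w r))) 0 = L (deriv (deriv (G w)) 0)
      ∧ deriv (fun r => L (G w r)) 0 = L (deriv (G w) 0) := by
    intro H _ _ L w
    constructor
    · have := deriv_deriv_comp_curve (h := L) (c := G w) (s := 0) L.contDiff.contDiffAt (hGs w)
      rw [this]
      have h1 : fderiv ℝ (fderiv ℝ L) = 0 := by
        have : fderiv ℝ L = fun _ => L := funext fun y => L.fderiv
        rw [this]; ext1 y; simp
      simp [h1]
    · have := deriv_comp_curve (h := L) (c := G w) (s := 0) L.differentiableAt
        ((hGs w).differentiableAt (by simp))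
      rw [this]; simp
  have hbs : ∀ w, ContDiffAt ℝ ∞ (fun r => base (G w r)) 0 := fun w =>
    Lb.contDiff.contDiffAt.comp (0:ℝ) (hGs w)
  have hg' : ∀ w, ContDiffAt ℝ ∞ g (base (G w 0)) := by intro w; rw [hG0]; exact hg
  -- Differentiating `ψ̃ = g(t̃, x̃)` once along the image curve; the directions `e` and `k` will
  -- give `g_x` and `g_t`.
  have first : ∀ w, (fderiv ℝ φ (p.1, p.2, f p) (lift f p w)).2.2
      = fderiv ℝ g (base (φ (p.1, p.2, f p)))
          (base (fderiv ℝ φ (p.1, p.2, f p) (lift f p w))) := by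
    intro w
    have h1 := (hcomp w).deriv_eq
    have h2 := (hlin L3 w).2
    have h3 := (hlin Lb w).2
    have h4 := deriv_comp_curve (h := g) (c := fun r => base (G w r)) (s := 0)
      ((hg' w).differentiableAt (by simp)) ((hbs w).differentiableAt (by simp))
    rw [hGd] at h2 h3
    simp only [hLb] at h3
    rw [h4, h3, hG0] at h1
    rw [← h1]
    exact h2.symm
  -- The base curve has velocity `(0, 1)` by `he`, so its second derivative sees only `g_xx` and,
  -- through the acceleration, the gradient of `g`.
  have second : (deriv (deriv (G e)) 0).2.2
      = fderiv ℝ (fderiv ℝ g) (base (φ (p.1, p.2, f p))) (0, 1) (0, 1)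
        + fderiv ℝ g (base (φ (p.1, p.2, f p))) (base (deriv (deriv (G e)) 0)) := by
    have h1 := (hcomp e).deriv.deriv_eq
    have h2 := (hlin L3 e).1
    have h3 := (hlin Lb e).1
    have h3' := (hlin Lb e).2
    have h4 := deriv_deriv_comp_curve (h := g) (c := fun r => base (G e r)) (s := 0)
      (hg' e) (hbs e)
    rw [hGd] at h3'
    simp only [hLb] at h3 h3'
    rw [h4, h3, h3', hG0, he] at h1
    rw [← h1]
    exact h2.symm
  have fe := first e
  have fk := first k
  rw [he] at fe
  rw [hk] at fk
  rw [lhs_eq hg, fe, fk, ← hGdd e, second, hval]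
  set Y := deriv (deriv (G e)) 0
  -- The acceleration is resolved along the coordinate axes, so that the gradient of `g` is
  -- expressed by `fe` and `fk`; these are the subtracted terms.
  have hY : base Y = Y.1 • ((1, 0) : ℝ × ℝ) + Y.2.1 • ((0, 1) : ℝ × ℝ) := by
    simp [base]
  rw [hY, map_add, map_smul, map_smul]
  have : (((base (φ (p.1, p.2, f p))).1, (base (φ (p.1, p.2, f p))).2,
      g (base (φ (p.1, p.2, f p)))) : Pt) = φ (p.1, p.2, f p) := by
    rw [← hval]; rfl
  rw [this]
  ring

end NSchE

/-! ### Images of graphs and the pointwise form of admissibility -/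

namespace NSchE

/-- A point transformation maps the graph of `f` to the graph of a smooth function near every
point at which its prolongation to the first-order jet of `f` is defined. -/
lemma exists_graphMapsTo {D : Set Pt} {φ : Pt → Pt} (hφ : IsPointTransformation D φ)
    {f : ℝ × ℝ → ℂ} {p : ℝ × ℝ} (hp : (p.1, p.2, f p) ∈ D) (hf : ContDiffAt ℝ ∞ f p)
    (e k : ℝ × ℝ)
    (he : base (fderiv ℝ φ (p.1, p.2, f p) (lift f p e)) = (0, 1))
    (hk : base (fderiv ℝ φ (p.1, p.2, f p) (lift f p k)) = (1, 0)) :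
    ∃ g : ℝ × ℝ → ℂ, ContDiffAt ℝ ∞ g (base (φ (p.1, p.2, f p))) ∧
      GraphMapsTo φ (p.1, p.2, f p) f g := by
  have hDn : D ∈ 𝓝 ((p.1, p.2, f p) : Pt) := hφ.isOpen.mem_nhds hp
  have hφs : ContDiffAt ℝ ∞ φ (p.1, p.2, f p) := hφ.smooth.contDiffAt hDn
  have hlift : ContDiffAt ℝ ∞ (fun q : ℝ × ℝ => ((q.1, q.2, f q) : Pt)) p :=
    contDiffAt_fst.prodMk (contDiffAt_snd.prodMk hf)
  let Lb : Pt →L[ℝ] ℝ × ℝ := (ContinuousLinearMap.fst ℝ ℝ (ℝ × ℂ)).prod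
    ((ContinuousLinearMap.fst ℝ ℝ ℂ).comp (ContinuousLinearMap.snd ℝ ℝ (ℝ × ℂ)))
  let B : ℝ × ℝ → ℝ × ℝ := fun q => Lb (φ (q.1, q.2, f q))
  have hBs : ContDiffAt ℝ ∞ B p :=
    Lb.contDiff.contDiffAt.comp p (ContDiffAt.comp p (g := φ)
      (f := fun q : ℝ × ℝ => ((q.1, q.2, f q) : Pt)) hφs hlift)
  let B' : ℝ × ℝ →L[ℝ] ℝ × ℝ := Lb.comp ((fderiv ℝ φ (p.1, p.2, f p)).comp
        ((ContinuousLinearMap.fst ℝ ℝ ℝ).prod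
          ((ContinuousLinearMap.snd ℝ ℝ ℝ).prod (fderiv ℝ f p))))
  have hB' : HasFDerivAt B B' p := Lb.hasFDerivAt.comp p (hasFDerivAt_graph hφs hf)
  -- The candidate inverse of the differential of `q ↦ (t̃, x̃)` along the graph, with columns `k`
  -- and `e`. It is visibly a right inverse; finite dimension makes it two-sided.
  let R : ℝ × ℝ →L[ℝ] ℝ × ℝ := (ContinuousLinearMap.fst ℝ ℝ ℝ).smulRight k
    + (ContinuousLinearMap.snd ℝ ℝ ℝ).smulRight e
  have hBe : B' e = (0, 1) := he
  have hBk : B' k = (1, 0) := hk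
  have hBR : ∀ w, B' (R w) = w := by
    intro w
    simp [R, hBe, hBk]
  have hRB : ∀ w, R (B' w) = w := by
    have h1 : (B' : ℝ × ℝ →ₗ[ℝ] ℝ × ℝ) * (R : ℝ × ℝ →ₗ[ℝ] ℝ × ℝ) = 1 := by
      ext1 <;> (ext1; exact hBR _)
    have h2 := mul_eq_one_comm.mp h1
    intro w
    exact LinearMap.congr_fun h2 w
  let Be : (ℝ × ℝ) ≃L[ℝ] (ℝ × ℝ) := ContinuousLinearEquiv.equivOfInverse B' R hRB hBR
  have hBe' : HasFDerivAt B (Be : ℝ × ℝ →L[ℝ] ℝ × ℝ) p := hB'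
  have hstrict := hBs.hasStrictFDerivAt' hBe' (by simp)
  let G := hBs.localInverse hBe' (by simp)
  have hGs : ContDiffAt ℝ ∞ G (B p) := hBs.to_localInverse hBe' (by simp)
  have hGp : G (B p) = p := hBs.localInverse_apply_image hBe' (by simp)
  have hleft : ∀ᶠ q in 𝓝 p, G (B q) = q := hstrict.eventually_left_inverse
  have hright : ∀ᶠ y in 𝓝 (B p), B (G y) = y := hstrict.eventually_right_inverse
  -- The image graph is `ψ̃` along the graph of `f`, reparametrised by the local inverse `G` of
  -- `(t̃, x̃)`.
  refine ⟨fun y => (φ ((G y).1, (G y).2, f (G y))).2.2, ?_, ?_⟩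
  · have h1 : ContDiffAt ℝ ∞ (fun q : ℝ × ℝ => (φ (q.1, q.2, f q)).2.2) (G (B p)) := by
      rw [hGp]
      exact contDiffAt_snd.snd.comp p (ContDiffAt.comp p (g := φ)
        (f := fun q : ℝ × ℝ => ((q.1, q.2, f q) : Pt)) hφs hlift)
    exact h1.comp (B p) hGs
  · have hbase : Filter.Tendsto base (𝓝 ((p.1, p.2, f p) : Pt)) (𝓝 p) := by
      have : Continuous base := by unfold base; fun_prop
      simpa [ContinuousAt, base] using this.continuousAt (x := ((p.1, p.2, f p) : Pt))
    have hbφ : Filter.Tendsto (fun z => Lb (φ z)) (𝓝 ((p.1, p.2, f p) : Pt)) (𝓝 (B p)) :=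
      (Lb.continuous.continuousAt.comp hφs.continuousAt)
    have hGt : Filter.Tendsto G (𝓝 (B p)) (𝓝 p) := by
      simpa [ContinuousAt, hGp] using hGs.continuousAt
    have hDq : ∀ᶠ q in 𝓝 p, ((q.1, q.2, f q) : Pt) ∈ D :=
      hlift.continuousAt.eventually hDn
    filter_upwards [hDn, hbase.eventually hleft, hbφ.eventually hright,
      hbφ.eventually (hGt.eventually hDq)] with z hzD hz1 hz2 hz3
    constructor
    · intro h
      have hz : (((base z).1, (base z).2, f (base z)) : Pt) = z := by rw [← h]; rfl
      have hB : B (base z) = base (φ z) := by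
        change base (φ _) = _
        rw [hz]
      have hG : G (base (φ z)) = base z := by rw [← hB]; exact hz1
      simp only [hG, hz]
    · intro h
      -- The point of the graph of `f` over `G (base (φ z))` has the same image as `z`, and
      -- injectivity on `D` identifies the two points.
      have h1 : φ ((G (base (φ z))).1, (G (base (φ z))).2, f (G (base (φ z)))) = φ z := by
        have h2 : base (φ ((G (base (φ z))).1, (G (base (φ z))).2, f (G (base (φ z)))))
          = base (φ z) := hz2
        have h3 := congrArg Prod.fst h2
        have h4 := congrArg Prod.snd h2
        exact Prod.ext h3 (Prod.ext h4 h.symm)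
      have h2 := hφ.injOn hz3 hzD h1
      have h3 : G (base (φ z)) = base z := congrArg base h2
      rw [← h3]
      exact (congrArg (fun y : Pt => y.2.2) h2).symm

/-- The quadratic polynomial with given Taylor coefficients at `p`. -/
noncomputable def quadratic (p : ℝ × ℝ) (ψ a b c₁ c₂ : ℂ) (q : ℝ × ℝ) : ℂ :=
  ψ + (q.1 - p.1) • a + (q.2 - p.2) • b + ((q.1 - p.1) ^ 2 / 2) • c₁ + ((q.2 - p.2) ^ 2 / 2) • c₂

lemma quadratic_smooth (p : ℝ × ℝ) (ψ a b c₁ c₂ : ℂ) :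
    ContDiff ℝ ∞ (quadratic p ψ a b c₁ c₂) := by
  unfold quadratic
  fun_prop

lemma quadratic_self (p : ℝ × ℝ) (ψ a b c₁ c₂ : ℂ) : quadratic p ψ a b c₁ c₂ p = ψ := by
  simp [quadratic]

lemma deriv_quadratic_line (p : ℝ × ℝ) (ψ a b c₁ c₂ : ℂ) (w : ℝ × ℝ) :
    deriv (fun r : ℝ => quadratic p ψ a b c₁ c₂ (p + r • w))
      = fun r : ℝ => (w.1 • a + w.2 • b) + r • (w.1 ^ 2 • c₁ + w.2 ^ 2 • c₂) := by
  funext r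
  have h1 : (fun r : ℝ => quadratic p ψ a b c₁ c₂ (p + r • w))
      = fun r : ℝ => ψ + r • (w.1 • a + w.2 • b) + (r ^ 2) • (((1:ℝ)/2) • (w.1 ^ 2 • c₁ + w.2 ^ 2 • c₂)) := by
    funext r
    simp only [quadratic, Prod.fst_add, Prod.snd_add, Prod.smul_fst, Prod.smul_snd,
      add_sub_cancel_left, smul_eq_mul, Complex.real_smul]
    push_cast
    ring
  rw [h1]
  have h2 : HasDerivAt (fun r : ℝ => ψ + r • (w.1 • a + w.2 • b)) ((1 : ℝ) • (w.1 • a + w.2 • b)) r :=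
    ((hasDerivAt_id r).smul_const _).const_add ψ
  have h3 := (hasDerivAt_pow 2 r).smul_const (((1:ℝ)/2) • (w.1 ^ 2 • c₁ + w.2 ^ 2 • c₂))
  refine (h2.add h3).deriv.trans ?_
  simp only [Complex.real_smul]
  push_cast
  ring

lemma fderiv_quadratic (p : ℝ × ℝ) (ψ a b c₁ c₂ : ℂ) (w : ℝ × ℝ) :
    fderiv ℝ (quadratic p ψ a b c₁ c₂) p w = w.1 • a + w.2 • b := by
  rw [← deriv_comp_line ((quadratic_smooth p ψ a b c₁ c₂).differentiable (by simp) p),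
    deriv_quadratic_line]
  simp

lemma fderiv_fderiv_quadratic (p : ℝ × ℝ) (ψ a b c₁ c₂ : ℂ) (w : ℝ × ℝ) :
    fderiv ℝ (fderiv ℝ (quadratic p ψ a b c₁ c₂)) p w w = w.1 ^ 2 • c₁ + w.2 ^ 2 • c₂ := by
  rw [← deriv_deriv_comp_line (quadratic_smooth p ψ a b c₁ c₂).contDiffAt, deriv_quadratic_line]
  have h3 := ((hasDerivAt_id (0:ℝ)).smul_const (w.1 ^ 2 • c₁ + w.2 ^ 2 • c₂)).const_add
    (w.1 • a + w.2 • b)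
  simpa using h3.deriv

/-- The condition of admissibility in terms of 2-jets. -/
lemma IsAdmissible.jet {γ : ℝ} {θ θ' : ArbElt} {D : Set Pt} {φ : Pt → Pt}
    (hA : IsAdmissible γ θ θ' D φ) {z : Pt} (hz : z ∈ D) (a b c₁ c₂ : ℂ) {e k : ℝ × ℝ} {ve vk : Pt}
    {L : Pt →L[ℝ] Pt} {D2 : Pt →L[ℝ] Pt →L[ℝ] Pt} (hL : fderiv ℝ φ z = L)
    (hD2 : fderiv ℝ (fderiv ℝ φ) z = D2)
    (hve : ve = (e.1, e.2, e.1 • a + e.2 • b)) (hvk : vk = (k.1, k.2, k.1 • a + k.2 • b))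
    (he : base (L ve) = (0, 1)) (hk : base (L vk) = (1, 0)) {Y : Pt}
    (hY : Y = D2 ve ve + L (0, 0, e.1 ^ 2 • c₁ + e.2 ^ 2 • c₂)) :
    (Complex.I * a + c₂ + θ.S γ z * z.2.2 = 0) ↔
      Complex.I * (L vk).2.2
        + (Y.2.2 - Y.1 • (L vk).2.2 - Y.2.1 • (L ve).2.2)
        + θ'.S γ (φ z) * (φ z).2.2 = 0 := by
  subst hL hD2
  set p : ℝ × ℝ := (z.1, z.2.1) with hp
  -- The mixed derivative of this representative is zero: the necessary conditions drawn later only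
  -- need `a`, `b`, `c₁`, `c₂` to be free.
  set f := quadratic p z.2.2 a b c₁ c₂ with hf
  have hfp : f p = z.2.2 := quadratic_self ..
  have hzf : ((p.1, p.2, f p) : Pt) = z := by rw [hfp]
  have hl : ∀ w, lift f p w = (w.1, w.2, w.1 • a + w.2 • b) := by
    intro w; rw [lift, fderiv_quadratic]
  have hfs : ContDiffAt ℝ ∞ f p := (quadratic_smooth ..).contDiffAt
  have hDn : D ∈ 𝓝 z := hA.transformation.isOpen.mem_nhds hz
  have he' : base (fderiv ℝ φ (p.1, p.2, f p) (lift f p e)) = (0, 1) := by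
    rw [hzf, hl, ← hve, he]
  have hk' : base (fderiv ℝ φ (p.1, p.2, f p) (lift f p k)) = (1, 0) := by
    rw [hzf, hl, ← hvk, hk]
  obtain ⟨g, hg, hfg⟩ := exists_graphMapsTo hA.transformation (by rw [hzf]; exact hz) hfs e k he' hk'
  have h1 := hA.maps p f g (by rw [hzf]; exact hz) hfs hg hfg
  have h2 := lhs_image (γ := γ) (θ' := θ') (by rw [hzf]; exact hA.transformation.smooth.contDiffAt hDn)
    hfs hg hfg e k he' hk'
  rw [h2, lhs_eq hfs, fderiv_fderiv_quadratic, fderiv_quadratic, fderiv_fderiv_quadratic] at h1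
  rw [hl, hl, ← hve, ← hvk, hzf, hfp, ← hY] at h1
  simpa using h1

end NSchE

/-! ### The new time variable and the determining equation -/

namespace NSchE

section LinearMaps

variable {E : Type*} [NormedAddCommGroup E] [NormedSpace ℝ E] [FiniteDimensional ℝ E]

lemma injective_of_det_ne_zero {L : E →L[ℝ] E} (hL : L.det ≠ 0) : Function.Injective L := by
  have h : IsUnit (L : E →ₗ[ℝ] E) :=
    LinearMap.isUnit_iff_isUnit_det _ |>.2 (isUnit_iff_ne_zero.2 hL)
  exact ((Module.End.isUnit_iff _).1 h).1

lemma surjective_of_det_ne_zero {L : E →L[ℝ] E} (hL : L.det ≠ 0) : Function.Surjective L := by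
  have h : IsUnit (L : E →ₗ[ℝ] E) :=
    LinearMap.isUnit_iff_isUnit_det _ |>.2 (isUnit_iff_ne_zero.2 hL)
  exact ((Module.End.isUnit_iff _).1 h).2

lemma det_ne_zero_of_ker {L : E →L[ℝ] E} (hL : ∀ v, L v = 0 → v = 0) : L.det ≠ 0 := by
  intro h
  have h1 := LinearMap.bot_lt_ker_of_det_eq_zero (f := (L : E →ₗ[ℝ] E)) h
  refine h1.ne' ?_
  rw [LinearMap.ker_eq_bot']
  exact hL

end LinearMaps

/-- The vertical part of the differential of a point transformation is nondegenerate. -/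
lemma vertical_eq_zero {L : Pt →L[ℝ] Pt} (hL : Function.Injective L) {e k : ℝ × ℝ} {ve vk : Pt}
    {a b : ℂ} (hve : ve = (e.1, e.2, e.1 • a + e.2 • b)) (hvk : vk = (k.1, k.2, k.1 • a + k.2 • b))
    (he : base (L ve) = (0, 1)) (hk : base (L vk) = (1, 0)) {c : ℂ}
    (hc : (L (0, 0, c)).2.2 - (L (0, 0, c)).1 • (L vk).2.2 - (L (0, 0, c)).2.1 • (L ve).2.2 = 0) :
    c = 0 := by
  set y := L (0, 0, c) with hy
  simp only [base, Prod.mk.injEq] at he hk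
  -- By `hc` the image of the vertical vector lies in the span of `L vk` and `L ve`. Pulled back by
  -- injectivity, the vertical vector lies in the tangent plane of a graph, which forces `c = 0`.
  have h1 : L (0, 0, c) = L (y.1 • vk + y.2.1 • ve) := by
    rw [← hy, map_add, map_smul, map_smul]
    refine Prod.ext ?_ (Prod.ext ?_ ?_)
    · simp [he.1, hk.1]
    · simp [he.2, hk.2]
    · simp only [Prod.snd_add, Prod.smul_snd]
      linear_combination hc
  have h2 := hL h1
  subst hve hvk
  have ht := congrArg Prod.fst h2
  have hx := congrArg (fun w : Pt => w.2.1) h2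
  have hψ := congrArg (fun w : Pt => w.2.2) h2
  simp only [Prod.fst_add, Prod.snd_add, Prod.smul_fst, Prod.smul_snd, smul_eq_mul] at ht hx hψ
  rw [hψ]
  have ht' : (y.1 : ℂ) * k.1 + y.2.1 * e.1 = 0 := by exact_mod_cast ht.symm
  have hx' : (y.1 : ℂ) * k.2 + y.2.1 * e.2 = 0 := by exact_mod_cast hx.symm
  simp only [Complex.real_smul]
  linear_combination a * ht' + b * hx'

namespace IsAdmissible

variable {γ : ℝ} {θ θ' : ArbElt} {D : Set Pt} {φ : Pt → Pt} {z : Pt}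

lemma smooth (hA : IsAdmissible γ θ θ' D φ) (hz : z ∈ D) : ContDiffAt ℝ ∞ φ z :=
  hA.transformation.smooth.contDiffAt (hA.transformation.isOpen.mem_nhds hz)

lemma injective (hA : IsAdmissible γ θ θ' D φ) (hz : z ∈ D) :
    Function.Injective (fderiv ℝ φ z) :=
  injective_of_det_ne_zero (hA.transformation.jacobian z hz)

lemma surjective (hA : IsAdmissible γ θ θ' D φ) (hz : z ∈ D) :
    Function.Surjective (fderiv ℝ φ z) :=
  surjective_of_det_ne_zero (hA.transformation.jacobian z hz)

/-- The derivative `ψ_tt` does not occur in the first equation, but enters the prolonged second one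
with the factor `e.1 ^ 2`, where `e` is the direction sent to `∂/∂x̃`. A nonzero `t̃`-component
along `(0, 1, b)` would make `e.1` nonzero whenever the prolongation is defined. -/
lemma time_aux (hA : IsAdmissible γ θ θ' D φ) (hz : z ∈ D) (b : ℂ) :
    (fderiv ℝ φ z (0, 1, b)).1 = 0 := by
  by_contra hv
  have hinj := hA.injective hz
  have hsurj := hA.surjective hz
  generalize hL : fderiv ℝ φ z = L at *
  obtain ⟨v, hvdef⟩ : ∃ v : Pt, v = (0, 1, b) := ⟨_, rfl⟩
  rw [← hvdef] at hv
  -- If the Jacobian `J` of `(t̃, x̃)` along the graph were nonzero, Cramer's rule would give `e`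
  -- and `k`, and comparing `c₁ = 0` with `c₁ = 1` would contradict `vertical_eq_zero`. So `J`
  -- vanishes for every `a`.
  have key : ∀ a : ℂ, (L (1, 0, a)).1 * (L v).2.1 - (L v).1 * (L (1, 0, a)).2.1 = 0 := by
    intro a
    by_contra hJ
    obtain ⟨u, hu⟩ : ∃ u : Pt, u = (1, 0, a) := ⟨_, rfl⟩
    rw [← hu] at hJ
    obtain ⟨J, hJdef⟩ : ∃ J, J = (L u).1 * (L v).2.1 - (L v).1 * (L u).2.1 := ⟨_, rfl⟩
    rw [← hJdef] at hJ
    have hve : (-(L v).1 / J) • u + ((L u).1 / J) • v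
        = (-(L v).1 / J, (L u).1 / J, (-(L v).1 / J) • a + ((L u).1 / J) • b) := by
      rw [hu, hvdef]; simp
    have hvk : ((L v).2.1 / J) • u + (-(L u).2.1 / J) • v
        = ((L v).2.1 / J, -(L u).2.1 / J, ((L v).2.1 / J) • a + (-(L u).2.1 / J) • b) := by
      rw [hu, hvdef]; simp
    have he : base (L ((-(L v).1 / J) • u + ((L u).1 / J) • v)) = (0, 1) := by
      rw [map_add, map_smul, map_smul]
      simp only [base, Prod.fst_add, Prod.snd_add, Prod.smul_fst, Prod.smul_snd, smul_eq_mul]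
      refine Prod.ext ?_ ?_
      · simp only; ring
      · simp only
        rw [← div_self hJ, div_mul_eq_mul_div, div_mul_eq_mul_div, ← add_div]
        congr 1
        rw [hJdef]; ring
    have hk : base (L (((L v).2.1 / J) • u + (-(L u).2.1 / J) • v)) = (1, 0) := by
      rw [map_add, map_smul, map_smul]
      simp only [base, Prod.fst_add, Prod.snd_add, Prod.smul_fst, Prod.smul_snd, smul_eq_mul]
      refine Prod.ext ?_ ?_
      · simp only
        rw [← div_self hJ, div_mul_eq_mul_div, div_mul_eq_mul_div, ← add_div]
        congr 1
        rw [hJdef]; ring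
      · simp only; ring
    -- The value of `c₂` is dictated by the first equation; `c₁` stays free.
    have h := fun c₁ : ℂ => (hA.jet hz a b c₁ (-Complex.I * a - θ.S γ z * z.2.2)
      (e := (-(L v).1 / J, (L u).1 / J)) (k := ((L v).2.1 / J, -(L u).2.1 / J))
      hL rfl hve hvk he hk rfl).1 (by ring)
    have h0 := h 0
    have h1 := h 1
    have hq : ((0, 0, (-(L v).1 / J) ^ 2 • (1 : ℂ) + ((L u).1 / J) ^ 2 •
          (-Complex.I * a - θ.S γ z * z.2.2)) : Pt)
        = (0, 0, (-(L v).1 / J) ^ 2 • (0 : ℂ) + ((L u).1 / J) ^ 2 •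
          (-Complex.I * a - θ.S γ z * z.2.2)) + (0, 0, ((((-(L v).1 / J) ^ 2 : ℝ)) : ℂ)) := by
      simp [add_comm]
    have hq' := congrArg L hq
    rw [map_add] at hq'
    simp only [hq'] at h1
    simp only [Prod.fst_add, Prod.snd_add, add_smul] at h0 h1
    have h2 := vertical_eq_zero (c := ((((-(L v).1 / J) ^ 2 : ℝ)) : ℂ)) hinj
      (e := (-(L v).1 / J, (L u).1 / J)) (k := ((L v).2.1 / J, -(L u).2.1 / J)) hve hvk he hk (by
        linear_combination h1 - h0)
    have h3 : (-(L v).1 / J) ^ 2 = 0 := by exact_mod_cast h2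
    have h4 : -(L v).1 / J ≠ 0 := div_ne_zero (neg_ne_zero.2 hv) hJ
    exact h4 (by simpa using h3)
  -- Vectors `(1, 0, a)` and `v` span everything, so the vanishing of `J` extends to all `w`; at a
  -- preimage of `∂/∂x̃` it reads `(L v).1 = 0`.
  obtain ⟨w, hw⟩ := hsurj (0, 1, 0)
  have hwdec : w = w.1 • ((1, 0, 0) : Pt) + w.2.1 • v
      + (((1, 0, w.2.2 - w.2.1 • b) : Pt) - (1, 0, 0)) := by
    refine Prod.ext ?_ (Prod.ext ?_ ?_) <;> simp [hvdef]
  have h1 := key 0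
  have h2 := key (w.2.2 - w.2.1 • b)
  have h3 : (L w).1 * (L v).2.1 - (L v).1 * (L w).2.1 = 0 := by
    rw [hwdec, map_add, map_add, map_smul, map_smul, map_sub]
    simp only [Prod.fst_add, Prod.snd_add, Prod.smul_fst, Prod.smul_snd, Prod.fst_sub,
      Prod.snd_sub, smul_eq_mul]
    linear_combination (w.1 - 1) * h1 + h2
  rw [hw] at h3
  simp at h3
  exact hv h3

/-- The new time variable depends on the time variable only. -/
lemma time_vertical (hA : IsAdmissible γ θ θ' D φ) (hz : z ∈ D) (x : ℝ) (c : ℂ) :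
    (fderiv ℝ φ z (0, x, c)).1 = 0 := by
  have h : ((0, x, c) : Pt) = x • (0, 1, 0) + (((0, 1, c) : Pt) - (0, 1, 0)) := by
    refine Prod.ext ?_ (Prod.ext ?_ ?_) <;> simp
  rw [h, map_add, map_smul, map_sub]
  simp [hA.time_aux hz]

lemma time_ne_zero (hA : IsAdmissible γ θ θ' D φ) (hz : z ∈ D) :
    (fderiv ℝ φ z (1, 0, 0)).1 ≠ 0 := by
  intro h
  obtain ⟨w, hw⟩ := hA.surjective hz (1, 0, 0)
  have hwdec : w = w.1 • ((1, 0, 0) : Pt) + (0, w.2.1, w.2.2) := by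
    refine Prod.ext ?_ (Prod.ext ?_ ?_) <;> simp
  rw [hwdec, map_add, map_smul] at hw
  have := congrArg Prod.fst hw
  simp [h, hA.time_vertical hz] at this

/-- The derivative of a relation between first-order derivatives which holds on `D`. -/
lemma second_eq_zero (hA : IsAdmissible γ θ θ' D φ) (hz : z ∈ D) {H : Type*}
    [NormedAddCommGroup H] [NormedSpace ℝ H] (P : Pt →L[ℝ] H)
    (v : Pt) (h : ∀ y ∈ D, P (fderiv ℝ φ y v) = 0) (w : Pt) :
    P (fderiv ℝ (fderiv ℝ φ) z w v) = 0 := by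
  have h1 := P.hasFDerivAt.comp z (hasFDerivAt_fderiv_apply (hA.smooth hz) v)
  have h2 : (P ∘ fun y => fderiv ℝ φ y v) =ᶠ[𝓝 z] fun _ => 0 := by
    filter_upwards [hA.transformation.isOpen.mem_nhds hz] with y hy using h y hy
  have h3 := h1.unique (h2.hasFDerivAt_iff.2 (hasFDerivAt_const 0 z))
  simpa using DFunLike.congr_fun h3 w

lemma time_second (hA : IsAdmissible γ θ θ' D φ) (hz : z ∈ D) (w : Pt) (x : ℝ) (c : ℂ) :
    (fderiv ℝ (fderiv ℝ φ) z w (0, x, c)).1 = 0 :=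
  hA.second_eq_zero hz (ContinuousLinearMap.fst ℝ ℝ (ℝ × ℂ)) _
    (fun _ hy => hA.time_vertical hy x c) w

/-- The determining equation on the jets of the first equation. -/
lemma determining (hA : IsAdmissible γ θ θ' D φ) (hz : z ∈ D) (a b : ℂ) {ξ : ℝ} {m : ℂ}
    (hξ : ξ = (fderiv ℝ φ z (0, 1, b)).2.1) (hξ0 : ξ ≠ 0)
    (hm : m = ξ⁻¹ • (fderiv ℝ φ z (0, 1, b)).2.2) :
    Complex.I * ((fderiv ℝ φ z (1, 0, 0)).1⁻¹ • ((fderiv ℝ φ z (1, 0, a)).2.2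
          - (fderiv ℝ φ z (1, 0, a)).2.1 • m))
      + (ξ ^ 2)⁻¹ • ((fderiv ℝ (fderiv ℝ φ) z (0, 1, b) (0, 1, b)).2.2
          - (fderiv ℝ (fderiv ℝ φ) z (0, 1, b) (0, 1, b)).2.1 • m
          + ((fderiv ℝ φ z (0, 0, -Complex.I * a - θ.S γ z * z.2.2)).2.2
            - (fderiv ℝ φ z (0, 0, -Complex.I * a - θ.S γ z * z.2.2)).2.1 • m))
      + θ'.S γ (φ z) * (φ z).2.2 = 0 := by
  have hT := hA.time_ne_zero hz
  have hvert := hA.time_vertical hz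
  have hsec := hA.time_second hz
  generalize hL : fderiv ℝ φ z = L at *
  generalize hD2 : fderiv ℝ (fderiv ℝ φ) z = D2 at *
  set v : Pt := (0, 1, b) with hv
  set u : Pt := (1, 0, a) with hu
  set T' := (L (1, 0, 0)).1
  have hu1 : (L u).1 = T' := by
    have : u = (1, 0, 0) + (0, 0, a) := by simp [hu]
    rw [this, map_add]
    simp [hvert, T']
  have hv1 : (L v).1 = 0 := hvert 1 b
  have hve : ξ⁻¹ • v = (0, ξ⁻¹, (0 : ℝ) • a + ξ⁻¹ • b) := by simp [hv]
  have hvk : T'⁻¹ • u + (-(L u).2.1 / (T' * ξ)) • v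
      = (T'⁻¹, -(L u).2.1 / (T' * ξ), T'⁻¹ • a + (-(L u).2.1 / (T' * ξ)) • b) := by
    simp [hu, hv]
  have he : base (L (ξ⁻¹ • v)) = (0, 1) := by
    rw [map_smul]
    simp [base, hv1, ← hξ, hξ0]
  have hk : base (L (T'⁻¹ • u + (-(L u).2.1 / (T' * ξ)) • v)) = (1, 0) := by
    rw [map_add, map_smul, map_smul]
    refine Prod.ext ?_ ?_
    · simp [base, hv1, hu1, hT]
    · simp [base, ← hξ]; field_simp; ring
  -- Since `t̃` depends on `t` alone, `e` has no `t`-component and `ψ_tt` drops out, so `c₁ = 0`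
  -- loses nothing.
  have h := (hA.jet hz a b 0 (-Complex.I * a - θ.S γ z * z.2.2)
      (e := (0, ξ⁻¹)) (k := (T'⁻¹, -(L u).2.1 / (T' * ξ)))
      hL hD2 hve hvk he hk rfl).1 (by ring)
  have hq : ((0, 0, (0 : ℝ) ^ 2 • (0 : ℂ) + (ξ⁻¹) ^ 2 • (-Complex.I * a - θ.S γ z * z.2.2)) : Pt)
      = ((ξ ^ 2)⁻¹) • (0, 0, -Complex.I * a - θ.S γ z * z.2.2) := by
    simp
  simp only [hq, map_add, map_smul, smul_apply] at h
  have hs1 : (D2 v v).1 = 0 := hsec v 1 b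
  have hs2 := hvert 0 (-Complex.I * a - θ.S γ z * z.2.2)
  have hξc : (ξ : ℂ) ≠ 0 := by exact_mod_cast hξ0
  have hm' : (ξ : ℂ) * m = (L v).2.2 := by
    rw [hm, Complex.real_smul, Complex.ofReal_inv, mul_inv_cancel_left₀ hξc]
  have hTc : (T' : ℂ) ≠ 0 := by exact_mod_cast hT
  simp only [Prod.fst_add, Prod.snd_add, Prod.smul_fst, Prod.smul_snd, hs1, hs2, smul_eq_mul,
    mul_zero, add_zero, zero_smul, sub_zero, Complex.real_smul] at h
  simp only [Complex.real_smul]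
  rw [← h, ← hm']
  push_cast
  field_simp
  ring

end IsAdmissible

end NSchE

/-! ### The new space variable and splitting with respect to derivatives -/

namespace NSchE

namespace IsAdmissible

variable {γ : ℝ} {θ θ' : ArbElt} {D : Set Pt} {φ : Pt → Pt} {z : Pt}

/-- Here `a` is the value of `ψ_t`, which also enters through `ψ_xx = -i a - Sψ`. Subtracting the
determining equations for `a` and for `0` removes everything else. -/
lemma space_aux (hA : IsAdmissible γ θ θ' D φ) (hz : z ∈ D) (b : ℂ) {ξ : ℝ} {m : ℂ}
    (hξ : ξ = (fderiv ℝ φ z (0, 1, b)).2.1) (hξ0 : ξ ≠ 0)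
    (hm : m = ξ⁻¹ • (fderiv ℝ φ z (0, 1, b)).2.2) (a : ℂ) :
    (fderiv ℝ φ z (0, 0, Complex.I * a)).2.2 - (fderiv ℝ φ z (0, 0, Complex.I * a)).2.1 • m
      = (ξ ^ 2 / (fderiv ℝ φ z (1, 0, 0)).1) • (Complex.I * ((fderiv ℝ φ z (0, 0, a)).2.2
          - (fderiv ℝ φ z (0, 0, a)).2.1 • m)) := by
  have h0 := hA.determining hz 0 b hξ hξ0 hm
  have h1 := hA.determining hz a b hξ hξ0 hm
  have hT := hA.time_ne_zero hz
  generalize fderiv ℝ φ z = L at *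
  have e1 : L (1, 0, a) = L (1, 0, 0) + L (0, 0, a) := by rw [← map_add]; simp
  have e2 : L (0, 0, -Complex.I * a - θ.S γ z * z.2.2)
      = L (0, 0, -Complex.I * 0 - θ.S γ z * z.2.2) - L (0, 0, Complex.I * a) := by
    rw [← map_sub]; congr 1; simp; ring
  rw [e1, e2] at h1
  generalize (L (1, 0, 0)).1 = T at *
  have hTc : (T : ℂ) ≠ 0 := by exact_mod_cast hT
  have hξc : (ξ : ℂ) ≠ 0 := by exact_mod_cast hξ0
  simp only [Prod.fst_add, Prod.snd_add, Prod.fst_sub, Prod.snd_sub, Complex.real_smul] at h0 h1 ⊢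
  push_cast at h0 h1 ⊢
  have h2 := sub_eq_zero.2 (h1.trans h0.symm)
  field_simp at h2 ⊢
  linear_combination -h2

/-- Write `M c` for the vertical derivative corrected by the `x̃`-component. By `space_aux`, `M (i
c) = (ξ²/T_t) i M c`; applying this twice and using `i² = -1` gives `(ξ²/T_t)² = 1`, because `M 1 ≠
0`. -/
lemma space_sq_aux (hA : IsAdmissible γ θ θ' D φ) (hz : z ∈ D) (b : ℂ)
    (hξ0 : (fderiv ℝ φ z (0, 1, b)).2.1 ≠ 0) :
    (fderiv ℝ φ z (0, 1, b)).2.1 ^ 2 = |(fderiv ℝ φ z (1, 0, 0)).1| := by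
  have hk := hA.space_aux hz b rfl hξ0 rfl
  have hT := hA.time_ne_zero hz
  have hinj := hA.injective hz
  have hvert := hA.time_vertical hz
  generalize fderiv ℝ φ z = L at *
  have h1 := hk 1
  have h2 := hk Complex.I
  have e2 : L (0, 0, Complex.I * Complex.I) = -L (0, 0, 1) := by
    rw [← map_neg]; simp
  rw [e2] at h2
  rw [mul_one] at h1
  -- If `M 1` vanished, the vertical vector `(0, 0, 1)` and a multiple of `(0, 1, b)` would have the
  -- same image, contrary to injectivity.
  have hM : (L (0, 0, 1)).2.2 - (L (0, 0, 1)).2.1 • (((L (0, 1, b)).2.1)⁻¹ • (L (0, 1, b)).2.2)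
      ≠ 0 := by
    intro h
    have h3 : L (0, 0, 1) = L (((L (0, 0, 1)).2.1 * ((L (0, 1, b)).2.1)⁻¹) • (0, 1, b)) := by
      rw [map_smul]
      refine Prod.ext ?_ (Prod.ext ?_ ?_)
      · simp [hvert]
      · simp [hξ0]
      · rw [sub_eq_zero.1 h, smul_smul]; rfl
    have h4 := hinj h3
    have h5 := congrArg (fun w : Pt => w.2.1) h4
    have h6 := congrArg (fun w : Pt => w.2.2) h4
    simp only [Prod.smul_snd, Prod.smul_fst, smul_eq_mul, mul_one] at h5 h6
    rw [← h5] at h6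
    simp at h6
  generalize hξ : (L (0, 1, b)).2.1 = ξ at *
  generalize (L (1, 0, 0)).1 = T at *
  simp only [Prod.snd_neg, Prod.fst_neg, Complex.real_smul] at h1 h2 hM
  push_cast at h1 h2 hM
  have h3 : (((ξ ^ 2 / T) ^ 2 : ℝ) : ℂ) = 1 := by
    push_cast
    refine mul_right_cancel₀ hM ?_
    linear_combination h2 + ((ξ : ℂ) ^ 2 / T * Complex.I) * h1
      + ((ξ : ℂ) ^ 2 / T) ^ 2 * ((L (0, 0, 1)).2.2
        - (L (0, 0, 1)).2.1 * ((ξ : ℂ)⁻¹ * (L (0, 1, b)).2.2)) * Complex.I_sq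
  have h4 : (ξ ^ 2 / T) ^ 2 = 1 := by exact_mod_cast h3
  have h5 : (ξ ^ 2) ^ 2 = T ^ 2 := by field_simp at h4; linarith
  have h6 := (sq_eq_sq_iff_abs_eq_abs _ _).1 h5
  rwa [abs_of_nonneg (sq_nonneg ξ)] at h6

/-- The new space variable does not depend on `ψ`. -/
lemma space_vertical (hA : IsAdmissible γ θ θ' D φ) (hz : z ∈ D) (c : ℂ) :
    (fderiv ℝ φ z (0, 0, c)).2.1 = 0 := by
  by_contra hc
  have hk := hA.space_sq_aux hz
  generalize fderiv ℝ φ z = L at *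
  set A := |(L (1, 0, 0)).1|
  have hA0 : 0 ≤ A := abs_nonneg _
  -- The derivative `ξ` is affine in `b`. If it really depended on `b` it could be made equal to `2
  -- + A`, but `(2 + A)² > A`.
  have h1 : (L (0, 1, ((2 + A - (L (0, 1, 0)).2.1) / (L (0, 0, c)).2.1) • c)).2.1 = 2 + A := by
    have : ((0, 1, ((2 + A - (L (0, 1, 0)).2.1) / (L (0, 0, c)).2.1) • c) : Pt)
        = (0, 1, 0) + ((2 + A - (L (0, 1, 0)).2.1) / (L (0, 0, c)).2.1) • (0, 0, c) := by simp
    rw [this, map_add, map_smul]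
    simp only [Prod.snd_add, Prod.fst_add, Prod.smul_snd, Prod.smul_fst, smul_eq_mul]
    field_simp
    ring
  have h2 := hk (((2 + A - (L (0, 1, 0)).2.1) / (L (0, 0, c)).2.1) • c) (by rw [h1]; positivity)
  rw [h1] at h2
  nlinarith

lemma space_ne_zero (hA : IsAdmissible γ θ θ' D φ) (hz : z ∈ D) :
    (fderiv ℝ φ z (0, 1, 0)).2.1 ≠ 0 := by
  intro h
  obtain ⟨w, hw⟩ := hA.surjective hz (0, 1, 0)
  have hwdec : w = w.1 • ((1, 0, 0) : Pt) + (0, w.2.1, w.2.2) := by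
    refine Prod.ext ?_ (Prod.ext ?_ ?_) <;> simp
  have hw1 : w.1 = 0 := by
    have h1 := congrArg Prod.fst hw
    rw [hwdec, map_add, map_smul] at h1
    simpa [hA.time_vertical hz, hA.time_ne_zero hz] using h1
  have hwdec' : w = w.2.1 • ((0, 1, 0) : Pt) + (0, 0, w.2.2) := by
    refine Prod.ext ?_ (Prod.ext ?_ ?_) <;> simp [hw1]
  rw [hwdec', map_add, map_smul] at hw
  have := congrArg (fun y : Pt => y.2.1) hw
  simp [h, hA.space_vertical hz] at this

lemma space_sq (hA : IsAdmissible γ θ θ' D φ) (hz : z ∈ D) :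
    (fderiv ℝ φ z (0, 1, 0)).2.1 ^ 2 = |(fderiv ℝ φ z (1, 0, 0)).1| :=
  hA.space_sq_aux hz 0 (hA.space_ne_zero hz)

/-- The new unknown function depends on `ψ` holomorphically or antiholomorphically. -/
lemma vertical_I (hA : IsAdmissible γ θ θ' D φ) (hz : z ∈ D) (c : ℂ) :
    (fderiv ℝ φ z (0, 0, Complex.I * c)).2.2
      = Real.sign (fderiv ℝ φ z (1, 0, 0)).1 • (Complex.I * (fderiv ℝ φ z (0, 0, c)).2.2) := by
  have h := hA.space_aux hz 0 rfl (hA.space_ne_zero hz) rfl c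
  rw [hA.space_vertical hz, hA.space_vertical hz, hA.space_sq hz] at h
  simp only [zero_smul, sub_zero] at h
  rw [h]
  congr 1
  rcases lt_or_gt_of_ne (hA.time_ne_zero hz) with h0 | h0
  · rw [Real.sign_of_neg h0, abs_of_neg h0, neg_div, div_self h0.ne]
  · rw [Real.sign_of_pos h0, abs_of_pos h0, div_self h0.ne']

lemma space_second_vertical (hA : IsAdmissible γ θ θ' D φ) (hz : z ∈ D) (w : Pt) (c : ℂ) :
    (fderiv ℝ (fderiv ℝ φ) z w (0, 0, c)).2.1 = 0 :=
  hA.second_eq_zero hz ((ContinuousLinearMap.fst ℝ ℝ ℂ).comp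
    (ContinuousLinearMap.snd ℝ ℝ (ℝ × ℂ))) _ (fun _ hy => hA.space_vertical hy c) w

/-- By `space_sq`, `x̃_x⁴ = t̃_t²`, and `t̃_t` does not depend on `x`. The fourth power avoids
differentiating an absolute value. -/
lemma space_second (hA : IsAdmissible γ θ θ' D φ) (hz : z ∈ D) :
    (fderiv ℝ (fderiv ℝ φ) z (0, 1, 0) (0, 1, 0)).2.1 = 0 := by
  let P1 : Pt →L[ℝ] ℝ := ContinuousLinearMap.fst ℝ ℝ (ℝ × ℂ)
  let P2 : Pt →L[ℝ] ℝ := (ContinuousLinearMap.fst ℝ ℝ ℂ).comp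
    (ContinuousLinearMap.snd ℝ ℝ (ℝ × ℂ))
  have h1 := (P2.hasFDerivAt.comp z (hasFDerivAt_fderiv_apply (hA.smooth hz) (0, 1, 0))).pow 4
  have h2 := (P1.hasFDerivAt.comp z (hasFDerivAt_fderiv_apply (hA.smooth hz) (1, 0, 0))).pow 2
  have h3 : (fun y => (P2 ∘ fun y => fderiv ℝ φ y (0, 1, 0)) y ^ 4) =ᶠ[𝓝 z]
      (fun y => (P1 ∘ fun y => fderiv ℝ φ y (1, 0, 0)) y ^ 2) := by
    filter_upwards [hA.transformation.isOpen.mem_nhds hz] with y hy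
    have := hA.space_sq hy
    change (fderiv ℝ φ y (0, 1, 0)).2.1 ^ 4 = (fderiv ℝ φ y (1, 0, 0)).1 ^ 2
    rw [← sq_abs (fderiv ℝ φ y (1, 0, 0)).1, ← this]
    ring
  have h4 := DFunLike.congr_fun (h1.unique (h3.hasFDerivAt_iff.2 h2)) (0, 1, 0)
  have h5 : (fderiv ℝ (fderiv ℝ φ) z (0, 1, 0) (1, 0, 0)).1 = 0 := by
    rw [fderiv_fderiv_comm (hA.smooth hz)]
    exact hA.time_second hz _ _ _
  have h6 := hA.space_ne_zero hz
  simp [P1, P2, h5] at h4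
  exact h4.resolve_left h6

/-- The determining equations: the coefficients of the powers of the derivative `ψ_x`. -/
lemma determining_coeff (hA : IsAdmissible γ θ θ' D φ) (hz : z ∈ D) :
    (Complex.I * ((fderiv ℝ φ z (1, 0, 0)).1⁻¹ • ((fderiv ℝ φ z (1, 0, 0)).2.2
        - ((fderiv ℝ φ z (1, 0, 0)).2.1 / (fderiv ℝ φ z (0, 1, 0)).2.1)
          • (fderiv ℝ φ z (0, 1, 0)).2.2))
      + |(fderiv ℝ φ z (1, 0, 0)).1|⁻¹ • ((fderiv ℝ (fderiv ℝ φ) z (0, 1, 0) (0, 1, 0)).2.2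
          - (fderiv ℝ φ z (0, 0, θ.S γ z * z.2.2)).2.2)
      + θ'.S γ (φ z) * (φ z).2.2 = 0) ∧
    (∀ b : ℂ, (fderiv ℝ (fderiv ℝ φ) z (0, 1, 0) (0, 0, b)).2.2
      = (Real.sign (fderiv ℝ φ z (1, 0, 0)).1
          * ((fderiv ℝ φ z (1, 0, 0)).2.1 / (fderiv ℝ φ z (0, 1, 0)).2.1) / 2)
        • (Complex.I * (fderiv ℝ φ z (0, 0, b)).2.2)) ∧
    (∀ b : ℂ, (fderiv ℝ (fderiv ℝ φ) z (0, 0, b) (0, 0, b)).2.2 = 0) := by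
  have hT := hA.time_ne_zero hz
  have hX := hA.space_ne_zero hz
  have hsq := hA.space_sq hz
  have hsv := hA.space_vertical hz
  have hss := hA.space_second hz
  have hssv := hA.space_second_vertical hz
  have hcomm := fderiv_fderiv_comm (hA.smooth hz)
  have hv : ∀ b : ℂ, ((0, 1, b) : Pt) = (0, 1, 0) + (0, 0, b) := by intro b; simp
  have hdet : ∀ b : ℂ, _ := fun b => hA.determining hz 0 b (ξ := (fderiv ℝ φ z (0, 1, 0)).2.1)
    (by rw [hv b, map_add]; simp [hsv]) hX rfl
  generalize fderiv ℝ (fderiv ℝ φ) z = D2 at *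
  generalize fderiv ℝ φ z = L at *
  obtain ⟨T, hTdef⟩ : ∃ T, T = (L (1, 0, 0)).1 := ⟨_, rfl⟩
  obtain ⟨X, hXdef⟩ : ∃ X, X = (L (0, 1, 0)).2.1 := ⟨_, rfl⟩
  have hsgn : (|T|)⁻¹ = Real.sign T * T⁻¹ := by
    rcases lt_or_gt_of_ne hT with h0 | h0
    · rw [← hTdef] at h0
      rw [Real.sign_of_neg h0, abs_of_neg h0, inv_neg]; ring
    · have h0' : 0 < T := hTdef ▸ h0
      rw [Real.sign_of_pos h0', abs_of_pos h0']; ring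
  -- The determining equation at `ψ_t = 0`, sorted into the parts of degree 0, 1 and 2 in `b = ψ_x`.
  have key : ∀ b : ℂ,
      (Complex.I * (T⁻¹ • ((L (1, 0, 0)).2.2 - ((L (1, 0, 0)).2.1 / X) • (L (0, 1, 0)).2.2))
        + |T|⁻¹ • ((D2 (0, 1, 0) (0, 1, 0)).2.2 - (L (0, 0, θ.S γ z * z.2.2)).2.2)
        + θ'.S γ (φ z) * (φ z).2.2)
      + (2 * |T|⁻¹ * (D2 (0, 1, 0) (0, 0, b)).2.2
        - Complex.I * (T⁻¹ * (((L (1, 0, 0)).2.1 / X) * (L (0, 0, b)).2.2)))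
      + |T|⁻¹ * (D2 (0, 0, b) (0, 0, b)).2.2 = 0 := by
    intro b
    have h := hdet b
    have hneg : L (0, 0, -Complex.I * 0 - θ.S γ z * z.2.2) = -L (0, 0, θ.S γ z * z.2.2) := by
      rw [← map_neg]; simp
    rw [hneg, hv b, hsq] at h
    simp only [map_add, add_apply, hcomm (0, 0, b) (0, 1, 0)] at h
    simp only [Prod.snd_add, Prod.fst_add, Prod.snd_neg, Prod.fst_neg, hss, hssv, hsv,
      ← hTdef, ← hXdef, Complex.real_smul, neg_zero] at h
    simp only [Complex.real_smul]
    push_cast at h ⊢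
    linear_combination h
  have hD2 : ∀ (s : ℝ) (b : ℂ), (D2 (0, 1, 0) (0, 0, s • b)).2.2 = s • (D2 (0, 1, 0) (0, 0, b)).2.2
      ∧ (D2 (0, 0, s • b) (0, 0, s • b)).2.2 = s ^ 2 • (D2 (0, 0, b) (0, 0, b)).2.2
      ∧ (L (0, 0, s • b)).2.2 = s • (L (0, 0, b)).2.2 := by
    intro s b
    have : ((0, 0, s • b) : Pt) = s • (0, 0, b) := by simp
    rw [this]
    simp only [map_smul, smul_apply, Prod.smul_snd]
    refine ⟨trivial, ?_, trivial⟩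
    rw [smul_smul, sq]
  have hTc : (T : ℂ) ≠ 0 := by rw [hTdef]; exact_mod_cast hT
  have hTa : (|T| : ℝ) ≠ 0 := by rw [hTdef]; exact abs_ne_zero.2 hT
  have hTac : ((|T| : ℝ) : ℂ) ≠ 0 := by exact_mod_cast hTa
  rw [← hTdef, ← hXdef]
  have k0 := key 0
  have e0 := hD2 0 0
  simp only [zero_smul] at e0
  simp only [e0.1, e0.2.2] at k0
  have e00 : (D2 (0, 0, 0) (0, 0, 0)).2.2 = 0 := by simpa using (hD2 0 0).2.1
  rw [e00] at k0
  simp only [mul_zero, sub_zero, add_zero] at k0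
  refine ⟨k0, ?_, ?_⟩
  · intro b
    -- With the constant part already zero, `±b` separate the odd part from the even one.
    have k1 := key ((1 : ℝ) • b)
    have k2 := key ((-1 : ℝ) • b)
    simp only [(hD2 _ b).1, (hD2 _ b).2.1, (hD2 _ b).2.2] at k1 k2
    rw [k0] at k1 k2
    have hs2 : ((Real.sign T : ℝ) : ℂ) * Real.sign T = 1 := by
      rcases lt_or_gt_of_ne hT with h0 | h0
      · rw [← hTdef] at h0
        rw [Real.sign_of_neg h0]; simp
      · have h0' : 0 < T := hTdef ▸ h0
        rw [Real.sign_of_pos h0']; simp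
    have hsgnc : (((|T| : ℝ) : ℂ))⁻¹ = Real.sign T * (T : ℂ)⁻¹ := by exact_mod_cast hsgn
    simp only [Complex.real_smul] at k1 k2 ⊢
    push_cast at k1 k2 ⊢
    rw [hsgnc] at k1 k2
    have k3 : (T : ℂ)⁻¹ * (2 * Real.sign T * (D2 (0, 1, 0) (0, 0, b)).2.2
        - Complex.I * (((L (1, 0, 0)).2.1 / X) * (L (0, 0, b)).2.2)) = 0 := by
      linear_combination (k1 - k2) / 2
    have k4 := (mul_eq_zero.1 k3).resolve_left (inv_ne_zero hTc)
    linear_combination (Real.sign T : ℂ) / 2 * k4 - (D2 (0, 1, 0) (0, 0, b)).2.2 * hs2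
  · intro b
    have k1 := key ((1 : ℝ) • b)
    have k2 := key ((-1 : ℝ) • b)
    simp only [(hD2 _ b).1, (hD2 _ b).2.1, (hD2 _ b).2.2] at k1 k2
    rw [k0] at k1 k2
    simp only [Complex.real_smul] at k1 k2
    push_cast at k1 k2
    have k3 : (((|T| : ℝ) : ℂ))⁻¹ * (D2 (0, 0, b) (0, 0, b)).2.2 = 0 := by
      linear_combination (k1 + k2) / 2
    exact (mul_eq_zero.1 k3).resolve_left (inv_ne_zero hTac)

end IsAdmissible

end NSchE

/-! ### Rigidity of the power nonlinearity -/

namespace NSchE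

section PowerRigidity

open ComplexConjugate

/-- The function `|y|^γ y^i (y*)^j`. -/
noncomputable def cpower (γ : ℝ) (i j : ℤ) (y : ℂ) : ℂ := ((‖y‖ ^ γ : ℝ) : ℂ) * y ^ i * conj y ^ j

lemma cpower_ne_zero (γ : ℝ) (i j : ℤ) {y : ℂ} (hy : y ≠ 0) : cpower γ i j y ≠ 0 := by
  refine mul_ne_zero (mul_ne_zero ?_ (zpow_ne_zero _ hy)) (zpow_ne_zero _ (by simpa using hy))
  exact_mod_cast (Real.rpow_pos_of_pos (norm_pos_iff.2 hy) γ).ne'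

/-- The power is differentiated as `(‖y‖²)^{γ/2}`, the squared norm being smooth with an explicit
derivative. -/
lemma hasDerivAt_norm_rpow_line (γ : ℝ) {y : ℂ} (hy : y ≠ 0) (w : ℂ) :
    HasDerivAt (fun s : ℝ => ‖y + s • w‖ ^ γ) (‖y‖ ^ γ * (γ * (w / y).re)) 0 := by
  have hn : 0 < ‖y‖ := norm_pos_iff.2 hy
  have h1 : HasDerivAt (fun s : ℝ => ‖y + s • w‖ ^ 2) (2 * inner ℝ y w) 0 := by
    have := (hasDerivAt_line y w 0).norm_sq
    simpa using this
  have h2 : HasDerivAt (fun s : ℝ => (‖y + s • w‖ ^ 2) ^ (γ / 2))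
      (2 * inner ℝ y w * (γ / 2) * (‖y + (0:ℝ) • w‖ ^ 2) ^ (γ / 2 - 1)) 0 :=
    h1.rpow_const (Or.inl (by simpa using hy))
  have h3 : ∀ x : ℂ, (‖x‖ ^ 2) ^ (γ / 2) = ‖x‖ ^ γ := by
    intro x
    rw [← Real.rpow_natCast, ← Real.rpow_mul (norm_nonneg _)]
    congr 1; push_cast; ring
  simp only [h3] at h2
  refine h2.congr_deriv ?_
  have h4 : (‖y‖ ^ 2) ^ (γ / 2 - 1) = ‖y‖ ^ γ / ‖y‖ ^ 2 := by
    rw [Real.rpow_sub (by positivity), h3, Real.rpow_one]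
  have h5 : (w / y).re = inner ℝ y w / ‖y‖ ^ 2 := by
    rw [Complex.div_re, Complex.inner, ← Complex.normSq_eq_norm_sq]
    simp
    ring
  simp only [zero_smul, add_zero]
  rw [h4, h5]
  ring

/-- Formally the function is `y^{γ/2+i} (y*)^{γ/2+j}`: each Wirtinger derivative lowers one exponent
by one and multiplies by that exponent, so the family is closed under differentiation. -/
lemma hasDerivAt_cpower_line (γ : ℝ) (i j : ℤ) {y : ℂ} (hy : y ≠ 0) (w : ℂ) :
    HasDerivAt (fun s : ℝ => cpower γ i j (y + s • w))
      (cpower γ i j y * ((γ / 2 + i) * (w / y) + (γ / 2 + j) * conj (w / y))) 0 := by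
  have hy' : conj y ≠ 0 := by simpa using hy
  have h1 := (hasDerivAt_norm_rpow_line γ hy w).ofReal_comp
  have hl := hasDerivAt_line y w 0
  have h2 : HasDerivAt (fun s : ℝ => (y + s • w) ^ i) ((i : ℂ) * y ^ (i - 1) * w) 0 := by
    have h := (hasDerivAt_zpow i (y + (0:ℝ) • w) (Or.inl (by simpa using hy))).comp
      (0:ℝ) hl
    exact h.congr_deriv (by simp)
  have hc : HasDerivAt (fun s : ℝ => conj (y + s • w)) (conj w) 0 := by
    have h := (Complex.conjCLE.toContinuousLinearMap.hasFDerivAt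
      (x := y + (0:ℝ) • w)).comp_hasDerivAt 0 hl
    exact h
  have h3 : HasDerivAt (fun s : ℝ => conj (y + s • w) ^ j) ((j : ℂ) * conj y ^ (j - 1) * conj w) 0 := by
    have h := (hasDerivAt_zpow j (conj (y + (0:ℝ) • w)) (Or.inl (by simpa using hy))).comp (0:ℝ) hc
    exact h.congr_deriv (by simp)
  have h4 := (h1.mul h2).mul h3
  refine h4.congr_deriv ?_
  simp only [Pi.mul_apply, cpower, zero_smul, add_zero]
  rw [zpow_sub_one₀ hy, zpow_sub_one₀ hy']
  push_cast
  have h5 : ((w / y).re : ℂ) = (w / y + conj (w / y)) / 2 := by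
    rw [Complex.re_eq_add_conj]
  rw [h5, map_div₀]
  ring

/-- `p |y + n|^γ (y + n)^i ((y + n)*)^j - q |y|^γ y^i (y*)^j` is an affine function near `y₀`. -/
def AffineRel (γ : ℝ) (p q n y₀ : ℂ) (i j : ℤ) (C : ℂ) (A : ℂ →L[ℝ] ℂ) : Prop :=
  ∀ᶠ y in 𝓝 y₀, p * cpower γ i j (y + n) - q * cpower γ i j y = C + A y

variable {γ : ℝ} {p q n y₀ : ℂ}

lemma AffineRel.deriv {i j : ℤ} {C : ℂ} {A : ℂ →L[ℝ] ℂ} (h : AffineRel γ p q n y₀ i j C A)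
    (h0 : y₀ ≠ 0) (hn : y₀ + n ≠ 0) :
    ∀ᶠ y in 𝓝 y₀, y ≠ 0 ∧ y + n ≠ 0 ∧ ∀ w,
      p * (cpower γ i j (y + n) * ((γ / 2 + i) * (w / (y + n)) + (γ / 2 + j) * conj (w / (y + n))))
      - q * (cpower γ i j y * ((γ / 2 + i) * (w / y) + (γ / 2 + j) * conj (w / y))) = A w := by
  have hc : ContinuousAt (fun y : ℂ => y + n) y₀ := by fun_prop
  filter_upwards [h.eventually_nhds, isOpen_ne.eventually_mem h0,
    hc.eventually (isOpen_ne.eventually_mem hn)] with y hy hy0 hyn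
  refine ⟨hy0, hyn, fun w => ?_⟩
  have h1 := ((hasDerivAt_cpower_line γ i j hyn w).const_mul p).sub
    ((hasDerivAt_cpower_line γ i j hy0 w).const_mul q)
  have h2 : HasDerivAt (fun s : ℝ => C + A (y + s • w)) (A w) 0 := by
    have := (A.hasFDerivAt (x := y + (0:ℝ) • w)).comp_hasDerivAt 0 (hasDerivAt_line y w 0)
    exact this.const_add C
  refine h1.unique (h2.congr_of_eventuallyEq ?_)
  have hl : Filter.Tendsto (fun s : ℝ => y + s • w) (𝓝 0) (𝓝 y) := by
    have : ContinuousAt (fun s : ℝ => y + s • w) 0 := by fun_prop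
    simpa [ContinuousAt] using this
  filter_upwards [hl.eventually hy] with s hs
  rw [← hs]
  simp only [Pi.sub_apply]
  congr 3
  ring

/-- This is `∂/∂y*`, extracted as half of (derivative along `1` plus `i` times derivative along `i`)
and divided by the exponent `γ/2 + j`. An affine right-hand side becomes constant, and a constant
one becomes zero. -/
lemma AffineRel.conj_part {i j : ℤ} {C : ℂ} {A : ℂ →L[ℝ] ℂ} (h : AffineRel γ p q n y₀ i j C A)
    (h0 : y₀ ≠ 0) (hn : y₀ + n ≠ 0) (hj : (γ / 2 + j : ℝ) ≠ 0) :
    AffineRel γ p q n y₀ i (j - 1) ((A 1 + Complex.I * A Complex.I) / 2 / ((γ / 2 + j : ℝ) : ℂ))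
      0 := by
  have hj' : ((γ / 2 + j : ℝ) : ℂ) ≠ 0 := by exact_mod_cast hj
  filter_upwards [h.deriv h0 hn] with y ⟨hy0, hyn, hy⟩
  have hy0' : conj y ≠ 0 := by simpa using hy0
  have hyn' : conj (y + n) ≠ 0 := (map_ne_zero _).2 hyn
  have h1 := hy 1
  have h2 := hy Complex.I
  simp only [cpower, zpow_sub_one₀ hy0', zpow_sub_one₀ hyn', zero_apply, add_zero] at h1 h2 ⊢
  simp only [map_div₀, map_one, Complex.conj_I] at h1 h2
  rw [eq_div_iff hj']
  push_cast
  rw [← h1, ← h2]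
  ring_nf
  simp only [Complex.I_sq]
  ring

/-- The companion operation `∂/∂y`, with exponent `γ/2 + i`. -/
lemma AffineRel.linear_part {i j : ℤ} {C : ℂ} {A : ℂ →L[ℝ] ℂ} (h : AffineRel γ p q n y₀ i j C A)
    (h0 : y₀ ≠ 0) (hn : y₀ + n ≠ 0) (hi : (γ / 2 + i : ℝ) ≠ 0) :
    AffineRel γ p q n y₀ (i - 1) j ((A 1 - Complex.I * A Complex.I) / 2 / ((γ / 2 + i : ℝ) : ℂ))
      0 := by
  have hi' : ((γ / 2 + i : ℝ) : ℂ) ≠ 0 := by exact_mod_cast hi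
  filter_upwards [h.deriv h0 hn] with y ⟨hy0, hyn, hy⟩
  have h1 := hy 1
  have h2 := hy Complex.I
  simp only [cpower, zpow_sub_one₀ hy0, zpow_sub_one₀ hyn, zero_apply, add_zero] at h1 h2 ⊢
  simp only [map_div₀, map_one, Complex.conj_I] at h1 h2
  rw [eq_div_iff hi']
  push_cast
  rw [← h1, ← h2]
  ring_nf
  simp only [Complex.I_sq]
  ring

/-- The two homogeneous relations differ by the factors `y₀ + n` and `y₀`, while their common part
does not vanish, so these factors agree. -/
lemma AffineRel.eq_zero_of_linear {i j : ℤ} (h : AffineRel γ p q n y₀ i j 0 0)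
    (h' : AffineRel γ p q n y₀ (i - 1) j 0 0) (hq : q ≠ 0)
    (h0 : y₀ ≠ 0) (hn : y₀ + n ≠ 0) : n = 0 := by
  have h1 := h.self_of_nhds
  have h2 := h'.self_of_nhds
  have h3 := cpower_ne_zero γ (i - 1) j h0
  have e : ∀ y : ℂ, y ≠ 0 → cpower γ i j y = cpower γ (i - 1) j y * y := by
    intro y hy
    simp only [cpower, zpow_sub_one₀ hy]
    field_simp
  rw [e _ h0, e _ hn] at h1
  simp only [zero_apply, add_zero] at h1 h2
  have h4 : q * cpower γ (i - 1) j y₀ * n = 0 := by linear_combination h1 - (y₀ + n) * h2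
  simpa [hq, h3] using h4

lemma AffineRel.eq_zero_of_conj {i j : ℤ} (h : AffineRel γ p q n y₀ i j 0 0)
    (h' : AffineRel γ p q n y₀ i (j - 1) 0 0) (hq : q ≠ 0)
    (h0 : y₀ ≠ 0) (hn : y₀ + n ≠ 0) : n = 0 := by
  have h1 := h.self_of_nhds
  have h2 := h'.self_of_nhds
  have h3 := cpower_ne_zero γ i (j - 1) h0
  have e : ∀ y : ℂ, y ≠ 0 → cpower γ i j y = cpower γ i (j - 1) y * conj y := by
    intro y hy
    have hy' : conj y ≠ 0 := by simpa using hy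
    simp only [cpower, zpow_sub_one₀ hy']
    field_simp
  rw [e _ h0, e _ hn, map_add] at h1
  simp only [zero_apply, add_zero] at h1 h2
  have h4 : q * cpower γ i (j - 1) y₀ * conj n = 0 := by
    linear_combination h1 - (conj y₀ + conj n) * h2
  simpa [hq, h3] using h4

/-- Two shifted copies of the nonlinearity `|y|^γ y` differ by an affine function only if the
shift vanishes. -/
lemma AffineRel.shift_eq_zero {C : ℂ} {A : ℂ →L[ℝ] ℂ} (h : AffineRel γ p q n y₀ 1 0 C A)
    (hγ : γ ≠ 0) (hq : q ≠ 0) (h0 : y₀ ≠ 0) (hn : y₀ + n ≠ 0) : n = 0 := by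
  have r1 := h.conj_part h0 hn (by simpa using hγ)
  -- One `∂/∂y*` leaves a constant on the right, and a further derivative kills it. For `γ = 2` the
  -- function is now `y²`, so a second `∂/∂y*` would give nothing and `∂/∂y` is used.
  by_cases h2 : γ = 2
  · subst h2
    have r2 := r1.linear_part h0 hn (by norm_num)
    have r3 := r2.linear_part h0 hn (by norm_num)
    simp only [zero_apply, mul_zero, sub_zero, zero_div] at r2 r3
    exact r2.eq_zero_of_linear r3 hq h0 hn
  · have r2 := r1.conj_part h0 hn (by
      push_cast; intro h; apply h2; linarith)
    simp only [zero_apply, mul_zero, add_zero, zero_div] at r2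
    -- For `γ = -2` the function depends on `y*` only, so the last derivative must again be `∂/∂y*`.
    by_cases h3 : γ = -2
    · subst h3
      have r3 := r2.conj_part h0 hn (by norm_num)
      simp only [zero_apply, mul_zero, add_zero, zero_div] at r3
      exact r2.eq_zero_of_conj r3 hq h0 hn
    · have r3 := r2.linear_part h0 hn (by
        push_cast; intro h; apply h3; linarith)
      simp only [zero_apply, mul_zero, sub_zero, zero_div] at r3
      exact r2.eq_zero_of_linear r3 hq h0 hn

end PowerRigidity

end NSchE

/-! ### Linearity of the new unknown function in `ψ` or `ψ*` -/

namespace NSchE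

/-- The identity if `0 < τ`, and complex conjugation otherwise. -/
noncomputable def conjIf (τ : ℝ) : ℂ →L[ℝ] ℂ :=
  if 0 < τ then ContinuousLinearMap.id ℝ ℂ else Complex.conjCLE.toContinuousLinearMap

lemma conjIf_pos {τ : ℝ} (h : 0 < τ) (c : ℂ) : conjIf τ c = c := by simp [conjIf, h]

lemma conjIf_nonpos {τ : ℝ} (h : ¬ 0 < τ) (c : ℂ) : conjIf τ c = (starRingEnd ℂ) c := by
  simp [conjIf, h]

lemma conjIf_mul (τ : ℝ) (a b : ℂ) : conjIf τ (a * b) = conjIf τ a * conjIf τ b := by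
  by_cases h : 0 < τ <;> simp [conjIf, h]

lemma conjIf_ofReal (τ r : ℝ) : conjIf τ (r : ℂ) = r := by
  by_cases h : 0 < τ <;> simp [conjIf, h]

lemma conjIf_conjIf (τ : ℝ) (a : ℂ) : conjIf τ (conjIf τ a) = a := by
  by_cases h : 0 < τ <;> simp [conjIf, h]

lemma norm_conjIf (τ : ℝ) (a : ℂ) : ‖conjIf τ a‖ = ‖a‖ := by
  by_cases h : 0 < τ <;> simp [conjIf, h]

lemma conjIf_eq_zero {τ : ℝ} {a : ℂ} : conjIf τ a = 0 ↔ a = 0 := by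
  rw [← norm_eq_zero, norm_conjIf, norm_eq_zero]

lemma conjIf_I {τ : ℝ} (hτ : τ ≠ 0) : conjIf τ Complex.I = Real.sign τ * Complex.I := by
  rcases lt_or_gt_of_ne hτ with h | h
  · rw [conjIf_nonpos h.not_gt, Real.sign_of_neg h]; simp
  · rw [conjIf_pos h, Real.sign_of_pos h]; simp

section Lines

variable {E F : Type*} [NormedAddCommGroup E] [NormedSpace ℝ E]
  [NormedAddCommGroup F] [NormedSpace ℝ F]

/-- A function whose directional derivative is constant along a segment is affine on it. -/
lemma eq_add_of_fderiv_const {U : Set E} (hU : Convex ℝ U) {h : E → F} {y w : E} {c : F}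
    (hy : y ∈ U) (hw : y + w ∈ U) (hd : ∀ x ∈ U, DifferentiableAt ℝ h x)
    (hc : ∀ s ∈ Set.Icc (0 : ℝ) 1, fderiv ℝ h (y + s • w) w = c) : h (y + w) = h y + c := by
  have hmem : ∀ s ∈ Set.Icc (0 : ℝ) 1, y + s • w ∈ U := fun s hs =>
    hU.add_smul_mem hy hw hs
  have hder : ∀ s ∈ Set.Icc (0 : ℝ) 1,
      HasDerivAt (fun s : ℝ => h (y + s • w) - s • c) 0 s := by
    intro s hs
    have h1 := (hd _ (hmem s hs)).hasFDerivAt.comp_hasDerivAt s (hasDerivAt_line y w s)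
    rw [hc s hs] at h1
    have h2 := h1.sub ((hasDerivAt_id s).smul_const c)
    exact h2.congr_deriv (by simp)
  have h3 := constant_of_has_deriv_right_zero
    (fun s hs => (hder s hs).continuousAt.continuousWithinAt)
    (fun s hs => (hder s ⟨hs.1, hs.2.le⟩).hasDerivWithinAt) 1 (by simp)
  simp only [one_smul, zero_smul, add_zero, sub_zero] at h3
  rw [← h3]; abel

lemma eq_of_fderiv_zero {U : Set E} (hU : Convex ℝ U) {h : E → F} {y w : E}
    (hy : y ∈ U) (hw : y + w ∈ U) (hd : ∀ x ∈ U, DifferentiableAt ℝ h x)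
    (hc : ∀ x ∈ U, fderiv ℝ h x w = 0) : h (y + w) = h y := by
  simpa using eq_add_of_fderiv_const hU hy hw hd
    (fun s hs => hc _ (hU.add_smul_mem hy hw hs))

end Lines

lemma fderiv_comp_clm {E F G : Type*} [NormedAddCommGroup E] [NormedSpace ℝ E]
    [NormedAddCommGroup F] [NormedSpace ℝ F] [NormedAddCommGroup G] [NormedSpace ℝ G]
    (P : F →L[ℝ] G) {φ : E → F} {z : E} (hφ : ContDiffAt ℝ ∞ φ z) (v w : E) :
    fderiv ℝ (fun y => P (φ y)) z v = P (fderiv ℝ φ z v) ∧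
    fderiv ℝ (fderiv ℝ (fun y => P (φ y))) z v w = P (fderiv ℝ (fderiv ℝ φ) z v w) := by
  constructor
  · have h : HasFDerivAt (fun y => P (φ y)) _ z :=
      P.hasFDerivAt.comp z (hasFDerivAt_of_smooth hφ)
    rw [h.fderiv]; rfl
  · have h1 : ContDiffAt ℝ ∞ (fun y => P (φ y)) z := P.contDiff.contDiffAt.comp z hφ
    have h2 := hasFDerivAt_fderiv_apply h1 w
    have h3 : HasFDerivAt (fun y => P (fderiv ℝ φ y w)) _ z :=
      P.hasFDerivAt.comp z (hasFDerivAt_fderiv_apply hφ w)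
    have h4 : (fun y => fderiv ℝ (fun y => P (φ y)) y w) =ᶠ[𝓝 z] fun y => P (fderiv ℝ φ y w) := by
      filter_upwards [eventually_smooth hφ] with y hy
      have h5 : HasFDerivAt (fun y => P (φ y)) _ y := P.hasFDerivAt.comp y hy.hasFDerivAt
      rw [h5.fderiv]; rfl
    have h6 := DFunLike.congr_fun (h2.unique (h4.hasFDerivAt_iff.2 h3)) v
    simpa using h6

/-- The third component of a point of the space of `(t, x, ψ)`. -/
noncomputable def psiL : Pt →L[ℝ] ℂ :=
  (ContinuousLinearMap.snd ℝ ℝ ℂ).comp (ContinuousLinearMap.snd ℝ ℝ (ℝ × ℂ))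

lemma psiL_apply (y : Pt) : psiL y = y.2.2 := rfl

/-- The second component of a point of the space of `(t, x, ψ)`. -/
noncomputable def xL : Pt →L[ℝ] ℝ :=
  (ContinuousLinearMap.fst ℝ ℝ ℂ).comp (ContinuousLinearMap.snd ℝ ℝ (ℝ × ℂ))

lemma xL_apply (y : Pt) : xL y = y.2.1 := rfl

/-- The first component of a point of the space of `(t, x, ψ)`. -/
noncomputable def tL : Pt →L[ℝ] ℝ := ContinuousLinearMap.fst ℝ ℝ (ℝ × ℂ)

lemma tL_apply (y : Pt) : tL y = y.1 := rfl

/-- The inclusion of the `ψ`-axis. -/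
noncomputable def vertL : ℂ →L[ℝ] Pt :=
  (ContinuousLinearMap.inr ℝ ℝ (ℝ × ℂ)).comp (ContinuousLinearMap.inr ℝ ℝ ℂ)

lemma vertL_apply (c : ℂ) : vertL c = (0, 0, c) := rfl

namespace IsAdmissible

variable {γ : ℝ} {θ θ' : ArbElt} {D : Set Pt} {φ : Pt → Pt} {z : Pt}

/-- By `vertical_I` the vertical differential commutes with multiplication by `i` up to the sign of
`t̃_t`, so it is determined by its value at `1`. -/
lemma vertical_eq (hA : IsAdmissible γ θ θ' D φ) (hz : z ∈ D) (c : ℂ) :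
    (fderiv ℝ φ z (0, 0, c)).2.2
      = (fderiv ℝ φ z (0, 0, 1)).2.2 * conjIf (fderiv ℝ φ z (1, 0, 0)).1 c := by
  have hI := hA.vertical_I hz 1
  have hT := hA.time_ne_zero hz
  generalize fderiv ℝ φ z = L at *
  have hc : ((0, 0, c) : Pt) = c.re • (0, 0, 1) + c.im • (0, 0, Complex.I * 1) := by
    have := Complex.re_add_im c
    simp [this]
  have hc' : conjIf (L (1, 0, 0)).1 c
      = c.re + c.im * (Real.sign (L (1, 0, 0)).1 * Complex.I) := by
    conv_lhs => rw [← Complex.re_add_im c]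
    rw [map_add, conjIf_mul, conjIf_ofReal, conjIf_ofReal, conjIf_I hT]
  rw [hc, map_add, map_smul, map_smul, hc']
  simp only [Prod.snd_add, Prod.smul_snd, hI, Complex.real_smul]
  ring

lemma vertical_ne_zero (hA : IsAdmissible γ θ θ' D φ) (hz : z ∈ D) :
    (fderiv ℝ φ z (0, 0, 1)).2.2 ≠ 0 := by
  intro h
  have h1 : fderiv ℝ φ z (0, 0, 1) = 0 :=
    Prod.ext (hA.time_vertical hz _ _) (Prod.ext (hA.space_vertical hz _) h)
  have h2 := hA.injective hz (h1.trans (map_zero _).symm)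
  simpa using congrArg (fun w : Pt => w.2.2) h2

/-- The new unknown function is linear in `ψ` or in `ψ*`. -/
lemma vertical_self (hA : IsAdmissible γ θ θ' D φ) (hγ : γ ≠ 0) (hz : z ∈ D) :
    (fderiv ℝ φ z (0, 0, z.2.2)).2.2 = (φ z).2.2 := by
  obtain ⟨r, hr, hball⟩ := Metric.isOpen_iff.1 hA.transformation.isOpen z hz
  have hconv : Convex ℝ (Metric.ball z r) := convex_ball z r
  have hzb : z ∈ Metric.ball z r := Metric.mem_ball_self hr
  let h : Pt → ℂ := fun y => psiL (φ y)
  have hs : ∀ y ∈ D, ContDiffAt ℝ ∞ h y := fun y hy =>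
    psiL.contDiff.contDiffAt.comp y (hA.smooth hy)
  have hh1 : ∀ y ∈ D, ∀ v, (fderiv ℝ φ y v).2.2 = fderiv ℝ h y v := fun y hy v =>
    (fderiv_comp_clm psiL (hA.smooth hy) v 0).1.symm
  have hh2 : ∀ y ∈ D, ∀ v w, (fderiv ℝ (fderiv ℝ φ) y v w).2.2
      = fderiv ℝ (fderiv ℝ h) y v w := fun y hy v w =>
    (fderiv_comp_clm psiL (hA.smooth hy) v w).2.symm
  have hsymm : ∀ y ∈ D, ∀ v w, fderiv ℝ (fderiv ℝ φ) y v w = fderiv ℝ (fderiv ℝ φ) y w v :=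
    fun y hy v w => fderiv_fderiv_comm (hA.smooth hy) v w
  -- Polarization of the last equation of `determining_coeff`.
  have hpol : ∀ y ∈ D, ∀ a b : ℂ, fderiv ℝ (fderiv ℝ h) y (0, 0, a) (0, 0, b) = 0 := by
    intro y hy a b
    have h1 := (hA.determining_coeff hy).2.2
    have e : ((0, 0, a + b) : Pt) = (0, 0, a) + (0, 0, b) := by simp
    have h2 := h1 (a + b)
    rw [e] at h2
    simp only [map_add, add_apply, hsymm y hy (0, 0, b) (0, 0, a), Prod.snd_add, h1] at h2
    rw [hh2 y hy] at h2
    linear_combination h2 / 2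
  -- constancy along the vertical directions
  have hconst : ∀ {H : Type} [NormedAddCommGroup H] [NormedSpace ℝ H] (k : Pt → H) (w : ℂ),
      (∀ y ∈ D, DifferentiableAt ℝ k y) → (∀ y ∈ D, fderiv ℝ k y (0, 0, w) = 0) →
      z + (0, 0, w) ∈ Metric.ball z r → k (z + (0, 0, w)) = k z := by
    intro H _ _ k w hk hk0 hw
    exact eq_of_fderiv_zero hconv hzb hw (fun x hx => hk x (hball hx)) (fun x hx => hk0 x (hball hx))
  have hconst2 : ∀ {H : Type} [NormedAddCommGroup H] [NormedSpace ℝ H] (P : Pt →L[ℝ] H) (v : Pt)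
      (w : ℂ), (∀ y ∈ D, P (fderiv ℝ (fderiv ℝ φ) y v (0, 0, w)) = 0) →
      z + (0, 0, w) ∈ Metric.ball z r →
      P (fderiv ℝ φ (z + (0, 0, w)) v) = P (fderiv ℝ φ z v) := by
    intro H _ _ P v w hk hw
    refine hconst (fun y => P (fderiv ℝ φ y v)) w ?_ ?_ hw
    · intro y hy
      exact (P.hasFDerivAt.comp y (hasFDerivAt_fderiv_apply (hA.smooth hy) v)).differentiableAt
    · intro y hy
      have h1 : HasFDerivAt (fun y => P (fderiv ℝ φ y v)) _ y :=
        P.hasFDerivAt.comp y (hasFDerivAt_fderiv_apply (hA.smooth hy) v)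
      rw [h1.fderiv]
      simp [hsymm y hy (0, 0, w) v, hk y hy]
  have hvs : ∀ w : ℂ, ‖((0, 0, w) : Pt)‖ = ‖w‖ := by intro w; simp [Prod.norm_def]
  -- Vanishing second vertical derivatives make the first-order Taylor formula in `ψ` exact. The
  -- radius `r / 2` keeps both `y` and its shift inside the ball, so that the formula can be
  -- differentiated in `y`.
  have haff : ∀ w : ℂ, ‖w‖ < r / 2 → ∀ y ∈ Metric.ball z (r / 2),
      h (y + (0, 0, w)) = h y + fderiv ℝ h y (0, 0, w) := by
    intro w hw y hy
    have hy' : y ∈ Metric.ball z r := Metric.ball_subset_ball (by linarith) hy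
    have hyw : y + (0, 0, w) ∈ Metric.ball z r := by
      rw [mem_ball_iff_norm] at hy ⊢
      have : y + (0, 0, w) - z = (y - z) + (0, 0, w) := by abel
      rw [this]
      refine (norm_add_le _ _).trans_lt ?_
      rw [hvs]; linarith
    refine eq_add_of_fderiv_const hconv hy' hyw
      (fun x hx => (hs x (hball hx)).differentiableAt (by simp)) ?_
    intro s hs'
    have hmem := hconv.add_smul_mem hy' hyw hs'
    have e : s • ((0, 0, w) : Pt) = (0, 0, s • w) := by simp
    have h1 : fderiv ℝ h (y + s • (0, 0, w)) (0, 0, w) = fderiv ℝ h y (0, 0, w) := by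
      refine eq_of_fderiv_zero (h := fun x => fderiv ℝ h x (0, 0, w)) hconv hy' hmem ?_ ?_
      · intro x hx
        exact (hasFDerivAt_fderiv_apply (hs x (hball hx)) _).differentiableAt
      · intro x hx
        rw [(hasFDerivAt_fderiv_apply (hs x (hball hx)) _).fderiv, e]
        exact hpol x (hball hx) _ _
    exact h1
  -- the derivatives at a shifted point
  have hd1 : ∀ w : ℂ, ‖w‖ < r / 2 → ∀ y ∈ Metric.ball z (r / 2), ∀ u,
      fderiv ℝ h (y + (0, 0, w)) u = fderiv ℝ h y u + fderiv ℝ (fderiv ℝ h) y u (0, 0, w) := by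
    intro w hw y hy u
    have hyD : y ∈ D := hball (Metric.ball_subset_ball (by linarith) hy)
    have hywD : y + (0, 0, w) ∈ D := by
      apply hball
      rw [mem_ball_iff_norm] at hy ⊢
      have : y + (0, 0, w) - z = (y - z) + (0, 0, w) := by abel
      rw [this]
      refine (norm_add_le _ _).trans_lt ?_
      rw [hvs]; linarith
    have h1 : HasFDerivAt (fun x => h (x + (0, 0, w))) (fderiv ℝ h (y + (0, 0, w))) y :=
      (hasFDerivAt_comp_add_right _).2 (hasFDerivAt_of_smooth (hs _ hywD))
    have h2 := (hasFDerivAt_of_smooth (hs y hyD)).add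
      (hasFDerivAt_fderiv_apply (hs y hyD) (0, 0, w))
    have h3 : (fun x => h (x + (0, 0, w))) =ᶠ[𝓝 y] (h + fun x => fderiv ℝ h x (0, 0, w)) := by
      filter_upwards [Metric.isOpen_ball.mem_nhds hy] with x hx
      exact haff w hw x hx
    have h4 := DFunLike.congr_fun (h1.unique (h3.hasFDerivAt_iff.2 h2)) u
    simpa using h4
  have hzb2 : z ∈ Metric.ball z (r / 2) := Metric.mem_ball_self (by linarith)
  -- A third derivative of `ψ̃`: on vertical vectors it is the coefficient with which `ψ̃_xx` varies
  -- in `ψ`.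
  let K : Pt →L[ℝ] ℂ :=
    fderiv ℝ (fun y => fderiv ℝ (fderiv ℝ h) y (0, 1, 0)) z (0, 1, 0)
  have hd2 : ∀ w : ℂ, ‖w‖ < r / 2 →
      fderiv ℝ (fderiv ℝ h) (z + (0, 0, w)) (0, 1, 0) (0, 1, 0)
        = fderiv ℝ (fderiv ℝ h) z (0, 1, 0) (0, 1, 0) + K (0, 0, w) := by
    intro w hw
    have hwD : z + (0, 0, w) ∈ D := by
      apply hball
      rw [mem_ball_iff_norm]
      have : z + (0, 0, w) - z = (0, 0, w) := by abel
      rw [this, hvs]; linarith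
    have h1 : HasFDerivAt (fun x => fderiv ℝ h (x + (0, 0, w)) (0, 1, 0)) _ z :=
      (hasFDerivAt_comp_add_right (f := fun x => fderiv ℝ h x (0, 1, 0)) _).2
        (hasFDerivAt_fderiv_apply (hs _ hwD) (0, 1, 0))
    have h2 := hasFDerivAt_of_smooth
      ((smooth_fderiv (smooth_fderiv (hs z hz))).clm_apply
        (contDiffAt_const (c := ((0, 1, 0) : Pt))))
    have h2' : HasFDerivAt (fun x => fderiv ℝ (fderiv ℝ h) x (0, 1, 0) (0, 0, w)) _ z :=
      h2.clm_apply (hasFDerivAt_const ((0, 0, w) : Pt) z)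
    have h3 := (hasFDerivAt_fderiv_apply (hs z hz) (0, 1, 0)).add h2'
    have h4 : (fun x => fderiv ℝ h (x + (0, 0, w)) (0, 1, 0)) =ᶠ[𝓝 z]
        ((fun x => fderiv ℝ h x (0, 1, 0))
          + fun x => fderiv ℝ (fderiv ℝ h) x (0, 1, 0) (0, 0, w)) := by
      filter_upwards [Metric.isOpen_ball.mem_nhds hzb2] with x hx
      exact hd1 w hw x hx _
    have h5 := DFunLike.congr_fun (h1.unique (h4.hasFDerivAt_iff.2 h3)) (0, 1, 0)
    simpa [K] using h5
  -- the classifying equation along the vertical direction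
  set T := (fderiv ℝ φ z (1, 0, 0)).1 with hT
  set ρ := (fderiv ℝ φ z (1, 0, 0)).2.1 / (fderiv ℝ φ z (0, 1, 0)).2.1 with hρ
  set m := (fderiv ℝ φ z (0, 0, 1)).2.2 with hm
  have hm0 : m ≠ 0 := hA.vertical_ne_zero hz
  have hT0 : T ≠ 0 := hA.time_ne_zero hz
  have hMv : ∀ c : ℂ, fderiv ℝ h z (0, 0, c) = m * conjIf T c := by
    intro c
    rw [← hh1 z hz, hA.vertical_eq hz]
  -- In the first equation of `determining_coeff`, taken at `z + (0, 0, w)`, all terms except the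
  -- two power nonlinearities are affine in `w`; `A₀` and `C₀` collect them.
  let A₀ : ℂ →L[ℝ] ℂ :=
    (-(Complex.I * (T : ℂ)⁻¹)) • ((fderiv ℝ (fderiv ℝ h) z (1, 0, 0)
        - ρ • fderiv ℝ (fderiv ℝ h) z (0, 1, 0)).comp vertL)
      - |T|⁻¹ • K.comp vertL
      + ((|T|⁻¹ : ℝ) * conjIf T (θ.V (base z)) - θ'.V (base (φ z))) • (m • conjIf T)
  let C₀ : ℂ := -(Complex.I * (T : ℂ)⁻¹) * (fderiv ℝ h z (1, 0, 0) - ρ * fderiv ℝ h z (0, 1, 0))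
      - (|T|⁻¹ : ℝ) * fderiv ℝ (fderiv ℝ h) z (0, 1, 0) (0, 1, 0)
      + (|T|⁻¹ : ℝ) * conjIf T (θ.V (base z)) * (m * conjIf T z.2.2) - θ'.V (base (φ z)) * h z
  have hclass : ∀ w : ℂ, ‖w‖ < r / 2 →
      θ'.σ * ((‖h z + m * conjIf T w‖ ^ γ : ℝ) : ℂ) * (h z + m * conjIf T w)
        - (|T|⁻¹ : ℝ) * (conjIf T θ.σ * ((‖z.2.2 + w‖ ^ γ : ℝ) : ℂ)
            * (m * conjIf T (z.2.2 + w))) = C₀ + A₀ w := by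
    intro w hw
    have hwb : z + (0, 0, w) ∈ Metric.ball z r := by
      rw [mem_ball_iff_norm]
      have : z + (0, 0, w) - z = (0, 0, w) := by abel
      rw [this, hvs]; linarith
    have hwD := hball hwb
    have i0 := (hA.determining_coeff hwD).1
    have c1 : (fderiv ℝ φ (z + (0, 0, w)) (1, 0, 0)).1 = T :=
      hconst2 tL (1, 0, 0) w (fun y hy => hA.time_second hy _ _ _) hwb
    have c2 : (fderiv ℝ φ (z + (0, 0, w)) (1, 0, 0)).2.1 = (fderiv ℝ φ z (1, 0, 0)).2.1 :=
      hconst2 xL (1, 0, 0) w (fun y hy => hA.space_second_vertical hy _ _) hwb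
    have c3 : (fderiv ℝ φ (z + (0, 0, w)) (0, 1, 0)).2.1 = (fderiv ℝ φ z (0, 1, 0)).2.1 :=
      hconst2 xL (0, 1, 0) w (fun y hy => hA.space_second_vertical hy _ _) hwb
    have c4 : (fderiv ℝ φ (z + (0, 0, w)) (0, 0, 1)).2.2 = m :=
      hconst2 psiL (0, 0, 1) w (fun y hy => (hh2 y hy _ _).trans (hpol y hy _ _)) hwb
    have c5 : (φ (z + (0, 0, w))).1 = (φ z).1 :=
      hconst (fun y => tL (φ y)) w
        (fun y hy => (tL.contDiff.contDiffAt.comp y (hA.smooth hy)).differentiableAt (by simp))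
        (fun y hy => (fderiv_comp_clm tL (hA.smooth hy) _ 0).1.trans (hA.time_vertical hy _ _)) hwb
    have c6 : (φ (z + (0, 0, w))).2.1 = (φ z).2.1 :=
      hconst (fun y => xL (φ y)) w
        (fun y hy => (xL.contDiff.contDiffAt.comp y (hA.smooth hy)).differentiableAt (by simp))
        (fun y hy => (fderiv_comp_clm xL (hA.smooth hy) _ 0).1.trans (hA.space_vertical hy _)) hwb
    have c7 : (φ (z + (0, 0, w))).2.2 = h z + m * conjIf T w := by
      rw [← hMv]; exact haff w hw z hzb2
    have c8 : base (φ (z + (0, 0, w))) = base (φ z) := Prod.ext c5 c6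
    have c9 : base (z + (0, 0, w)) = base z := by simp [base]
    rw [hA.vertical_eq hwD, c1, c2, c3, c4, hh1 _ hwD, hh1 _ hwD, hh2 _ hwD, hd1 w hw z hzb2,
      hd1 w hw z hzb2, hd2 w hw, ← hρ] at i0
    simp only [ArbElt.S, c7, c8, c9] at i0
    have c10 : (z + ((0, 0, w) : Pt)).2.2 = z.2.2 + w := rfl
    rw [c10] at i0
    simp only [conjIf_mul, map_add, conjIf_ofReal] at i0
    simp only [A₀, C₀, add_apply, sub_apply, smul_apply, ContinuousLinearMap.comp_apply,
      vertL_apply, smul_eq_mul, map_add]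
    simp only [Complex.real_smul] at i0 ⊢
    push_cast at i0 ⊢
    linear_combination i0
  -- reformulation in terms of the new variable
  set q := ((|T|⁻¹ * (‖m‖ ^ γ)⁻¹ : ℝ) : ℂ) * conjIf T θ.σ with hq
  let Gm : ℂ →L[ℝ] ℂ := (conjIf T).comp ((m⁻¹ : ℂ) • ContinuousLinearMap.id ℝ ℂ)
  have hGm : ∀ y, Gm y = conjIf T (m⁻¹ * y) := fun y => rfl
  have hψ0 : z.2.2 ≠ 0 := hA.isDomain.ne_zero z hz
  have hmpos : 0 < ‖m‖ := norm_pos_iff.2 hm0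
  -- In the variable `y = m · conjIf T (ψ + w)` the new unknown is `y + n`, where the shift `n` is
  -- the free term of `ψ̃` as an affine function of `ψ` or `ψ*`. The factor `‖m‖^{-γ}` in `q` comes
  -- from `|ψ + w| = |y| / |m|`.
  have hrel : AffineRel γ θ'.σ q (h z - m * conjIf T z.2.2) (m * conjIf T z.2.2) 1 0
      (C₀ - A₀ z.2.2) (A₀.comp Gm) := by
    have hcont : Filter.Tendsto (fun y => Gm y - z.2.2) (𝓝 (m * conjIf T z.2.2)) (𝓝 0) := by
      have : ContinuousAt (fun y => Gm y - z.2.2) (m * conjIf T z.2.2) := by fun_prop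
      have h0 : Gm (m * conjIf T z.2.2) - z.2.2 = 0 := by
        rw [hGm, inv_mul_cancel_left₀ hm0, conjIf_conjIf, sub_self]
      rw [ContinuousAt, h0] at this
      exact this
    filter_upwards [hcont.eventually (Metric.ball_mem_nhds 0 (half_pos hr))] with y hy
    have hy' : ‖Gm y - z.2.2‖ < r / 2 := by simpa using hy
    have h1 := hclass _ hy'
    have h2 : m * conjIf T (Gm y - z.2.2) = y - m * conjIf T z.2.2 := by
      rw [map_sub, hGm, conjIf_conjIf, mul_sub, mul_inv_cancel_left₀ hm0]
    have h3 : m * conjIf T (z.2.2 + (Gm y - z.2.2)) = y := by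
      rw [map_add, mul_add, h2]; ring
    have h4 : ‖z.2.2 + (Gm y - z.2.2)‖ = ‖m‖⁻¹ * ‖y‖ := by
      rw [add_sub_cancel, hGm, norm_conjIf, norm_mul, norm_inv]
    have h5 : h z + (y - m * conjIf T z.2.2) = y + (h z - m * conjIf T z.2.2) := by ring
    rw [h2, h3, h4, h5, Real.mul_rpow (by positivity) (by positivity),
      Real.inv_rpow (by positivity)] at h1
    simp only [cpower, zpow_one, zpow_zero, mul_one, ContinuousLinearMap.comp_apply, hq]
    rw [map_sub] at h1
    push_cast at h1 ⊢
    linear_combination h1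
  -- The two nonvanishing conditions are `ψ ≠ 0` on `D` and `ψ̃ ≠ 0` on its image, since `y₀ + n` is
  -- the value of `ψ̃` at `z`.
  have hfin := hrel.shift_eq_zero hγ
    (by
      refine mul_ne_zero ?_ (fun h0 => hA.source_mem.1 (conjIf_eq_zero.1 h0))
      have : |T|⁻¹ * (‖m‖ ^ γ)⁻¹ ≠ 0 :=
        mul_ne_zero (inv_ne_zero (abs_ne_zero.2 hT0))
          (inv_ne_zero (Real.rpow_pos_of_pos hmpos γ).ne')
      exact_mod_cast this)
    (mul_ne_zero hm0 (fun h0 => hψ0 (conjIf_eq_zero.1 h0)))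
    (by rw [add_sub_cancel]; exact hA.ne_zero z hz)
  rw [hh1 z hz, hMv]
  exact (sub_eq_zero.1 hfin).symm

end IsAdmissible

end NSchE

/-! ### Signs, smooth logarithms and functions of time -/

namespace NSchE

section Analysis

/-- Near a point where `f` does not vanish its sign is constant; replacing `|f|` by a fixed sign
times `f` makes the square root differentiable by the usual rules. -/
lemma sqrt_abs_eventuallyEq {f : ℝ → ℝ} {t : ℝ} (hf : ContinuousAt f t) (h : f t ≠ 0) :
    (fun s => Real.sqrt |f s|) =ᶠ[𝓝 t] fun s => Real.sqrt (Real.sign (f t) * f s) := by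
  rcases lt_or_gt_of_ne h with h0 | h0
  · filter_upwards [hf.eventually_lt_const h0] with s hs
    rw [Real.sign_of_neg h0, abs_of_neg hs]; simp
  · filter_upwards [hf.eventually_const_lt h0] with s hs
    rw [Real.sign_of_pos h0, abs_of_pos hs]; simp

lemma sign_mul_pos {r : ℝ} (h : r ≠ 0) : 0 < Real.sign r * r := by
  rcases lt_or_gt_of_ne h with h0 | h0
  · rw [Real.sign_of_neg h0]; linarith
  · rw [Real.sign_of_pos h0]; linarith

lemma sign_mul_self {r : ℝ} : Real.sign r * r = |r| := by
  rcases lt_trichotomy r 0 with h0 | h0 | h0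
  · rw [Real.sign_of_neg h0, abs_of_neg h0]; ring
  · simp [h0]
  · rw [Real.sign_of_pos h0, abs_of_pos h0]; ring

lemma sign_sq {r : ℝ} (h : r ≠ 0) : Real.sign r * Real.sign r = 1 := by
  rcases lt_or_gt_of_ne h with h0 | h0
  · rw [Real.sign_of_neg h0]; norm_num
  · rw [Real.sign_of_pos h0]; norm_num

lemma hasDerivAt_sqrt_abs {f : ℝ → ℝ} {f' t : ℝ} (hf : HasDerivAt f f' t) (h : f t ≠ 0) :
    HasDerivAt (fun s => Real.sqrt |f s|) (Real.sign (f t) * f' / (2 * Real.sqrt |f t|)) t := by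
  have h1 := (hf.const_mul (Real.sign (f t))).sqrt (sign_mul_pos h).ne'
  rw [sign_mul_self] at h1
  exact h1.congr_of_eventuallyEq (sqrt_abs_eventuallyEq hf.continuousAt h)

lemma smooth_sqrt_abs {f : ℝ → ℝ} {t : ℝ} (hf : ContDiffAt ℝ ∞ f t) (h : f t ≠ 0) :
    ContDiffAt ℝ ∞ (fun s => Real.sqrt |f s|) t :=
  ((contDiffAt_const.mul hf).sqrt (sign_mul_pos h).ne').congr_of_eventuallyEq
    (sqrt_abs_eventuallyEq hf.continuousAt h)

lemma eventually_sign_eq {f : ℝ → ℝ} {t : ℝ} (hf : ContinuousAt f t) (h : f t ≠ 0) :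
    ∀ᶠ s in 𝓝 t, Real.sign (f s) = Real.sign (f t) ∧ conjIf (f s) = conjIf (f t) := by
  rcases lt_or_gt_of_ne h with h0 | h0
  · filter_upwards [hf.eventually_lt_const h0] with s hs
    rw [Real.sign_of_neg h0, Real.sign_of_neg hs]
    simp [conjIf, h0.not_gt, hs.not_gt]
  · filter_upwards [hf.eventually_const_lt h0] with s hs
    rw [Real.sign_of_pos h0, Real.sign_of_pos hs]
    simp [conjIf, h0, hs]

lemma smooth_ofReal {E : Type*} [NormedAddCommGroup E] [NormedSpace ℝ E] {f : E → ℝ} {y : E}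
    (hf : ContDiffAt ℝ ∞ f y) : ContDiffAt ℝ ∞ (fun y => (f y : ℂ)) y :=
  Complex.ofRealCLM.contDiff.contDiffAt.comp y hf

/-- A continuous nowhere vanishing function on a connected set has constant sign. -/
lemma constant_sign {E : Type*} [TopologicalSpace E] {D : Set E} (hD : IsPreconnected D)
    {f : E → ℝ} (hf : ContinuousOn f D) (h : ∀ z ∈ D, f z ≠ 0) :
    (∀ z ∈ D, 0 < f z) ∨ ∀ z ∈ D, f z < 0 := by
  by_contra! hc
  obtain ⟨⟨a, ha, ha'⟩, b, hb, hb'⟩ := hc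
  obtain ⟨c, hc, hc'⟩ := hD.intermediate_value ha hb hf ⟨ha', hb'⟩
  exact h c hc hc'

/-- A smooth nowhere vanishing function on an interval has a smooth logarithm. -/
lemma exists_smooth_log {I : Set ℝ} (hI : IsOpen I) (hc : IsPreconnected I) {H : ℝ → ℂ}
    (hH : ContDiffOn ℝ ∞ H I) (h0 : ∀ t ∈ I, H t ≠ 0) :
    ∃ L : ℝ → ℂ, ContDiffOn ℝ ∞ L I ∧ ∀ t ∈ I, H t = Complex.exp (L t) := by
  rcases I.eq_empty_or_nonempty with rfl | ⟨t₀, ht₀⟩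
  · exact ⟨0, by simp, by simp⟩
  have hHt : ∀ t ∈ I, ContDiffAt ℝ ∞ H t := fun t ht => hH.contDiffAt (hI.mem_nhds ht)
  have hq : ∀ t ∈ I, ContDiffAt ℝ ∞ (fun s => deriv H s / H s) t := fun t ht => by
    simp only [div_eq_mul_inv]
    exact (smooth_deriv (hHt t ht)).mul ((hHt t ht).inv (h0 t ht))
  have hqc : ContinuousOn (fun s => deriv H s / H s) I := fun t ht =>
    (hq t ht).continuousAt.continuousWithinAt
  -- A primitive of the logarithmic derivative, normalised at `t₀`; the principal logarithm is
  -- needed at one point only.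
  let L : ℝ → ℂ := fun t => Complex.log (H t₀) + ∫ s in t₀..t, deriv H s / H s
  have hL : ∀ t ∈ I, HasDerivAt L (deriv H t / H t) t := by
    intro t ht
    refine HasDerivAt.const_add _ (intervalIntegral.integral_hasDerivAt_right ?_ ?_ ?_)
    · exact (hqc.mono (hc.ordConnected.uIcc_subset ht₀ ht)).intervalIntegrable
    · exact hqc.stronglyMeasurableAtFilter hI t ht
    · exact (hq t ht).continuousAt
  refine ⟨L, ?_, ?_⟩
  · rw [contDiffOn_infty_iff_deriv_of_isOpen hI]
    refine ⟨fun t ht => (hL t ht).differentiableAt.differentiableWithinAt, ?_⟩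
    refine ContDiffOn.congr (f := fun s => deriv H s / H s)
      (fun t ht => (hq t ht).contDiffWithinAt) (fun t ht => (hL t ht).deriv)
  · have hder : ∀ t ∈ I, HasDerivAt (fun s => H s * Complex.exp (-L s)) 0 t := by
      intro t ht
      have h1 := ((hHt t ht).differentiableAt (by simp)).hasDerivAt.mul (hL t ht).neg.cexp
      refine h1.congr_deriv ?_
      have := h0 t ht
      simp only [Pi.neg_apply]
      field_simp
      ring
    intro t ht
    have h1 := hI.is_const_of_deriv_eq_zero hc
      (fun t ht => (hder t ht).differentiableAt.differentiableWithinAt)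
      (fun t ht => (hder t ht).deriv) ht ht₀
    have h2 : L t₀ = Complex.log (H t₀) := by simp [L]
    simp only [h2, Complex.exp_neg, Complex.exp_log (h0 t₀ ht₀)] at h1
    rw [mul_inv_cancel₀ (h0 t₀ ht₀)] at h1
    field_simp at h1
    exact h1

end Analysis

namespace IsDomain

variable {D : Set Pt}

lemma isOpen_times (hD : IsDomain D) : IsOpen (times D) := isOpenMap_fst _ hD.isOpen

lemma isPreconnected_times (hD : IsDomain D) : IsPreconnected (times D) :=
  hD.isConnected.isPreconnected.image _ continuous_fst.continuousOn

lemma mem_times {z : Pt} (hz : z ∈ D) : z.1 ∈ times D := ⟨z, hz, rfl⟩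

/-- A function on a domain whose derivatives with respect to `x` and `ψ` vanish is a function
of `t`. -/
lemma exists_function_of_time (hD : IsDomain D) {F : Type*} [NormedAddCommGroup F]
    [NormedSpace ℝ F] {h : Pt → F} (hh : ContDiffOn ℝ ∞ h D)
    (h0 : ∀ z ∈ D, ∀ (x : ℝ) (c : ℂ), fderiv ℝ h z (0, x, c) = 0) :
    ∃ H : ℝ → F, ContDiffOn ℝ ∞ H (times D) ∧ ∀ z ∈ D, h z = H z.1 := by
  have hs : ∀ z ∈ D, ContDiffAt ℝ ∞ h z := fun z hz => hh.contDiffAt (hD.isOpen.mem_nhds hz)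
  have hconst : ∀ z ∈ D, ∀ z' ∈ D, z.1 = z'.1 → h z = h z' := by
    rintro ⟨t, y⟩ hz ⟨t', y'⟩ hz' rfl
    let U : Set (ℝ × ℂ) := {y | (t, y) ∈ D}
    have hU : IsOpen U := hD.isOpen.preimage (by fun_prop : Continuous fun y : ℝ × ℂ => ((t, y) : Pt))
    -- The connectedness of sections in the definition of a domain is what makes `h` constant on the
    -- whole section, not just locally.
    have hUc : IsPreconnected U := by
      have h1 := (hD.section_connected t).image Prod.snd continuous_snd.continuousOn
      convert! h1 using 1
      ext w
      constructor
      · intro hw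
        exact ⟨(t, w), ⟨hw, rfl⟩, rfl⟩
      · rintro ⟨⟨s, v⟩, ⟨hv, rfl⟩, rfl⟩
        exact hv
    have hder : ∀ w ∈ U, HasFDerivAt (fun w : ℝ × ℂ => h (t, w)) (0 : ℝ × ℂ →L[ℝ] F) w := by
      intro w hw
      have h1 : HasFDerivAt h (fderiv ℝ h (t, w)) (t, w) := hasFDerivAt_of_smooth (hs _ hw)
      have h2 : HasFDerivAt (fun w : ℝ × ℂ => h (t, w)) _ w :=
        HasFDerivAt.comp w h1 (hasFDerivAt_prodMk_right t w)
      refine h2.congr_fderiv ?_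
      refine ContinuousLinearMap.ext fun v => ?_
      exact h0 _ hw v.1 v.2
    exact hU.is_const_of_fderiv_eq_zero hUc
      (fun w hw => (hder w hw).differentiableAt.differentiableWithinAt)
      (fun w hw => (hder w hw).fderiv) hz hz'
  classical
  let H : ℝ → F := fun t => if ht : ∃ z ∈ D, z.1 = t then h ht.choose else 0
  have hH : ∀ z ∈ D, h z = H z.1 := by
    intro z hz
    have ht : ∃ z' ∈ D, z'.1 = z.1 := ⟨z, hz, rfl⟩
    simp only [H, dif_pos ht]
    exact hconst z hz _ ht.choose_spec.1 ht.choose_spec.2.symm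
  refine ⟨H, ?_, hH⟩
  rintro _ ⟨z, hz, rfl⟩
  have hcont : ContinuousAt (fun t : ℝ => ((t, z.2) : Pt)) z.1 := by fun_prop
  -- By openness nearby sections are reached with `(x, ψ)` fixed, so `H` inherits smoothness from
  -- `h`.
  have h1 : H =ᶠ[𝓝 z.1] fun t => h (t, z.2) := by
    filter_upwards [hcont.eventually (hD.isOpen.mem_nhds hz)] with t ht
    exact (hH _ ht).symm
  have h2 : ContDiffAt ℝ ∞ (fun t : ℝ => h (t, z.2)) z.1 :=
    ContDiffAt.comp (g := h) (f := fun t : ℝ => ((t, z.2) : Pt)) z.1 (hs z hz) (by fun_prop)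
  exact (h2.congr_of_eventuallyEq h1).contDiffWithinAt

end IsDomain

/-! ### Smoothness of the parametrised transformations -/

namespace Params

/-- The constraints on the parameters with the exception of those on `κ`. -/
structure Regular (P : Params) (I : Set ℝ) : Prop where
  smooth_T : ∀ t ∈ I, ContDiffAt ℝ ∞ P.T t
  smooth_X : ∀ t ∈ I, ContDiffAt ℝ ∞ P.X t
  smooth_Θ : ∀ t ∈ I, ContDiffAt ℝ ∞ P.Θ t
  smooth_Ψ : ∀ t ∈ I, ContDiffAt ℝ ∞ P.Ψ t
  T1_ne : ∀ t ∈ I, P.T1 t ≠ 0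
  ε_eq : P.ε = 1 ∨ P.ε = -1

lemma Allowed.regular {P : Params} {γ : ℝ} {I : Set ℝ} (h : P.Allowed γ I) (hI : IsOpen I) :
    P.Regular I where
  smooth_T _ ht := h.smooth_T.contDiffAt (hI.mem_nhds ht)
  smooth_X _ ht := h.smooth_X.contDiffAt (hI.mem_nhds ht)
  smooth_Θ _ ht := h.smooth_Θ.contDiffAt (hI.mem_nhds ht)
  smooth_Ψ _ ht := h.smooth_Ψ.contDiffAt (hI.mem_nhds ht)
  T1_ne := h.deriv_T_ne
  ε_eq := h.ε_eq

lemma hat_eq (P : Params) (t : ℝ) (β : ℂ) : P.hat t β = conjIf (P.T1 t) β := by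
  unfold hat
  split_ifs with h
  · rw [conjIf_pos h]
  · rw [conjIf_nonpos h]

/-- The part of the exponent in the transformation of `ψ` which depends on `x`. -/
noncomputable def phase (P : Params) (t x : ℝ) : ℂ :=
  Complex.I / 8 * ((P.T2 t / |P.T1 t| * x ^ 2 : ℝ) : ℂ)
      + Complex.I / 2 * ((P.ε * P.ε' t * P.X1 t / Real.sqrt |P.T1 t| * x : ℝ) : ℂ)

lemma pointMap_psi (P : Params) (z : Pt) : (P.pointMap z).2.2
    = conjIf (P.T1 z.1) z.2.2
      * Complex.exp (P.phase z.1 z.2.1 + ((P.Θ z.1 : ℂ) + Complex.I * (P.Ψ z.1 : ℂ))) := by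
  rw [← hat_eq, phase, ← add_assoc]
  rfl

section Smooth

variable {P : Params} {I : Set ℝ} {E : Type*} [NormedAddCommGroup E] [NormedSpace ℝ E]
  {a b : E → ℝ} {c : E → ℂ} {y : E}

lemma Regular.smooth_T1 (hP : P.Regular I) {t : ℝ} (ht : t ∈ I) : ContDiffAt ℝ ∞ P.T1 t :=
  smooth_deriv (hP.smooth_T t ht)

lemma Regular.smooth_T2 (hP : P.Regular I) {t : ℝ} (ht : t ∈ I) : ContDiffAt ℝ ∞ P.T2 t :=
  smooth_deriv (hP.smooth_T1 ht)

lemma Regular.smooth_T3 (hP : P.Regular I) {t : ℝ} (ht : t ∈ I) : ContDiffAt ℝ ∞ P.T3 t :=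
  smooth_deriv (hP.smooth_T2 ht)

lemma Regular.smooth_X1 (hP : P.Regular I) {t : ℝ} (ht : t ∈ I) : ContDiffAt ℝ ∞ P.X1 t :=
  smooth_deriv (hP.smooth_X t ht)

lemma Regular.smooth_Ψ1 (hP : P.Regular I) {t : ℝ} (ht : t ∈ I) : ContDiffAt ℝ ∞ P.Ψ1 t :=
  smooth_deriv (hP.smooth_Ψ t ht)

lemma Regular.smooth_XT (hP : P.Regular I) {t : ℝ} (ht : t ∈ I) : ContDiffAt ℝ ∞ P.XT t :=
  smooth_deriv ((hP.smooth_X1 ht).div (hP.smooth_T1 ht) (hP.T1_ne t ht))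

lemma Regular.sqrt_pos (hP : P.Regular I) {t : ℝ} (ht : t ∈ I) : 0 < Real.sqrt |P.T1 t| :=
  Real.sqrt_pos.2 (abs_pos.2 (hP.T1_ne t ht))

lemma Regular.smooth_sqrt (hP : P.Regular I) {t : ℝ} (ht : t ∈ I) :
    ContDiffAt ℝ ∞ (fun s => Real.sqrt |P.T1 s|) t :=
  smooth_sqrt_abs (hP.smooth_T1 ht) (hP.T1_ne t ht)

lemma Regular.smooth_abs (hP : P.Regular I) {t : ℝ} (ht : t ∈ I) :
    ContDiffAt ℝ ∞ (fun s => |P.T1 s|) t := by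
  have h : (fun s => |P.T1 s|) = fun s => Real.sqrt |P.T1 s| ^ 2 := by
    funext s; rw [Real.sq_sqrt (abs_nonneg _)]
  rw [h]
  exact (hP.smooth_sqrt ht).pow 2

lemma Regular.eventually_sign (hP : P.Regular I) {t : ℝ} (ht : t ∈ I) :
    ∀ᶠ s in 𝓝 t, P.ε' s = P.ε' t ∧ conjIf (P.T1 s) = conjIf (P.T1 t) :=
  eventually_sign_eq (hP.smooth_T1 ht).continuousAt (hP.T1_ne t ht)

lemma Regular.smooth_ε' (hP : P.Regular I) {t : ℝ} (ht : t ∈ I) : ContDiffAt ℝ ∞ P.ε' t :=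
  (contDiffAt_const (c := P.ε' t)).congr_of_eventuallyEq
    ((hP.eventually_sign ht).mono fun _ hs => hs.1)

lemma Regular.ε'_ne (hP : P.Regular I) {t : ℝ} (ht : t ∈ I) : P.ε' t ≠ 0 := fun h => by
  have := sign_sq (hP.T1_ne t ht)
  rw [show Real.sign (P.T1 t) = 0 from h] at this
  simp at this

lemma Regular.smooth_hat (hP : P.Regular I) (ha : ContDiffAt ℝ ∞ a y) (hc : ContDiffAt ℝ ∞ c y)
    (hy : a y ∈ I) : ContDiffAt ℝ ∞ (fun y => conjIf (P.T1 (a y)) (c y)) y := by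
  refine ((conjIf (P.T1 (a y))).contDiff.contDiffAt.comp y hc).congr_of_eventuallyEq ?_
  filter_upwards [ha.continuousAt.eventually (hP.eventually_sign hy)] with s hs
  simp [hs.2]

lemma Regular.smooth_phase (hP : P.Regular I) (ha : ContDiffAt ℝ ∞ a y) (hb : ContDiffAt ℝ ∞ b y)
    (hy : a y ∈ I) : ContDiffAt ℝ ∞ (fun y => P.phase (a y) (b y)) y := by
  refine ContDiffAt.add (contDiffAt_const.mul (smooth_ofReal ?_))
    (contDiffAt_const.mul (smooth_ofReal ?_))
  · exact (((hP.smooth_T2 hy).comp y ha).div ((hP.smooth_abs hy).comp y ha)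
      (abs_ne_zero.2 (hP.T1_ne _ hy))).mul (hb.pow 2)
  · exact (((contDiffAt_const.mul ((hP.smooth_ε' hy).comp y ha)).mul
      ((hP.smooth_X1 hy).comp y ha)).div ((hP.smooth_sqrt hy).comp y ha)
      (hP.sqrt_pos hy).ne').mul hb

end Smooth

end Params

end NSchE

/-! ### The general form of admissible transformations -/

namespace NSchE

lemma hasDerivAt_phase {P : Params} {t : ℝ} (x : ℝ) :
    HasDerivAt (fun y : ℝ => P.phase t y)
      (Complex.I * ((P.T2 t / |P.T1 t| * x / 4
        + P.ε * P.ε' t * P.X1 t / Real.sqrt |P.T1 t| / 2 : ℝ) : ℂ)) x := by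
  have h1 : HasDerivAt (fun y : ℝ => P.T2 t / |P.T1 t| * y ^ 2) (P.T2 t / |P.T1 t| * (2 * x)) x := by
    simpa using (hasDerivAt_pow 2 x).const_mul (P.T2 t / |P.T1 t|)
  have h2 : HasDerivAt (fun y : ℝ => P.ε * P.ε' t * P.X1 t / Real.sqrt |P.T1 t| * y)
      (P.ε * P.ε' t * P.X1 t / Real.sqrt |P.T1 t|) x := by
    simpa using (hasDerivAt_id x).const_mul (P.ε * P.ε' t * P.X1 t / Real.sqrt |P.T1 t|)
  have h3 := (h1.ofReal_comp.const_mul (Complex.I / 8)).add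
    (h2.ofReal_comp.const_mul (Complex.I / 2))
  refine h3.congr_deriv ?_
  push_cast
  ring

lemma fderiv_of_time {F : Type*} [NormedAddCommGroup F] [NormedSpace ℝ F] {D : Set Pt}
    (hD : IsOpen D) {h : Pt → F} {H : ℝ → F} (hH : ∀ z ∈ D, h z = H z.1) {z : Pt} (hz : z ∈ D)
    (hs : DifferentiableAt ℝ H z.1) (v : Pt) : fderiv ℝ h z v = v.1 • deriv H z.1 := by
  have h1 : HasFDerivAt (fun y : Pt => H y.1) _ z := hs.hasFDerivAt.comp z hasFDerivAt_fst
  have h2 : h =ᶠ[𝓝 z] fun y => H y.1 := by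
    filter_upwards [hD.mem_nhds hz] with y hy using hH y hy
  rw [h2.fderiv_eq, h1.fderiv]
  simp

namespace IsAdmissible

variable {γ : ℝ} {θ θ' : ArbElt} {D : Set Pt} {φ : Pt → Pt}

/-- Admissible transformations have the form given by parameter functions of `t`. -/
theorem exists_params (hA : IsAdmissible γ θ θ' D φ) (hγ : γ ≠ 0) :
    ∃ P : Params, P.Regular (times D) ∧ ∀ z ∈ D, φ z = P.pointMap z := by
  have hD := hA.isDomain
  have hto := hD.isOpen_times
  -- the time component
  have hts : ∀ z ∈ D, ContDiffAt ℝ ∞ (fun y => tL (φ y)) z := fun z hz =>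
    tL.contDiff.contDiffAt.comp z (hA.smooth hz)
  obtain ⟨T, hTs, hT⟩ := hD.exists_function_of_time (h := fun y => tL (φ y))
    (fun z hz => (hts z hz).contDiffWithinAt)
    (fun z hz x c => (fderiv_comp_clm tL (hA.smooth hz) _ 0).1.trans (hA.time_vertical hz x c))
  have hTs' : ∀ t ∈ times D, ContDiffAt ℝ ∞ T t := fun t ht => hTs.contDiffAt (hto.mem_nhds ht)
  have hT1 : ∀ z ∈ D, (fderiv ℝ φ z (1, 0, 0)).1 = deriv T z.1 := by
    intro z hz
    have h1 := fderiv_of_time hD.isOpen hT hz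
      ((hTs' _ (IsDomain.mem_times hz)).differentiableAt (by simp)) (1, 0, 0)
    rw [(fderiv_comp_clm tL (hA.smooth hz) _ 0).1] at h1
    simpa [tL_apply] using h1
  have hT1s : ∀ t ∈ times D, ContDiffAt ℝ ∞ (deriv T) t := fun t ht => smooth_deriv (hTs' t ht)
  have hT1ne : ∀ t ∈ times D, deriv T t ≠ 0 := by
    rintro _ ⟨z, hz, rfl⟩
    rw [← hT1 z hz]; exact hA.time_ne_zero hz
  -- the sign of `∂x̃/∂x`
  have hxcont : ContinuousOn (fun z => (fderiv ℝ φ z (0, 1, 0)).2.1) D := fun z hz =>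
    (xL.continuous.continuousAt.comp
      (hasFDerivAt_fderiv_apply (hA.smooth hz) (0, 1, 0)).continuousAt).continuousWithinAt
  obtain ⟨ε, hε, hεx⟩ : ∃ ε : ℝ, (ε = 1 ∨ ε = -1) ∧
      ∀ z ∈ D, (fderiv ℝ φ z (0, 1, 0)).2.1 = ε * Real.sqrt |deriv T z.1| := by
    have hsq : ∀ z ∈ D, Real.sqrt |deriv T z.1| = |(fderiv ℝ φ z (0, 1, 0)).2.1| := by
      intro z hz
      rw [← hT1 z hz, ← hA.space_sq hz, Real.sqrt_sq_eq_abs]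
    rcases constant_sign hD.isConnected.isPreconnected hxcont (fun z hz => hA.space_ne_zero hz)
      with h | h
    · exact ⟨1, Or.inl rfl, fun z hz => by rw [hsq z hz, abs_of_pos (h z hz)]; ring⟩
    · exact ⟨-1, Or.inr rfl, fun z hz => by rw [hsq z hz, abs_of_neg (h z hz)]; ring⟩
  have hε2 : ε * ε = 1 := by rcases hε with rfl | rfl <;> norm_num
  -- the space component
  have hsqs : ∀ t ∈ times D, ContDiffAt ℝ ∞ (fun s => Real.sqrt |deriv T s|) t := fun t ht =>
    smooth_sqrt_abs (hT1s t ht) (hT1ne t ht)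
  -- The difference between `x̃` and its expected part linear in `x`; once its `x`- and
  -- `ψ`-derivatives vanish, it is the function `X(t)`.
  let k : Pt → ℝ := fun y => xL (φ y) - ε * xL y * Real.sqrt |deriv T (tL y)|
  have hxs : ∀ z ∈ D, ContDiffAt ℝ ∞ (fun y => xL (φ y)) z := fun z hz =>
    xL.contDiff.contDiffAt.comp z (hA.smooth hz)
  have hsqz : ∀ z ∈ D, ContDiffAt ℝ ∞ (fun y : Pt => Real.sqrt |deriv T (tL y)|) z := fun z hz =>
    (hsqs _ (IsDomain.mem_times hz)).comp (f := fun y : Pt => tL y) z tL.contDiff.contDiffAt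
  have hks : ∀ z ∈ D, ContDiffAt ℝ ∞ k z := fun z hz =>
    (hxs z hz).sub ((contDiffAt_const.mul xL.contDiff.contDiffAt).mul (hsqz z hz))
  have hk0 : ∀ z ∈ D, ∀ (x : ℝ) (c : ℂ), fderiv ℝ k z (0, x, c) = 0 := by
    intro z hz x c
    have h1 := hasDerivAt_comp_line ((hks z hz).differentiableAt (by simp)) (0, x, c)
    have h2 := hasDerivAt_comp_line ((hxs z hz).differentiableAt (by simp)) (0, x, c)
    have h3 : HasDerivAt (fun r : ℝ => ε * (z.2.1 + r * x) * Real.sqrt |deriv T z.1|)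
        (ε * x * Real.sqrt |deriv T z.1|) 0 := by
      have := ((((hasDerivAt_id (0:ℝ)).mul_const x).const_add z.2.1).const_mul ε).mul_const
        (Real.sqrt |deriv T z.1|)
      simpa using this
    have h4 : (fun r : ℝ => k (z + r • (0, x, c)))
        = fun r : ℝ => xL (φ (z + r • (0, x, c)))
          - ε * (z.2.1 + r * x) * Real.sqrt |deriv T z.1| := by
      funext r
      simp [k, xL_apply, tL_apply]
    rw [h4] at h1
    rw [h1.unique (h2.sub h3), (fderiv_comp_clm xL (hA.smooth hz) _ 0).1, xL_apply]
    have h5 : ((0, x, c) : Pt) = x • (0, 1, 0) + (0, 0, c) := by simp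
    rw [h5, map_add, map_smul]
    simp only [Prod.snd_add, Prod.fst_add, Prod.smul_snd, Prod.smul_fst, hεx z hz,
      hA.space_vertical hz, smul_eq_mul]
    ring
  obtain ⟨X, hXs, hX⟩ := hD.exists_function_of_time (fun z hz => (hks z hz).contDiffWithinAt) hk0
  have hXs' : ∀ t ∈ times D, ContDiffAt ℝ ∞ X t := fun t ht => hXs.contDiffAt (hto.mem_nhds ht)
  have hX' : ∀ z ∈ D, (φ z).2.1 = ε * z.2.1 * Real.sqrt |deriv T z.1| + X z.1 := by
    intro z hz
    rw [← hX z hz]; simp [k, xL_apply, tL_apply]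
  -- `Θ = Ψ = 0` and `κ = 1` are placeholders: the phase only involves `T`, `X` and `ε`.
  let P₀ : Params := ⟨T, X, 0, 0, ε, 1⟩
  have hP₀ : P₀.Regular (times D) :=
    ⟨hTs', hXs', fun _ _ => contDiffAt_const, fun _ _ => contDiffAt_const, hT1ne, hε⟩
  -- The ratio `x̃_t / x̃_x` is the coefficient in the second equation of `determining_coeff`, so it
  -- fixes the `x`-dependence of the phase.
  have hxt : ∀ z ∈ D, (fderiv ℝ φ z (1, 0, 0)).2.1 / (fderiv ℝ φ z (0, 1, 0)).2.1
      = z.2.1 * Real.sign (deriv T z.1) * P₀.T2 z.1 / (2 * |deriv T z.1|)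
        + ε * P₀.X1 z.1 / Real.sqrt |deriv T z.1| := by
    intro z hz
    have ht := IsDomain.mem_times hz
    have h2 := hasDerivAt_comp_line ((hxs z hz).differentiableAt (by simp)) (1, 0, 0)
    have h3 : HasDerivAt (fun r : ℝ => z.1 + r) 1 0 := (hasDerivAt_id (0:ℝ)).const_add z.1
    have hz0 : z.1 + 0 = z.1 := add_zero _
    have h4 : HasDerivAt (fun r : ℝ => Real.sqrt |deriv T (z.1 + r)|) _ 0 :=
      HasDerivAt.comp (h₂ := fun s => Real.sqrt |deriv T s|) 0 (by
        rw [hz0]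
        exact hasDerivAt_sqrt_abs ((hT1s _ ht).differentiableAt (by simp)).hasDerivAt (hT1ne _ ht)) h3
    have h5 : HasDerivAt (fun r : ℝ => X (z.1 + r)) _ 0 :=
      HasDerivAt.comp (h₂ := X) 0 (by
        rw [hz0]; exact ((hXs' _ ht).differentiableAt (by simp)).hasDerivAt) h3
    have h6 := (h4.const_mul (ε * z.2.1)).add h5
    have h7 : (fun r : ℝ => xL (φ (z + r • ((1, 0, 0) : Pt)))) =ᶠ[𝓝 0]
        fun r => ε * z.2.1 * Real.sqrt |deriv T (z.1 + r)| + X (z.1 + r) := by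
      have hl : ContinuousAt (fun r : ℝ => z + r • ((1, 0, 0) : Pt)) 0 := by fun_prop
      have hl' : Filter.Tendsto (fun r : ℝ => z + r • ((1, 0, 0) : Pt)) (𝓝 0) (𝓝 z) := by
        simpa [ContinuousAt] using hl
      filter_upwards [hl'.eventually (hD.isOpen.mem_nhds hz)] with r hr
      have := hX' _ hr
      rw [xL_apply, this]
      simp
    have h8 := h2.unique (h6.congr_of_eventuallyEq h7)
    rw [(fderiv_comp_clm xL (hA.smooth hz) _ 0).1, xL_apply] at h8
    rw [h8, hεx z hz]
    have hpos : 0 < Real.sqrt |deriv T z.1| := Real.sqrt_pos.2 (abs_pos.2 (hT1ne _ ht))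
    have hsq : |deriv T z.1| = Real.sqrt |deriv T z.1| ^ 2 := (Real.sq_sqrt (abs_nonneg _)).symm
    have hε0 : ε ≠ 0 := fun h => by simp [h] at hε2
    change (ε * z.2.1 * (Real.sign (deriv T z.1) * P₀.T2 z.1 / (2 * Real.sqrt |deriv T z.1|) * 1)
      + P₀.X1 z.1 * 1) / _ = _
    generalize Real.sqrt |deriv T z.1| = R at *
    rw [hsq]
    field_simp
    linear_combination (-2 * R * P₀.X1 z.1) * hε2
  -- the component `ψ`
  let E : Pt → ℂ := fun y => conjIf (deriv T (tL y)) (psiL y) * Complex.exp (P₀.phase (tL y) (xL y))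
  have hE0 : ∀ z ∈ D, E z ≠ 0 := fun z hz =>
    mul_ne_zero (fun h => hD.ne_zero z hz (conjIf_eq_zero.1 h)) (Complex.exp_ne_zero _)
  have hps : ∀ z ∈ D, ContDiffAt ℝ ∞ (fun y => psiL (φ y)) z := fun z hz =>
    psiL.contDiff.contDiffAt.comp z (hA.smooth hz)
  have hEs : ∀ z ∈ D, ContDiffAt ℝ ∞ E z := by
    intro z hz
    have ht := IsDomain.mem_times hz
    exact (hP₀.smooth_hat tL.contDiff.contDiffAt psiL.contDiff.contDiffAt ht).mul
      (hP₀.smooth_phase tL.contDiff.contDiffAt xL.contDiff.contDiffAt ht).cexp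
  let q : Pt → ℂ := fun y => psiL (φ y) * (E y)⁻¹
  have hqs : ∀ z ∈ D, ContDiffAt ℝ ∞ q z := fun z hz => (hps z hz).mul ((hEs z hz).inv (hE0 z hz))
  -- Differentiating `ψ̃_ψ ψ = ψ̃` in `x` gives `ψ̃_xψ ψ = ψ̃_x`, and the second equation of
  -- `determining_coeff` turns this into a linear equation for `ψ̃` in `x`.
  have hψx : ∀ z ∈ D, (fderiv ℝ φ z (0, 1, 0)).2.2
      = Complex.I * ((P₀.T2 z.1 / |P₀.T1 z.1| * z.2.1 / 4
        + P₀.ε * P₀.ε' z.1 * P₀.X1 z.1 / Real.sqrt |P₀.T1 z.1| / 2 : ℝ) : ℂ) * (φ z).2.2 := by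
    intro z hz
    have h1 : (fun y : Pt => psiL (fderiv ℝ φ y (vertL (psiL y)))) =ᶠ[𝓝 z] fun y => psiL (φ y) := by
      filter_upwards [hD.isOpen.mem_nhds hz] with y hy
      exact hA.vertical_self hγ hy
    have h2 : HasFDerivAt (fun y : Pt => fderiv ℝ φ y (vertL (psiL y))) _ z :=
      (hasFDerivAt_of_smooth (smooth_fderiv (hA.smooth hz))).clm_apply
        ((vertL.comp psiL).hasFDerivAt)
    have h3 : HasFDerivAt (fun y : Pt => psiL (fderiv ℝ φ y (vertL (psiL y)))) _ z :=
      psiL.hasFDerivAt.comp z h2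
    have h4 := DFunLike.congr_fun (h3.unique (h1.hasFDerivAt_iff.2
      (hasFDerivAt_of_smooth (hps z hz)))) (0, 1, 0)
    have h5 : psiL (fderiv ℝ (fderiv ℝ φ) z (0, 1, 0) (vertL (psiL z)))
        = fderiv ℝ (fun y => psiL (φ y)) z (0, 1, 0) := by
      have h0 : vertL (psiL ((0, 1, 0) : Pt)) = 0 := rfl
      rw [← h4]
      simp [h0]
    rw [(fderiv_comp_clm psiL (hA.smooth hz) _ 0).1] at h5
    have h6 := (hA.determining_coeff hz).2.1 z.2.2
    rw [hA.vertical_self hγ hz, hxt z hz, hT1 z hz] at h6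
    change (fderiv ℝ (fderiv ℝ φ) z (0, 1, 0) (0, 0, z.2.2)).2.2 = _ at h5
    rw [h5, psiL_apply] at h6
    rw [h6, Complex.real_smul]
    have e1 : P₀.T1 z.1 = deriv T z.1 := rfl
    have e2 : P₀.ε' z.1 = Real.sign (deriv T z.1) := rfl
    have e3 : P₀.ε = ε := rfl
    rw [e1, e2, e3]
    have e4 := sign_sq (hT1ne _ (IsDomain.mem_times hz))
    have e5 : Real.sign (deriv T z.1) * (z.2.1 * Real.sign (deriv T z.1) * P₀.T2 z.1
          / (2 * |deriv T z.1|) + ε * P₀.X1 z.1 / Real.sqrt |deriv T z.1|) / 2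
        = P₀.T2 z.1 / |deriv T z.1| * z.2.1 / 4
          + ε * Real.sign (deriv T z.1) * P₀.X1 z.1 / Real.sqrt |deriv T z.1| / 2 := by
      linear_combination (z.2.1 * P₀.T2 z.1 / |deriv T z.1| / 4) * e4
    rw [e5]
    ring
  have hq0 : ∀ z ∈ D, ∀ (x : ℝ) (c : ℂ), fderiv ℝ q z (0, x, c) = 0 := by
    intro z hz x c
    have ht := IsDomain.mem_times hz
    have h1 := hasDerivAt_comp_line ((hqs z hz).differentiableAt (by simp)) (0, x, c)
    have h2 := hasDerivAt_comp_line ((hps z hz).differentiableAt (by simp)) (0, x, c)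
    have hψ0 : conjIf (deriv T z.1) z.2.2 ≠ 0 := fun h => hD.ne_zero z hz (conjIf_eq_zero.1 h)
    have h3 : HasDerivAt (fun r : ℝ => conjIf (deriv T z.1) (z.2.2 + r • c))
        (conjIf (deriv T z.1) c) 0 :=
      ((conjIf (deriv T z.1)).hasFDerivAt (x := z.2.2 + (0:ℝ) • c)).comp_hasDerivAt 0
        (hasDerivAt_line z.2.2 c 0)
    have h4 : HasDerivAt (fun r : ℝ => z.2.1 + r * x) x 0 := by
      simpa using ((hasDerivAt_id (0:ℝ)).mul_const x).const_add z.2.1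
    have h5 := (HasDerivAt.scomp (g₁ := fun y : ℝ => P₀.phase z.1 y) (0:ℝ)
      (hasDerivAt_phase (P := P₀) (t := z.1) (z.2.1 + 0 * x)) h4).cexp
    have h6 := h3.mul h5
    have h7 : (fun r : ℝ => E (z + r • (0, x, c)))
        = (fun r : ℝ => conjIf (deriv T z.1) (z.2.2 + r • c))
          * fun r => Complex.exp (((fun y : ℝ => P₀.phase z.1 y) ∘ fun r => z.2.1 + r * x) r) := by
      funext r
      simp [E, xL_apply, tL_apply, psiL_apply]
    have h8 := h6
    rw [← h7] at h8
    -- Differentiating the product `q E = ψ̃` instead of the quotient: `E` satisfies the same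
    -- first-order equations in `x` and `ψ` as `ψ̃`, hence `q` is constant in these directions.
    have h9 : HasDerivAt (fun r : ℝ => q (z + r • (0, x, c)) * E (z + r • (0, x, c))) _ 0 :=
      h1.mul h8
    have h10 : (fun r : ℝ => q (z + r • (0, x, c)) * E (z + r • (0, x, c))) =ᶠ[𝓝 0]
        fun r : ℝ => psiL (φ (z + r • (0, x, c))) := by
      have hl : ContinuousAt (fun r : ℝ => z + r • ((0, x, c) : Pt)) 0 := by fun_prop
      have hl' : Filter.Tendsto (fun r : ℝ => z + r • ((0, x, c) : Pt)) (𝓝 0) (𝓝 z) := by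
        simpa [ContinuousAt] using hl
      filter_upwards [hl'.eventually (hD.isOpen.mem_nhds hz)] with r hr
      simp only [q]
      rw [inv_mul_cancel_right₀ (hE0 _ hr)]
    have h11 := h9.unique (h2.congr_of_eventuallyEq h10)
    rw [(fderiv_comp_clm psiL (hA.smooth hz) _ 0).1, psiL_apply] at h11
    have e5 : ((0, x, c) : Pt) = x • (0, 1, 0) + (0, 0, c) := by simp
    have e6 : (fderiv ℝ φ z (0, x, c)).2.2 = x • (fderiv ℝ φ z (0, 1, 0)).2.2
        + (fderiv ℝ φ z (0, 0, c)).2.2 := by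
      rw [e5, map_add, map_smul]; rfl
    have e7 := hA.vertical_eq hz c
    have e8 := hA.vertical_eq hz z.2.2
    rw [hA.vertical_self hγ hz] at e8
    rw [e6, hψx z hz, e7, e8, hT1 z hz] at h11
    simp only [zero_smul, add_zero, zero_mul, Function.comp_apply] at h11
    have e9 : q z * E z = (φ z).2.2 := by
      simp only [q]
      rw [inv_mul_cancel_right₀ (hE0 _ hz)]; rfl
    have e10 : E z = conjIf (deriv T z.1) z.2.2 * Complex.exp (P₀.phase z.1 z.2.1) := rfl
    rw [e8, hT1 z hz, e10] at e9
    have e11 : q z * Complex.exp (P₀.phase z.1 z.2.1) = (fderiv ℝ φ z (0, 0, 1)).2.2 :=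
      mul_right_cancel₀ hψ0 (by linear_combination e9)
    rw [← e11] at h11
    rw [e10] at h11
    simp only [Complex.real_smul] at h11
    have e12 : fderiv ℝ q z (0, x, c)
        * (conjIf (deriv T z.1) z.2.2 * Complex.exp (P₀.phase z.1 z.2.1)) = 0 := by
      linear_combination h11
    exact (mul_eq_zero.1 e12).resolve_right (hE0 z hz)
  obtain ⟨H, hHs, hH⟩ := hD.exists_function_of_time (fun z hz => (hqs z hz).contDiffWithinAt) hq0
  have hH0 : ∀ t ∈ times D, H t ≠ 0 := by
    rintro _ ⟨z, hz, rfl⟩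
    rw [← hH z hz]
    exact mul_ne_zero (hA.ne_zero z hz) (inv_ne_zero (hE0 z hz))
  -- The remaining factor `H(t)` is nonvanishing; the real and imaginary parts of its logarithm are
  -- `Θ` and `Ψ`.
  obtain ⟨L, hLs, hL⟩ := exists_smooth_log hto hD.isPreconnected_times hHs hH0
  have hLs' : ∀ t ∈ times D, ContDiffAt ℝ ∞ L t := fun t ht => hLs.contDiffAt (hto.mem_nhds ht)
  -- The value `κ = 1` is provisional: `Regular` does not constrain it, and `pointMap` does not use
  -- it.
  refine ⟨⟨T, X, fun t => (L t).re, fun t => (L t).im, ε, 1⟩,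
    ⟨hTs', hXs', ?_, ?_, hT1ne, hε⟩, ?_⟩
  · exact fun t ht => Complex.reCLM.contDiff.contDiffAt.comp t (hLs' t ht)
  · exact fun t ht => Complex.imCLM.contDiff.contDiffAt.comp t (hLs' t ht)
  · intro z hz
    have ht := IsDomain.mem_times hz
    refine Prod.ext (hT z hz) (Prod.ext (hX' z hz) ?_)
    rw [Params.pointMap_psi]
    have h1 : (φ z).2.2 = q z * E z := by
      simp only [q]
      rw [inv_mul_cancel_right₀ (hE0 _ hz)]; rfl
    have h2 : (((L z.1).re : ℂ) + Complex.I * ((L z.1).im : ℂ)) = L z.1 := by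
      rw [mul_comm]; exact Complex.re_add_im _
    rw [h1, hH z hz, hL _ ht, Complex.exp_add, h2]
    change _ = conjIf (deriv T z.1) z.2.2 * (Complex.exp (P₀.phase z.1 z.2.1) * Complex.exp (L z.1))
    change _ * (conjIf (deriv T z.1) z.2.2 * Complex.exp (P₀.phase z.1 z.2.1)) = _
    ring

end IsAdmissible

end NSchE

/-! ### Derivatives of the explicit transformation and the rule for the left-hand side -/

namespace NSchE

namespace Params

variable {P : Params} {I : Set ℝ}

/-- The derivative of the phase with respect to `x`. -/
noncomputable def phaseX (P : Params) (t x : ℝ) : ℂ :=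
  Complex.I * ((P.T2 t / |P.T1 t| * x / 4
        + P.ε * P.ε' t * P.X1 t / Real.sqrt |P.T1 t| / 2 : ℝ) : ℂ)

/-- The derivative of the phase with respect to `t`. -/
noncomputable def phaseT (P : Params) (t x : ℝ) : ℂ :=
  Complex.I * ((P.ε' t * (P.T3 t * P.T1 t - P.T2 t ^ 2) / P.T1 t ^ 2 * x ^ 2 / 8
        + P.ε * (P.ε' t * deriv P.X1 t / Real.sqrt |P.T1 t|
          - P.X1 t * P.T2 t / (2 * Real.sqrt |P.T1 t| ^ 3)) * x / 2 : ℝ) : ℂ)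

/-- The factor by which `ψ` or `ψ*` is multiplied. -/
noncomputable def factor (P : Params) (t x : ℝ) : ℂ :=
  Complex.exp (P.phase t x + ((P.Θ t : ℂ) + Complex.I * (P.Ψ t : ℂ)))

lemma pointMap_psi' (P : Params) (z : Pt) :
    (P.pointMap z).2.2 = conjIf (P.T1 z.1) z.2.2 * P.factor z.1 z.2.1 := P.pointMap_psi z

lemma factor_ne_zero (P : Params) (t x : ℝ) : P.factor t x ≠ 0 := Complex.exp_ne_zero _

lemma abs_T1 (P : Params) (t : ℝ) : |P.T1 t| = Real.sqrt |P.T1 t| ^ 2 :=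
  (Real.sq_sqrt (abs_nonneg _)).symm

lemma T1_eq (P : Params) (t : ℝ) (h : P.T1 t ≠ 0) : P.T1 t = P.ε' t * Real.sqrt |P.T1 t| ^ 2 := by
  rw [← abs_T1, ε', ← sign_mul_self, ← mul_assoc, sign_sq h, one_mul]

lemma hasDerivAt_of_smooth {F : Type*} [NormedAddCommGroup F] [NormedSpace ℝ F] {f : ℝ → F} {t : ℝ}
    (hf : ContDiffAt ℝ ∞ f t) : HasDerivAt f (deriv f t) t :=
  (hf.differentiableAt (by simp)).hasDerivAt

lemma Regular.hasDerivAt_phase_time (hP : P.Regular I) {t : ℝ} (ht : t ∈ I) (x : ℝ) :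
    HasDerivAt (fun s => P.phase s x) (P.phaseT t x) t := by
  have hT2 : HasDerivAt P.T2 (P.T3 t) t := hasDerivAt_of_smooth (hP.smooth_T2 ht)
  have hT1 : HasDerivAt P.T1 (P.T2 t) t := hasDerivAt_of_smooth (hP.smooth_T1 ht)
  have hX1 := hasDerivAt_of_smooth (hP.smooth_X1 ht)
  have hR : HasDerivAt (fun s => Real.sqrt |P.T1 s|)
      (P.ε' t * P.T2 t / (2 * Real.sqrt |P.T1 t|)) t := hasDerivAt_sqrt_abs hT1 (hP.T1_ne t ht)
  have hR0 := (hP.sqrt_pos ht).ne'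
  have h1 : HasDerivAt (fun s => P.T2 s / Real.sqrt |P.T1 s| ^ 2 * x ^ 2) _ t :=
    (hT2.div (hR.pow 2) (pow_ne_zero 2 hR0)).mul_const (x ^ 2)
  have h2 : HasDerivAt (fun s => P.ε * P.ε' t * P.X1 s / Real.sqrt |P.T1 s| * x) _ t :=
    ((hX1.const_mul (P.ε * P.ε' t)).div hR hR0).mul_const x
  have h3 := (h1.ofReal_comp.const_mul (Complex.I / 8)).add
    (h2.ofReal_comp.const_mul (Complex.I / 2))
  -- Locally the sign is frozen and `|T_t|` is the square of its root, so only one nonsmooth-looking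
  -- function remains to be differentiated.
  have h4 : (fun s => P.phase s x) =ᶠ[𝓝 t] fun s =>
      Complex.I / 8 * ((P.T2 s / Real.sqrt |P.T1 s| ^ 2 * x ^ 2 : ℝ) : ℂ)
      + Complex.I / 2 * ((P.ε * P.ε' t * P.X1 s / Real.sqrt |P.T1 s| * x : ℝ) : ℂ) := by
    filter_upwards [hP.eventually_sign ht] with s hs
    rw [phase, hs.1, ← abs_T1 P s]
  refine (h3.congr_of_eventuallyEq h4).congr_deriv ?_
  have hT1' := T1_eq P t (hP.T1_ne t ht)
  have hs2 : P.ε' t * P.ε' t = 1 := sign_sq (hP.T1_ne t ht)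
  have he := hP.ε'_ne ht
  rw [phaseT]
  simp only [Pi.pow_apply]
  generalize Real.sqrt |P.T1 t| = R at *
  rw [hT1']
  generalize P.ε' t = e at *
  have e1 : ((P.T3 t * R ^ 2 - P.T2 t * (↑2 * R ^ (2 - 1) * (e * P.T2 t / (2 * R)))) / (R ^ 2) ^ 2 * x ^ 2) / 8
      = e * (P.T3 t * (e * R ^ 2) - P.T2 t ^ 2) / (e * R ^ 2) ^ 2 * x ^ 2 / 8 := by
    rcases mul_self_eq_one_iff.1 hs2 with h | h <;> rw [h] <;> field_simp <;> ring_nf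
  have e2 : (P.ε * e * deriv P.X1 t * R - P.ε * e * P.X1 t * (e * P.T2 t / (2 * R))) / R ^ 2 * x / 2
      = P.ε * (e * deriv P.X1 t / R - P.X1 t * P.T2 t / (2 * R ^ 3)) * x / 2 := by
    rcases mul_self_eq_one_iff.1 hs2 with h | h <;> rw [h] <;> field_simp
  rw [← e1, ← e2]
  push_cast
  ring

lemma Regular.smooth_factor (hP : P.Regular I) {E : Type*} [NormedAddCommGroup E] [NormedSpace ℝ E]
    {a b : E → ℝ} {y : E} (ha : ContDiffAt ℝ ∞ a y) (hb : ContDiffAt ℝ ∞ b y)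
    (hy : a y ∈ I) : ContDiffAt ℝ ∞ (fun y => P.factor (a y) (b y)) y :=
  ((hP.smooth_phase ha hb hy).add ((smooth_ofReal ((hP.smooth_Θ _ hy).comp y ha)).add
    (contDiffAt_const.mul (smooth_ofReal ((hP.smooth_Ψ _ hy).comp y ha))))).cexp

lemma Regular.smooth_pointMap (hP : P.Regular I) {z : Pt} (hz : z.1 ∈ I) :
    ContDiffAt ℝ ∞ P.pointMap z := by
  have ht : ContDiffAt ℝ ∞ (fun y : Pt => y.1) z := contDiffAt_fst
  have hx : ContDiffAt ℝ ∞ (fun y : Pt => y.2.1) z := contDiffAt_snd.fst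
  have hψ : ContDiffAt ℝ ∞ (fun y : Pt => y.2.2) z := contDiffAt_snd.snd
  have h3 : ContDiffAt ℝ ∞ (fun y : Pt => (P.pointMap y).2.2) z := by
    simp only [pointMap_psi']
    exact (hP.smooth_hat ht hψ hz).mul (hP.smooth_factor ht hx hz)
  have h2 : ContDiffAt ℝ ∞ (fun y : Pt => (P.pointMap y).2.1) z :=
    ((contDiffAt_const.mul hx).mul ((hP.smooth_sqrt hz).comp z ht)).add ((hP.smooth_X _ hz).comp z ht)
  have h1 : ContDiffAt ℝ ∞ (fun y : Pt => (P.pointMap y).1) z := (hP.smooth_T _ hz).comp z ht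
  exact h1.prodMk (h2.prodMk h3)

lemma hasDerivAt_factor_x (P : Params) (t x : ℝ) :
    HasDerivAt (fun y => P.factor t y) (P.factor t x * P.phaseX t x) x :=
  ((hasDerivAt_phase (P := P) (t := t) x).add_const _).cexp

lemma Regular.hasDerivAt_factor_t (hP : P.Regular I) {t : ℝ} (ht : t ∈ I) (x : ℝ) :
    HasDerivAt (fun s => P.factor s x)
      (P.factor t x * (P.phaseT t x + ((P.Θ1 t : ℂ) + Complex.I * (P.Ψ1 t : ℂ)))) t :=
  ((hP.hasDerivAt_phase_time ht x).add
    ((hasDerivAt_of_smooth (hP.smooth_Θ t ht)).ofReal_comp.add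
      ((hasDerivAt_of_smooth (hP.smooth_Ψ t ht)).ofReal_comp.const_mul Complex.I))).cexp

/-- The derivative of the transformation in a direction transversal to `t = const`. -/
lemma Regular.fderiv_time (hP : P.Regular I) {z : Pt} (hz : z.1 ∈ I) (a : ℂ) :
    fderiv ℝ P.pointMap z (1, 0, a) =
      (P.T1 z.1, P.ε * z.2.1 * (P.ε' z.1 * P.T2 z.1 / (2 * Real.sqrt |P.T1 z.1|)) + P.X1 z.1,
        (conjIf (P.T1 z.1) a + (P.phaseT z.1 z.2.1 + ((P.Θ1 z.1 : ℂ) + Complex.I * (P.Ψ1 z.1 : ℂ)))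
            * conjIf (P.T1 z.1) z.2.2) * P.factor z.1 z.2.1) := by
  have h1 := hasDerivAt_comp_line ((hP.smooth_pointMap hz).differentiableAt (by simp)) (1, 0, a)
  refine h1.unique ?_
  have hsh : HasDerivAt (fun r : ℝ => z.1 + r) 1 0 := (hasDerivAt_id (0:ℝ)).const_add z.1
  have hz0 : z.1 + 0 = z.1 := add_zero _
  have hshift : ∀ {F : Type} [NormedAddCommGroup F] [NormedSpace ℝ F] {f : ℝ → F} {f' : F},
      HasDerivAt f f' z.1 → HasDerivAt (fun r : ℝ => f (z.1 + r)) f' 0 := by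
    intro F _ _ f f' hf
    have hf' : HasDerivAt f f' (z.1 + 0) := by rw [hz0]; exact hf
    exact (hf'.scomp (0:ℝ) hsh).congr_deriv (one_smul _ _)
  have hT1 : HasDerivAt P.T1 (P.T2 z.1) z.1 := hasDerivAt_of_smooth (hP.smooth_T1 hz)
  have c1 : HasDerivAt (fun r : ℝ => (P.pointMap (z + r • ((1, 0, a) : Pt))).1) (P.T1 z.1) 0 := by
    have h := hshift (hasDerivAt_of_smooth (hP.smooth_T _ hz))
    refine h.congr_of_eventuallyEq (Filter.Eventually.of_forall fun r => ?_)
    simp [pointMap]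
  have c2 : HasDerivAt (fun r : ℝ => (P.pointMap (z + r • ((1, 0, a) : Pt))).2.1)
      (P.ε * z.2.1 * (P.ε' z.1 * P.T2 z.1 / (2 * Real.sqrt |P.T1 z.1|)) + P.X1 z.1) 0 := by
    have h := ((hshift (hasDerivAt_sqrt_abs hT1 (hP.T1_ne _ hz))).const_mul (P.ε * z.2.1)).add
      (hshift (hasDerivAt_of_smooth (hP.smooth_X _ hz)))
    refine h.congr_of_eventuallyEq (Filter.Eventually.of_forall fun r => ?_)
    simp [pointMap]
  have c3 : HasDerivAt (fun r : ℝ => (P.pointMap (z + r • ((1, 0, a) : Pt))).2.2)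
      ((conjIf (P.T1 z.1) a + (P.phaseT z.1 z.2.1 + ((P.Θ1 z.1 : ℂ) + Complex.I * (P.Ψ1 z.1 : ℂ)))
            * conjIf (P.T1 z.1) z.2.2) * P.factor z.1 z.2.1) 0 := by
    have hψ : HasDerivAt (fun r : ℝ => conjIf (P.T1 z.1) (z.2.2 + r • a)) (conjIf (P.T1 z.1) a) 0 := by
      have h := ((conjIf (P.T1 z.1)).hasFDerivAt (x := z.2.2 + (0:ℝ) • a)).comp_hasDerivAt 0
        (hasDerivAt_line z.2.2 a 0)
      exact h
    have h := hψ.mul (hshift (hP.hasDerivAt_factor_t hz z.2.1))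
    have hcont : Filter.Tendsto (fun r : ℝ => z.1 + r) (𝓝 0) (𝓝 z.1) := by
      have := hsh.continuousAt
      rwa [ContinuousAt, hz0] at this
    have h' : (fun r : ℝ => (P.pointMap (z + r • ((1, 0, a) : Pt))).2.2) =ᶠ[𝓝 0] fun r =>
        conjIf (P.T1 z.1) (z.2.2 + r • a) * P.factor (z.1 + r) z.2.1 := by
      filter_upwards [hcont.eventually (hP.eventually_sign hz)] with r hr
      rw [pointMap_psi']
      have e1 : (z + r • ((1, 0, a) : Pt)).1 = z.1 + r := by simp
      have e2 : (z + r • ((1, 0, a) : Pt)).2.1 = z.2.1 := by simp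
      have e3 : (z + r • ((1, 0, a) : Pt)).2.2 = z.2.2 + r • a := rfl
      rw [e1, e2, e3, hr.2]
    refine (h.congr_of_eventuallyEq h').congr_deriv ?_
    simp only [zero_smul, add_zero]
    ring
  exact c1.prodMk (c2.prodMk c3)

/-- The transformation along a line in a section `t = const`. -/
lemma pointMap_line (P : Params) (z : Pt) (x : ℝ) (b : ℂ) (r : ℝ) :
    P.pointMap (z + r • ((0, x, b) : Pt)) = (P.T z.1,
      P.ε * (z.2.1 + r * x) * Real.sqrt |P.T1 z.1| + P.X z.1,
      conjIf (P.T1 z.1) (z.2.2 + r • b) * P.factor z.1 (z.2.1 + r * x)) := by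
  refine Prod.ext ?_ (Prod.ext ?_ ?_)
  · simp [pointMap]
  · simp [pointMap]
  · rw [pointMap_psi']; simp

lemma hasDerivAt_section (P : Params) (z : Pt) (x : ℝ) (b : ℂ) (s : ℝ) :
    HasDerivAt (fun r : ℝ => P.pointMap (z + r • ((0, x, b) : Pt)))
      (0, P.ε * x * Real.sqrt |P.T1 z.1|,
        (conjIf (P.T1 z.1) b + x * P.phaseX z.1 (z.2.1 + s * x)
          * conjIf (P.T1 z.1) (z.2.2 + s • b)) * P.factor z.1 (z.2.1 + s * x)) s := by
  simp only [pointMap_line]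
  have hψ : HasDerivAt (fun r : ℝ => conjIf (P.T1 z.1) (z.2.2 + r • b)) (conjIf (P.T1 z.1) b) s := by
    have h := ((conjIf (P.T1 z.1)).hasFDerivAt (x := z.2.2 + s • b)).comp_hasDerivAt s
        (hasDerivAt_line z.2.2 b s)
    exact h
  have hx : HasDerivAt (fun r : ℝ => z.2.1 + r * x) x s := by
    simpa using ((hasDerivAt_id s).mul_const x).const_add z.2.1
  have hf := HasDerivAt.scomp (g₁ := fun y : ℝ => P.factor z.1 y) s
    (P.hasDerivAt_factor_x z.1 (z.2.1 + s * x)) hx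
  refine (hasDerivAt_const _ _).prodMk (HasDerivAt.prodMk ?_ ?_)
  · exact ((hx.const_mul P.ε).mul_const (Real.sqrt |P.T1 z.1|)).add_const (P.X z.1)
  · refine (hψ.mul hf).congr_deriv ?_
    simp only [Function.comp_apply, Complex.real_smul]
    ring

lemma Regular.fderiv_section (hP : P.Regular I) {z : Pt} (hz : z.1 ∈ I) (x : ℝ) (b : ℂ) :
    fderiv ℝ P.pointMap z (0, x, b) = (0, P.ε * x * Real.sqrt |P.T1 z.1|,
        (conjIf (P.T1 z.1) b + x * P.phaseX z.1 z.2.1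
          * conjIf (P.T1 z.1) z.2.2) * P.factor z.1 z.2.1) := by
  have h1 := hasDerivAt_comp_line ((hP.smooth_pointMap hz).differentiableAt (by simp)) (0, x, b)
  have h2 := P.hasDerivAt_section z x b 0
  rw [h1.unique h2]
  simp

lemma Regular.fderiv_fderiv_section (hP : P.Regular I) {z : Pt} (hz : z.1 ∈ I) (x : ℝ) (b : ℂ) :
    fderiv ℝ (fderiv ℝ P.pointMap) z (0, x, b) (0, x, b) = (0, 0,
        (2 * x * P.phaseX z.1 z.2.1 * conjIf (P.T1 z.1) b
          + x ^ 2 * (Complex.I * ((P.T2 z.1 / |P.T1 z.1| / 4 : ℝ) : ℂ) + P.phaseX z.1 z.2.1 ^ 2)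
            * conjIf (P.T1 z.1) z.2.2) * P.factor z.1 z.2.1) := by
  rw [← deriv_deriv_comp_line (hP.smooth_pointMap hz)]
  rw [funext fun s => (P.hasDerivAt_section z x b s).deriv]
  have hψ : HasDerivAt (fun r : ℝ => conjIf (P.T1 z.1) (z.2.2 + r • b)) (conjIf (P.T1 z.1) b) 0 := by
    have h := ((conjIf (P.T1 z.1)).hasFDerivAt (x := z.2.2 + (0:ℝ) • b)).comp_hasDerivAt 0
        (hasDerivAt_line z.2.2 b 0)
    exact h
  have hx : HasDerivAt (fun r : ℝ => z.2.1 + r * x) x 0 := by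
    simpa using ((hasDerivAt_id (0:ℝ)).mul_const x).const_add z.2.1
  have hf := HasDerivAt.scomp (g₁ := fun y : ℝ => P.factor z.1 y) (0:ℝ)
    (P.hasDerivAt_factor_x z.1 (z.2.1 + 0 * x)) hx
  have hp : HasDerivAt (fun r : ℝ => P.phaseX z.1 (z.2.1 + r * x))
      (Complex.I * ((P.T2 z.1 / |P.T1 z.1| * x / 4 : ℝ) : ℂ)) 0 := by
    have h := ((((hx.const_mul (P.T2 z.1 / |P.T1 z.1|)).div_const 4).add_const
      (P.ε * P.ε' z.1 * P.X1 z.1 / Real.sqrt |P.T1 z.1| / 2)).ofReal_comp).const_mul Complex.I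
    exact h
  have h3 := (((hp.const_mul (x : ℂ)).mul hψ).const_add (conjIf (P.T1 z.1) b)).mul hf
  refine HasDerivAt.deriv ((hasDerivAt_const _ _).prodMk ((hasDerivAt_const _ _).prodMk ?_))
  refine h3.congr_deriv ?_
  simp only [Function.comp_apply, Complex.real_smul, zero_mul, zero_smul, add_zero, Pi.mul_apply]
  push_cast
  ring_nf

lemma Regular.XT_eq (hP : P.Regular I) {t : ℝ} (ht : t ∈ I) :
    P.XT t = (deriv P.X1 t * P.T1 t - P.X1 t * P.T2 t) / P.T1 t ^ 2 :=
  ((hasDerivAt_of_smooth (hP.smooth_X1 ht)).div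
    (hasDerivAt_of_smooth (hP.smooth_T1 ht) : HasDerivAt P.T1 (P.T2 t) t) (hP.T1_ne t ht)).deriv

/-- The derivative of the new space variable with respect to `t`, divided by its derivative with
respect to `x`. -/
noncomputable def drift (P : Params) (t x : ℝ) : ℝ :=
  (P.ε * x * (P.ε' t * P.T2 t / (2 * Real.sqrt |P.T1 t|)) + P.X1 t) / (P.ε * Real.sqrt |P.T1 t|)

/-- This is the balance of the terms with `ψ_x`: those produced by the phase in the new second
derivative cancel those produced by the drift of `x̃` in the new time derivative. -/
lemma Regular.phaseX_eq (hP : P.Regular I) {t : ℝ} (ht : t ∈ I) (x : ℝ) :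
    2 * P.phaseX t x / (|P.T1 t| : ℝ) = Complex.I * P.drift t x / (P.T1 t : ℂ) := by
  have hT1' := T1_eq P t (hP.T1_ne t ht)
  have hs2 : P.ε' t * P.ε' t = 1 := sign_sq (hP.T1_ne t ht)
  have hR0 := (hP.sqrt_pos ht).ne'
  have hab := P.abs_T1 t
  rw [phaseX, drift]
  generalize Real.sqrt |P.T1 t| = R at *
  rw [hab, hT1']
  generalize P.ε' t = e at *
  have h : 2 * (P.T2 t / R ^ 2 * x / 4 + P.ε * e * P.X1 t / R / 2) / R ^ 2
      = (P.ε * x * (e * P.T2 t / (2 * R)) + P.X1 t) / (P.ε * R) / (e * R ^ 2) := by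
    rcases hP.ε_eq with h' | h' <;> rcases mul_self_eq_one_iff.1 hs2 with h | h <;>
      rw [h, h'] <;> field_simp <;> ring
  have hc := congrArg (fun r : ℝ => Complex.I * (r : ℂ)) h
  push_cast at hc ⊢
  linear_combination hc

/-- The right-hand side is the coefficient of `ψ̃` in the form in which it arises in the computation
of the transformed left-hand side; the closed formula follows by substituting the derivatives of the
phase. -/
lemma Regular.sMap_eq (hP : P.Regular I) {t : ℝ} (ht : t ∈ I) (x : ℝ) (S : ℂ) :
    P.sMap t x S = conjIf (P.T1 t) S / (|P.T1 t| : ℝ)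
      - (Complex.I / (P.T1 t : ℂ) * (P.phaseT t x + ((P.Θ1 t : ℂ) + Complex.I * (P.Ψ1 t : ℂ))
          - P.drift t x * P.phaseX t x)
        + (Complex.I * ((P.T2 t / |P.T1 t| / 4 : ℝ) : ℂ) + P.phaseX t x ^ 2) / (|P.T1 t| : ℝ)) := by
  have hT1' := T1_eq P t (hP.T1_ne t ht)
  have hs2 : P.ε' t * P.ε' t = 1 := sign_sq (hP.T1_ne t ht)
  have hR0 := (hP.sqrt_pos ht).ne'
  have hab := P.abs_T1 t
  rw [sMap, phaseX, phaseT, drift, hat_eq, hP.XT_eq ht, add_sub_assoc,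
    add_assoc, add_assoc, sub_eq_add_neg (conjIf _ _ / _)]
  congr 1
  generalize Real.sqrt |P.T1 t| = R at *
  rw [hab, hT1']
  generalize P.ε' t = e at *
  have hRc : (R : ℂ) ≠ 0 := by exact_mod_cast hR0
  -- The four sign combinations of `ε` and `ε'` turn the claim into rational identities.
  rcases hP.ε_eq with h' | h' <;> rcases mul_self_eq_one_iff.1 hs2 with h | h <;>
      rw [h, h'] <;> push_cast <;> field_simp <;> ring_nf <;>
      simp only [Complex.I_sq] <;> ring

end Params

lemma lift_eq (f : ℝ × ℝ → ℂ) (p w : ℝ × ℝ) : lift f p w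
    = w.1 • ((1, 0, fderiv ℝ f p (1, 0)) : Pt) + w.2 • (0, 1, fderiv ℝ f p (0, 1)) := by
  have h : w = w.1 • ((1, 0) : ℝ × ℝ) + w.2 • ((0, 1) : ℝ × ℝ) := by ext <;> simp
  have h2 : fderiv ℝ f p w = w.1 • fderiv ℝ f p (1, 0) + w.2 • fderiv ℝ f p (0, 1) := by
    conv_lhs => rw [h]
    rw [map_add, map_smul, map_smul]
  rw [lift, h2]
  simp

/-- Tangent vectors of a graph which are mapped to the coordinate directions. -/
lemma Params.Regular.base_fderiv_lift {P : Params} {I : Set ℝ} (hP : P.Regular I) {p : ℝ × ℝ}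
    {f : ℝ × ℝ → ℂ} (hpI : p.1 ∈ I) :
    base (fderiv ℝ P.pointMap (p.1, p.2, f p)
      (lift f p (0, (P.ε * Real.sqrt |P.T1 p.1|)⁻¹))) = (0, 1) ∧
    base (fderiv ℝ P.pointMap (p.1, p.2, f p)
      (lift f p ((P.T1 p.1)⁻¹, -(P.drift p.1 p.2 * (P.T1 p.1)⁻¹)))) = (1, 0) := by
  have hz : ((p.1, p.2, f p) : Pt).1 ∈ I := hpI
  have hT := hP.T1_ne _ hpI
  have hR := (hP.sqrt_pos hpI).ne'
  have hε : P.ε ≠ 0 := by rcases hP.ε_eq with h | h <;> rw [h] <;> norm_num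
  rw [lift_eq, lift_eq, map_add, map_smul, map_smul, map_add, map_smul, map_smul,
    hP.fderiv_time hz, hP.fderiv_section hz]
  constructor
  · refine Prod.ext ?_ ?_
    · simp [base]
    · simp only [base, Prod.smul_snd, Prod.smul_fst, zero_smul, zero_add, smul_eq_mul, mul_one]
      exact inv_mul_cancel₀ (mul_ne_zero hε hR)
  · refine Prod.ext ?_ ?_
    · simp [base, hT]
    · simp only [base, Prod.snd_add, Prod.fst_add, Prod.smul_snd, Prod.smul_fst, smul_eq_mul,
        Params.drift]
      field_simp
      ring

/-- The transformation rule of the left-hand side of the equation. -/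
lemma lhs_pointMap {P : Params} {I : Set ℝ} (hP : P.Regular I) {γ : ℝ} (θ θ' : ArbElt)
    {D : Set Pt} (hD : IsOpen D) {φ : Pt → Pt} (hφ : ∀ z ∈ D, φ z = P.pointMap z)
    {p : ℝ × ℝ} {f g : ℝ × ℝ → ℂ} (hp : (p.1, p.2, f p) ∈ D) (hpI : p.1 ∈ I)
    (hf : ContDiffAt ℝ ∞ f p) (hg : ContDiffAt ℝ ∞ g (base (φ (p.1, p.2, f p))))
    (hfg : GraphMapsTo φ (p.1, p.2, f p) f g) :
    lhs γ θ' g (base (φ (p.1, p.2, f p)))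
      = P.factor p.1 p.2 / (|P.T1 p.1| : ℝ) * conjIf (P.T1 p.1) (lhs γ θ f p)
        + (θ'.S γ (φ (p.1, p.2, f p)) - P.sMap p.1 p.2 (θ.S γ (p.1, p.2, f p)))
          * (φ (p.1, p.2, f p)).2.2 := by
  have hφe : φ =ᶠ[𝓝 ((p.1, p.2, f p) : Pt)] P.pointMap := by
    filter_upwards [hD.mem_nhds hp] with y hy using hφ y hy
  have hz : ((p.1, p.2, f p) : Pt).1 ∈ I := hpI
  have hφs : ContDiffAt ℝ ∞ φ (p.1, p.2, f p) := (hP.smooth_pointMap hz).congr_of_eventuallyEq hφe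
  have hT := hP.T1_ne _ hpI
  have hR := (hP.sqrt_pos hpI).ne'
  have hε : P.ε ≠ 0 := by rcases hP.ε_eq with h | h <;> rw [h] <;> norm_num
  obtain ⟨a, ha⟩ : ∃ a, a = fderiv ℝ f p (1, 0) := ⟨_, rfl⟩
  obtain ⟨b, hb⟩ : ∃ b, b = fderiv ℝ f p (0, 1) := ⟨_, rfl⟩
  have hl : ∀ w, lift f p w = w.1 • ((1, 0, a) : Pt) + w.2 • (0, 1, b) := by
    rw [ha, hb]; exact lift_eq f p
  have hu := hP.fderiv_time hz a
  have hv := hP.fderiv_section hz 1 b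
  have hvv := hP.fderiv_fderiv_section hz 1 b
  simp only [Complex.ofReal_one, mul_one, one_mul, one_pow] at hu hv hvv
  set R := Real.sqrt |P.T1 p.1| with hRdef
  obtain ⟨he, hk⟩ := hP.base_fderiv_lift (f := f) hpI
  rw [← hφe.fderiv_eq, ← hRdef] at he
  rw [← hφe.fderiv_eq] at hk
  have key := lhs_image (γ := γ) (θ' := θ') hφs hf hg hfg _ _ he hk
  obtain ⟨c, hc⟩ : ∃ c, c = fderiv ℝ (fderiv ℝ f) p (0, 1) (0, 1) := ⟨_, rfl⟩
  have hq : ((0, 0, fderiv ℝ (fderiv ℝ f) p (0, (P.ε * R)⁻¹) (0, (P.ε * R)⁻¹)) : Pt)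
      = ((P.ε * R)⁻¹ * (P.ε * R)⁻¹) • (0, 0, c) := by
    have : ((0, (P.ε * R)⁻¹) : ℝ × ℝ) = (P.ε * R)⁻¹ • (0, 1) := by simp
    rw [this, map_smul, map_smul, smul_apply, ← hc, smul_smul]
    simp
  -- The factor gained by `ψ_xx`; the sign `ε` disappears on squaring.
  have hεR : (P.ε * R)⁻¹ * (P.ε * R)⁻¹ = (|P.T1 p.1|)⁻¹ := by
    rw [Params.abs_T1, ← hRdef]
    rcases hP.ε_eq with h | h <;> rw [h] <;> field_simp
  have hle : lift f p (0, (P.ε * R)⁻¹) = (P.ε * R)⁻¹ • ((0, 1, b) : Pt) := by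
    rw [hl]; simp
  have hc' := hP.fderiv_section hz 0 c
  simp only [mul_zero, zero_mul, Complex.ofReal_zero, add_zero] at hc'
  rw [hq, hle, hφe.fderiv_eq, hφe.fderiv.fderiv_eq, map_smul, map_smul, smul_apply,
    smul_smul, hεR, hvv, map_smul, hc', hl, map_add, map_smul, map_smul, hu, hv] at key
  simp only [Prod.fst_add, Prod.snd_add, Prod.smul_fst, Prod.smul_snd, smul_zero, add_zero,
    zero_smul, sub_zero] at key
  rw [key, lhs_eq hf, ← ha, ← hc, map_add, map_add, conjIf_mul, conjIf_mul, conjIf_I hT,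
    hP.sMap_eq hpI, hφ _ hp, P.pointMap_psi']
  have hpx := hP.phaseX_eq hpI p.2
  have hTc : (P.T1 p.1 : ℂ) ≠ 0 := by exact_mod_cast hT
  have hsg : (P.T1 p.1 : ℂ)⁻¹ = Real.sign (P.T1 p.1) / (|P.T1 p.1| : ℝ) := by
    have : (P.T1 p.1)⁻¹ = Real.sign (P.T1 p.1) / |P.T1 p.1| := by
      rw [eq_div_iff (abs_ne_zero.2 hT), ← sign_mul_self]; field_simp
    exact_mod_cast this
  simp only [Complex.real_smul]
  push_cast
  rw [div_eq_mul_inv _ (P.T1 p.1 : ℂ)] at hpx ⊢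
  rw [hsg] at hpx ⊢
  -- The contributions of `ψ_t`, `ψ_xx` and `ψ` agree identically by now; the terms with `ψ_x` need
  -- `phaseX_eq`.
  linear_combination P.factor p.1 p.2 * conjIf (P.T1 p.1) b * hpx

end NSchE

/-! ### The rules for `S`, `σ` and `V` -/

namespace NSchE

namespace Params

variable {P : Params} {I : Set ℝ} {γ : ℝ}

/-- The phase and `iΨ` are purely imaginary, so the modulus is affected by `Θ` alone. -/
lemma norm_pointMap (P : Params) (z : Pt) :
    ‖(P.pointMap z).2.2‖ = ‖z.2.2‖ * Real.exp (P.Θ z.1) := by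
  rw [pointMap_psi', norm_mul, norm_conjIf, factor, phase, Complex.norm_exp]
  congr 2
  simp only [Complex.add_re, Complex.mul_re, Complex.ofReal_re, Complex.ofReal_im, mul_zero,
    Complex.I_re, zero_mul, Complex.div_ofNat_re, zero_div]
  ring

lemma norm_pointMap_rpow (P : Params) (z : Pt) :
    ‖(P.pointMap z).2.2‖ ^ γ = ‖z.2.2‖ ^ γ * Real.exp (P.Θ z.1) ^ γ := by
  rw [norm_pointMap, Real.mul_rpow (norm_nonneg _) (Real.exp_pos _).le]

/-- The exponent `-1/γ` is chosen for this: the nonlinearity gains exactly the factor `1/|T_t|`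
carried by `S`, up to the constant `κ^γ`, and `σ̃` is constant. -/
lemma Allowed.exp_rpow (hP : P.Allowed γ I) (hγ : γ ≠ 0) {t : ℝ} (ht : t ∈ I) :
    Real.exp (P.Θ t) ^ γ = P.κ ^ γ / |P.T1 t| := by
  rw [hP.exp_Θ t ht, Real.mul_rpow hP.κ_pos.le (Real.rpow_nonneg (abs_nonneg _) _),
    ← Real.rpow_mul (abs_nonneg _), div_mul_cancel₀ _ hγ, Real.rpow_neg_one, ← div_eq_mul_inv]
  rfl

/-- The logarithmic derivative of the constraint on `Θ`; the real logarithm ignores the sign of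
`T_t`, so both orientations of time are covered at once. -/
lemma Allowed.Θ1_eq (hP : P.Allowed γ I) (hI : IsOpen I) {t : ℝ} (ht : t ∈ I) :
    P.Θ1 t = -1 / γ * (P.T2 t / P.T1 t) := by
  have h1 : P.Θ =ᶠ[𝓝 t] fun s => Real.log P.κ + -1 / γ * Real.log (P.T1 s) := by
    filter_upwards [hI.mem_nhds ht] with s hs
    have h0 : 0 < |P.T1 s| := abs_pos.2 (hP.deriv_T_ne s hs)
    rw [← Real.log_exp (P.Θ s), hP.exp_Θ s hs]
    change Real.log (P.κ * |P.T1 s| ^ _) = _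
    rw [Real.log_mul hP.κ_pos.ne' (Real.rpow_pos_of_pos h0 _).ne', Real.log_rpow h0,
      Real.log_abs]
  have hR := hP.regular hI
  have h2 : HasDerivAt P.T1 (P.T2 t) t := hasDerivAt_of_smooth (hR.smooth_T1 ht)
  rw [Θ1, h1.deriv_eq]
  exact (((h2.log (hR.T1_ne t ht)).const_mul _).const_add _).deriv

/-- The rules for `σ` and `V` correspond to the rule for `S`. -/
lemma Allowed.S_rule (hP : P.Allowed γ I) (hI : IsOpen I) (hγ : γ ≠ 0) {z : Pt} (hz : z.1 ∈ I)
    (σ V : ℂ) :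
    P.sigmaMap γ z.1 σ * ((‖(P.pointMap z).2.2‖ ^ γ : ℝ) : ℂ) + P.potentialMap γ z.1 z.2.1 V
      = P.sMap z.1 z.2.1 (σ * ((‖z.2.2‖ ^ γ : ℝ) : ℂ) + V) := by
  have hκ : ((P.κ ^ γ : ℝ) : ℂ) ≠ 0 := by exact_mod_cast (Real.rpow_pos_of_pos hP.κ_pos γ).ne'
  have hT : (P.T1 z.1 : ℂ) ≠ 0 := by exact_mod_cast hP.deriv_T_ne _ hz
  have ha : ((|P.T1 z.1| : ℝ) : ℂ) ≠ 0 := by exact_mod_cast abs_ne_zero.2 (hP.deriv_T_ne _ hz)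
  have hγ' : (γ : ℂ) ≠ 0 := by exact_mod_cast hγ
  rw [norm_pointMap_rpow, hP.exp_rpow hγ hz, sigmaMap, potentialMap, sMap, hat_eq, hat_eq, hat_eq,
    map_add, conjIf_mul, conjIf_ofReal, hP.Θ1_eq hI hz]
  generalize ‖z.2.2‖ ^ γ = n
  generalize P.κ ^ γ = k at *
  generalize |P.T1 z.1| = A at *
  have h1 : conjIf (P.T1 z.1) σ / (k : ℂ) * ((n * (k / A) : ℝ) : ℂ)
      = conjIf (P.T1 z.1) σ * n / A := by
    push_cast
    field_simp
  rw [h1, add_div]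
  -- The term `-iΘ_t/T_t` contributes `i/γ` times `T_tt/T_t²`; together with `-i/4` from the last
  -- term of the rule for `S` this is `iγ'`.
  have h2 : ((P.Ψ1 z.1 : ℂ) - Complex.I * ((-1 / γ * (P.T2 z.1 / P.T1 z.1) : ℝ) : ℂ)) / (P.T1 z.1 : ℂ)
      - ((P.X1 z.1 ^ 2 : ℝ) + Complex.I * (P.T2 z.1 : ℂ)) / (4 * (P.T1 z.1 : ℂ) ^ 2)
      = ((P.Ψ1 z.1 / P.T1 z.1 : ℝ) : ℂ) - ((P.X1 z.1 ^ 2 / (4 * P.T1 z.1 ^ 2) : ℝ) : ℂ)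
    + Complex.I * (((1 / γ - 1 / 4) * (P.T2 z.1 / P.T1 z.1 ^ 2) : ℝ) : ℂ) := by
    push_cast
    field_simp
    ring
  linear_combination -h2

/-- Scaling `ψ` by a positive number multiplies only the nonlinear part of `S`; in the difference
the potential and the inhomogeneous terms cancel, which isolates the rule for `σ`. -/
lemma sMap_smul_sub (P : Params) (t x r : ℝ) (s V : ℂ) :
    P.sMap t x (r * s + V) - P.sMap t x (s + V)
      = (r - 1) * (conjIf (P.T1 t) s / ((|P.T1 t| : ℝ) : ℂ)) := by
  simp only [sMap, hat_eq, map_add, conjIf_mul, conjIf_ofReal]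
  ring

end Params

namespace IsAdmissible

variable {γ : ℝ} {θ θ' : ArbElt} {D : Set Pt} {φ : Pt → Pt} {P : Params} {z : Pt}

/-- The arbitrary elements are transformed by the rule for `S`. -/
lemma S_eq (hA : IsAdmissible γ θ θ' D φ) (hP : P.Regular (times D))
    (hφ : ∀ z ∈ D, φ z = P.pointMap z) (hz : z ∈ D) :
    θ'.S γ (φ z) = P.sMap z.1 z.2.1 (θ.S γ z) := by
  set p : ℝ × ℝ := (z.1, z.2.1) with hp
  -- A simple jet on the first equation: `ψ_t = ψ_x = 0` and `ψ_xx = -Sψ`.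
  set f := quadratic p z.2.2 0 0 0 (-(θ.S γ z * z.2.2)) with hf
  have hfp : f p = z.2.2 := quadratic_self ..
  have hzf : ((p.1, p.2, f p) : Pt) = z := by rw [hfp]
  have hfs : ContDiffAt ℝ ∞ f p := (quadratic_smooth ..).contDiffAt
  have hφe : φ =ᶠ[𝓝 ((p.1, p.2, f p) : Pt)] P.pointMap := by
    rw [hzf]
    filter_upwards [hA.isDomain.isOpen.mem_nhds hz] with y hy using hφ y hy
  have hpD : ((p.1, p.2, f p) : Pt) ∈ D := by rw [hzf]; exact hz
  have hpI : p.1 ∈ times D := IsDomain.mem_times hz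
  obtain ⟨he, hk⟩ := hP.base_fderiv_lift (f := f) hpI
  rw [← hφe.fderiv_eq] at he hk
  obtain ⟨g, hg, hfg⟩ := exists_graphMapsTo hA.transformation hpD hfs _ _ he hk
  have h0 : lhs γ θ f p = 0 := by
    rw [lhs_eq hfs, fderiv_quadratic, fderiv_fderiv_quadratic, hzf, hfp]
    simp
  have h1 := (hA.maps p f g hpD hfs hg hfg).1 h0
  rw [lhs_pointMap hP θ θ' hA.isDomain.isOpen hφ hpD hpI hfs hg hfg, h0, map_zero, mul_zero,
    zero_add, hzf] at h1
  exact sub_eq_zero.1 ((mul_eq_zero.1 h1).resolve_right (hA.ne_zero z hz))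

/-- The rule for `σ`. -/
lemma sigma_eq (hA : IsAdmissible γ θ θ' D φ) (hγ : γ ≠ 0) (hP : P.Regular (times D))
    (hφ : ∀ z ∈ D, φ z = P.pointMap z) (hz : z ∈ D) :
    θ'.σ * ((Real.exp (P.Θ z.1) ^ γ : ℝ) : ℂ) = conjIf (P.T1 z.1) θ.σ / ((|P.T1 z.1| : ℝ) : ℂ) := by
  have hψ : 0 < ‖z.2.2‖ := norm_pos_iff.2 (hA.isDomain.ne_zero z hz)
  have hc : ContinuousAt (fun r : ℝ => ((z.1, z.2.1, (r : ℂ) * z.2.2) : Pt)) 1 := by fun_prop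
  have hev : ∀ᶠ r : ℝ in 𝓝 1, ((z.1, z.2.1, (r : ℂ) * z.2.2) : Pt) ∈ D := by
    refine hc.eventually (hA.isDomain.isOpen.mem_nhds ?_)
    simpa using hz
  -- By openness `ψ` can be stretched slightly with `(t, x)` fixed. Since `γ ≠ 0`, `r^γ ≠ 1`, and
  -- the two instances of the rule for `S` are independent.
  obtain ⟨r, hrD, hr⟩ : ∃ r : ℝ, ((z.1, z.2.1, (r : ℂ) * z.2.2) : Pt) ∈ D ∧ 1 < r :=
    ((hev.filter_mono nhdsWithin_le_nhds).and self_mem_nhdsWithin :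
      ∀ᶠ r in 𝓝[>] (1:ℝ), _ ∧ _).exists
  have hr0 : 0 < r := one_pos.trans hr
  have hrγ : ((r ^ γ : ℝ) : ℂ) - 1 ≠ 0 := by
    have : r ^ γ ≠ 1 := by
      rcases lt_or_gt_of_ne hγ with h | h
      · exact (Real.rpow_lt_one_of_one_lt_of_neg hr h).ne
      · exact (Real.one_lt_rpow hr h).ne'
    rw [sub_ne_zero]
    exact_mod_cast this
  have hψγ : ((‖z.2.2‖ ^ γ : ℝ) : ℂ) ≠ 0 := by exact_mod_cast (Real.rpow_pos_of_pos hψ γ).ne'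
  have h1 := hA.S_eq hP hφ hz
  have h2 := hA.S_eq hP hφ hrD
  have hb : base (φ (z.1, z.2.1, (r : ℂ) * z.2.2)) = base (φ z) := by
    rw [hφ _ hrD, hφ z hz]; rfl
  have hn : ‖(r : ℂ) * z.2.2‖ ^ γ = r ^ γ * ‖z.2.2‖ ^ γ := by
    rw [norm_mul, Complex.norm_of_nonneg hr0.le, Real.mul_rpow hr0.le (norm_nonneg _)]
  simp only [ArbElt.S, hb] at h1 h2
  rw [hφ z hz, P.norm_pointMap_rpow] at h1
  rw [hφ _ hrD, P.norm_pointMap_rpow, hn, hφ z hz] at h2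
  have h3 := Params.sMap_smul_sub P z.1 z.2.1 (r ^ γ) (θ.σ * ((‖z.2.2‖ ^ γ : ℝ) : ℂ))
    (θ.V (base z))
  have h4 : θ.σ * ((r ^ γ * ‖z.2.2‖ ^ γ : ℝ) : ℂ) + θ.V (base (z.1, z.2.1, (r : ℂ) * z.2.2))
      = ((r ^ γ : ℝ) : ℂ) * (θ.σ * ((‖z.2.2‖ ^ γ : ℝ) : ℂ)) + θ.V (base z) := by
    rw [show base (z.1, z.2.1, (r : ℂ) * z.2.2) = base z from rfl]
    push_cast
    ring
  rw [h4] at h2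
  rw [← h1, ← h2, conjIf_mul, conjIf_ofReal] at h3
  push_cast at h3
  have h5 : (((r ^ γ : ℝ) : ℂ) - 1) * (((‖z.2.2‖ ^ γ : ℝ) : ℂ) *
      (θ'.σ * ((Real.exp (P.Θ z.1) ^ γ : ℝ) : ℂ)
        - conjIf (P.T1 z.1) θ.σ / ((|P.T1 z.1| : ℝ) : ℂ))) = 0 := by
    linear_combination h3
  exact sub_eq_zero.1 ((mul_eq_zero.1 ((mul_eq_zero.1 h5).resolve_left hrγ)).resolve_left hψγ)

/-- Taking moduli in the rule for `σ` gives `|T_t| e^{γΘ} = |σ|/|σ̃|`, a constant; its power `1/γ`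
is the right `κ`. Changing `κ` leaves `pointMap` untouched. -/
theorem exists_allowed (hA : IsAdmissible γ θ θ' D φ) (hγ : γ ≠ 0) :
    ∃ P : Params, P.Allowed γ (times D) ∧ ∀ z ∈ D, φ z = P.pointMap z := by
  obtain ⟨P, hP, hφ⟩ := hA.exists_params hγ
  have hσ : 0 < ‖θ.σ‖ := norm_pos_iff.2 hA.source_mem.1
  have hσ' : 0 < ‖θ'.σ‖ := norm_pos_iff.2 hA.target_mem.1
  refine ⟨{ P with κ := (‖θ.σ‖ / ‖θ'.σ‖) ^ (1 / γ) }, ⟨fun t ht => (hP.smooth_T t ht).contDiffWithinAt,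
    fun t ht => (hP.smooth_X t ht).contDiffWithinAt, fun t ht => (hP.smooth_Θ t ht).contDiffWithinAt,
    fun t ht => (hP.smooth_Ψ t ht).contDiffWithinAt, hP.T1_ne, hP.ε_eq, ?_, ?_⟩, hφ⟩
  · exact Real.rpow_pos_of_pos (div_pos hσ hσ') _
  · rintro _ ⟨z, hz, rfl⟩
    have hT : 0 < |P.T1 z.1| := abs_pos.2 (hP.T1_ne _ (IsDomain.mem_times hz))
    have h1 := congrArg norm (hA.sigma_eq hγ hP hφ hz)
    rw [norm_mul, norm_div, norm_conjIf, Complex.norm_of_nonneg (abs_nonneg _),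
      Complex.norm_of_nonneg (Real.rpow_pos_of_pos (Real.exp_pos _) _).le] at h1
    have h2 : Real.exp (P.Θ z.1) ^ γ = ‖θ.σ‖ / ‖θ'.σ‖ * |P.T1 z.1|⁻¹ := by
      field_simp
      field_simp at h1
      linear_combination h1
    change Real.exp (P.Θ z.1) = (‖θ.σ‖ / ‖θ'.σ‖) ^ (1 / γ) * |P.T1 z.1| ^ (-1 / γ)
    have h3 : (Real.exp (P.Θ z.1) ^ γ) ^ (1 / γ) = _ := congrArg (fun y : ℝ => y ^ (1 / γ)) h2
    rw [← Real.rpow_mul (Real.exp_pos _).le, mul_one_div_cancel hγ, Real.rpow_one,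
      Real.mul_rpow (div_pos hσ hσ').le (inv_pos.2 hT).le, Real.inv_rpow hT.le,
      ← Real.rpow_neg hT.le, ← neg_div] at h3
    exact h3

/-- The action on arbitrary elements. -/
lemma fullMap_val (hA : IsAdmissible γ θ θ' D φ) (hγ : γ ≠ 0) (hP : P.Allowed γ (times D))
    (hφ : ∀ z ∈ D, φ z = P.pointMap z) (hz : z ∈ D) :
    P.fullMap γ (z, θ.val z) = (φ z, θ'.val (φ z)) := by
  have hI := hA.isDomain.isOpen_times
  have hR := hP.regular hI
  have ht := IsDomain.mem_times hz
  have hT : ((|P.T1 z.1| : ℝ) : ℂ) ≠ 0 := by exact_mod_cast abs_ne_zero.2 (hR.T1_ne _ ht)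
  have hκ : ((P.κ ^ γ : ℝ) : ℂ) ≠ 0 := by exact_mod_cast (Real.rpow_pos_of_pos hP.κ_pos γ).ne'
  have h1 := hA.sigma_eq hγ hR hφ hz
  rw [hP.exp_rpow hγ ht] at h1
  have h2 : P.sigmaMap γ z.1 θ.σ = θ'.σ := by
    rw [Params.sigmaMap, P.hat_eq]
    push_cast at h1
    field_simp at h1
    field_simp
    rw [← h1, mul_comm]
  have h3 := hA.S_eq hR hφ hz
  rw [ArbElt.S, ArbElt.S, ← hP.S_rule hI hγ ht, h2, ← hφ z hz] at h3
  -- Once `σ` is matched, the nonlinear terms in the rule for `S` are equal and cancel, leaving the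
  -- rule for `V`.
  refine Prod.ext (hφ z hz).symm (Prod.ext h2 ?_)
  exact (add_left_cancel h3).symm

end IsAdmissible

end NSchE

/-! ### The stated transformations belong to the equivalence group -/

namespace NSchE

/-- A smooth function of one variable with a nonvanishing derivative has a smooth local inverse. -/
lemma exists_local_inverse {f : ℝ → ℝ} {t : ℝ} (hf : ContDiffAt ℝ ∞ f t) (h : deriv f t ≠ 0) :
    ∃ g : ℝ → ℝ, ContDiffAt ℝ ∞ g (f t) ∧ g (f t) = t ∧ ∀ᶠ s in 𝓝 (f t), f (g s) = s := by
  let e : ℝ ≃L[ℝ] ℝ := ContinuousLinearEquiv.unitsEquivAut ℝ (Units.mk0 _ h)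
  have he : HasFDerivAt f (e : ℝ →L[ℝ] ℝ) t := by
    have h1 := (hf.differentiableAt (by simp)).hasDerivAt.hasFDerivAt
    refine h1.congr_fderiv ?_
    ext
    simp [e]
  exact ⟨hf.localInverse he (by simp), hf.to_localInverse he (by simp),
    hf.localInverse_apply_image he (by simp),
    (hf.hasStrictFDerivAt' he (by simp)).eventually_right_inverse⟩

namespace Params

variable {P : Params} {I : Set ℝ} {γ : ℝ}

/-- Rolle's theorem on an interval where `T_t` does not vanish. -/
lemma Regular.injOn_T (hP : P.Regular I) (hc : IsPreconnected I) : Set.InjOn P.T I := by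
  have key : ∀ s ∈ I, ∀ t ∈ I, s < t → P.T s ≠ P.T t := by
    intro s hs t ht hst h
    have hsub : Set.Icc s t ⊆ I := hc.ordConnected.out hs ht
    obtain ⟨c, hc, hc0⟩ := exists_deriv_eq_zero hst
      (fun y hy => (hP.smooth_T y (hsub hy)).continuousAt.continuousWithinAt) h
    exact hP.T1_ne c (hsub (Set.Ioo_subset_Icc_self hc)) hc0
  intro s hs t ht h
  rcases lt_trichotomy s t with h1 | h1 | h1
  · exact absurd h (key s hs t ht h1)
  · exact h1
  · exact absurd h.symm (key t ht s hs h1)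

lemma Regular.conjIf_eq (hP : P.Regular I) (hc : IsPreconnected I) {s t : ℝ} (hs : s ∈ I)
    (ht : t ∈ I) : conjIf (P.T1 s) = conjIf (P.T1 t) := by
  rcases constant_sign hc (fun t ht => (hP.smooth_T1 ht).continuousAt.continuousWithinAt)
    hP.T1_ne with h | h
  · simp [conjIf, h s hs, h t ht]
  · simp [conjIf, (h s hs).not_gt, (h t ht).not_gt]

lemma Regular.ε_ne (hP : P.Regular I) : P.ε ≠ 0 := by
  rcases hP.ε_eq with h | h <;> rw [h] <;> norm_num

/-- Besides injectivity of the whole map, this makes the transported potential well defined as a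
function of the new `(t, x)`. -/
lemma Regular.base_injective (hP : P.Regular I) (hc : IsPreconnected I) {z y : Pt} (hz : z.1 ∈ I)
    (hy : y.1 ∈ I) (h : base (P.pointMap z) = base (P.pointMap y)) : base z = base y := by
  have h1 : z.1 = y.1 := hP.injOn_T hc hz hy (congrArg Prod.fst h)
  have h2 : P.ε * z.2.1 * Real.sqrt |P.T1 z.1| + P.X z.1
      = P.ε * y.2.1 * Real.sqrt |P.T1 y.1| + P.X y.1 := congrArg Prod.snd h
  rw [h1] at h2
  refine Prod.ext h1 ?_
  exact mul_left_cancel₀ hP.ε_ne (mul_right_cancel₀ (hP.sqrt_pos hy).ne' (add_right_cancel h2))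

lemma Regular.injOn_pointMap (hP : P.Regular I) (hc : IsPreconnected I) {z y : Pt} (hz : z.1 ∈ I)
    (hy : y.1 ∈ I) (h : P.pointMap z = P.pointMap y) : z = y := by
  have h1 := hP.base_injective hc hz hy (congrArg base h)
  have h2 : z.1 = y.1 := (Prod.ext_iff.1 h1).1
  have h3 : z.2.1 = y.2.1 := (Prod.ext_iff.1 h1).2
  have h4 := congrArg (fun z : Pt => z.2.2) h
  simp only [pointMap_psi', h2, h3] at h4
  have h5 := mul_right_cancel₀ (P.factor_ne_zero _ _) h4
  have h6 := congrArg (conjIf (P.T1 y.1)) h5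
  rw [conjIf_conjIf, conjIf_conjIf] at h6
  exact Prod.ext h2 (Prod.ext h3 h6)

/-- The differential is triangular with respect to `t`, `x`, `ψ`, with invertible diagonal entries.
-/
lemma Regular.fderiv_pointMap_injective (hP : P.Regular I) {z : Pt} (hz : z.1 ∈ I) {v : Pt}
    (h : fderiv ℝ P.pointMap z v = 0) : v = 0 := by
  have hv : v = v.1 • ((1, 0, 0) : Pt) + (0, v.2.1, v.2.2) := by
    refine Prod.ext ?_ (Prod.ext ?_ ?_) <;> simp
  rw [hv, map_add, map_smul, hP.fderiv_time hz, hP.fderiv_section hz] at h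
  have h1 : v.1 = 0 := by
    have := congrArg Prod.fst h
    simpa [hP.T1_ne _ hz] using this
  rw [h1, zero_smul, zero_add] at h
  have h2 : v.2.1 = 0 := by
    have := congrArg (fun z : Pt => z.2.1) h
    simpa [hP.ε_ne, (hP.sqrt_pos hz).ne'] using this
  have h3 : v.2.2 = 0 := by
    have := congrArg (fun z : Pt => z.2.2) h
    simpa [h2, P.factor_ne_zero, conjIf_eq_zero] using this
  exact Prod.ext h1 (Prod.ext h2 h3)

lemma Regular.isPointTransformation_pointMap {D : Set Pt} (hD : IsDomain D)
    (hP : P.Regular (times D)) : IsPointTransformation D P.pointMap where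
  isOpen := hD.isOpen
  smooth _ hz := (hP.smooth_pointMap (IsDomain.mem_times hz)).contDiffWithinAt
  injOn _ hz _ hy h := hP.injOn_pointMap hD.isPreconnected_times (IsDomain.mem_times hz)
    (IsDomain.mem_times hy) h
  jacobian _ hz := det_ne_zero_of_ker fun _ =>
    hP.fderiv_pointMap_injective (IsDomain.mem_times hz)

/-- The inhomogeneous part of the transformation of the potential. -/
noncomputable def potentialShift (P : Params) (γ t x : ℝ) : ℂ :=
  (((2 * P.T3 t * P.T1 t - 3 * P.T2 t ^ 2) / (16 * P.ε' t * P.T1 t ^ 3) * x ^ 2 : ℝ) : ℂ)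
    + ((P.ε * P.ε' t / (2 * Real.sqrt |P.T1 t|) * P.XT t * x : ℝ) : ℂ)
    + ((P.Ψ1 t / P.T1 t : ℝ) : ℂ)
    - ((P.X1 t ^ 2 / (4 * P.T1 t ^ 2) : ℝ) : ℂ)
    + Complex.I * (((1 / γ - 1 / 4) * (P.T2 t / P.T1 t ^ 2) : ℝ) : ℂ)

lemma potentialMap_eq (P : Params) (γ t x : ℝ) (V : ℂ) :
    P.potentialMap γ t x V = conjIf (P.T1 t) V / ((|P.T1 t| : ℝ) : ℂ) + P.potentialShift γ t x := by
  rw [potentialMap, potentialShift, hat_eq]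
  ring

section Smooth

variable {E : Type*} [NormedAddCommGroup E] [NormedSpace ℝ E] {a b : E → ℝ} {c : E → ℂ} {y : E}

lemma Regular.smooth_potentialShift (hP : P.Regular I) (ha : ContDiffAt ℝ ∞ a y)
    (hb : ContDiffAt ℝ ∞ b y) (hy : a y ∈ I) :
    ContDiffAt ℝ ∞ (fun y => P.potentialShift γ (a y) (b y)) y := by
  have hT := hP.T1_ne _ hy
  have h1 := (hP.smooth_T1 hy).comp y ha
  have h2 := (hP.smooth_T2 hy).comp y ha
  have h3 := (hP.smooth_T3 hy).comp y ha
  have h4 := (hP.smooth_X1 hy).comp y ha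
  have h5 := (hP.smooth_Ψ1 hy).comp y ha
  have h6 := (hP.smooth_XT hy).comp y ha
  have h7 := (hP.smooth_ε' hy).comp y ha
  have h8 := (hP.smooth_sqrt hy).comp y ha
  refine ((((smooth_ofReal ?_).add (smooth_ofReal ?_)).add (smooth_ofReal ?_)).sub
    (smooth_ofReal ?_)).add (contDiffAt_const.mul (smooth_ofReal ?_))
  · exact ((((contDiffAt_const.mul h3).mul h1).sub (contDiffAt_const.mul (h2.pow 2))).div
      ((contDiffAt_const.mul h7).mul (h1.pow 3))
      (mul_ne_zero (mul_ne_zero (by norm_num) (hP.ε'_ne hy)) (pow_ne_zero 3 hT))).mul (hb.pow 2)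
  · exact (((contDiffAt_const.mul h7).div (contDiffAt_const.mul h8)
      (mul_ne_zero two_ne_zero (hP.sqrt_pos hy).ne')).mul h6).mul hb
  · exact h5.div h1 hT
  · exact (h4.pow 2).div (contDiffAt_const.mul (h1.pow 2))
      (mul_ne_zero four_ne_zero (pow_ne_zero 2 hT))
  · exact contDiffAt_const.mul (h2.div (h1.pow 2) (pow_ne_zero 2 hT))

lemma Regular.smooth_potentialMap (hP : P.Regular I) (ha : ContDiffAt ℝ ∞ a y)
    (hb : ContDiffAt ℝ ∞ b y) (hc : ContDiffAt ℝ ∞ c y) (hy : a y ∈ I) :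
    ContDiffAt ℝ ∞ (fun y => P.potentialMap γ (a y) (b y) (c y)) y := by
  simp only [potentialMap_eq, div_eq_mul_inv]
  exact ((hP.smooth_hat ha hc hy).mul ((smooth_ofReal ((hP.smooth_abs hy).comp y ha)).inv
    (by simpa using hP.T1_ne _ hy))).add (hP.smooth_potentialShift ha hb hy)

lemma Regular.smooth_sigmaMap (hP : P.Regular I) (ha : ContDiffAt ℝ ∞ a y)
    (hc : ContDiffAt ℝ ∞ c y) (hy : a y ∈ I) :
    ContDiffAt ℝ ∞ (fun y => P.sigmaMap γ (a y) (c y)) y := by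
  simp only [sigmaMap, hat_eq, div_eq_mul_inv]
  exact (hP.smooth_hat ha hc hy).mul contDiffAt_const

end Smooth

lemma isOpen_valSet : IsOpen valSet := isOpen_ne_fun continuous_fst continuous_const

lemma Regular.smooth_fullMap (hP : P.Regular I) {zw : Pt × Val} (hz : zw.1.1 ∈ I) :
    ContDiffAt ℝ ∞ (P.fullMap γ) zw := by
  have ht : ContDiffAt ℝ ∞ (fun y : Pt × Val => y.1.1) zw := contDiffAt_fst.fst
  have hx : ContDiffAt ℝ ∞ (fun y : Pt × Val => y.1.2.1) zw := contDiffAt_fst.snd.fst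
  have h1 : ContDiffAt ℝ ∞ (fun y : Pt × Val => P.pointMap y.1) zw :=
    (hP.smooth_pointMap hz).comp zw contDiffAt_fst
  exact h1.prodMk ((hP.smooth_sigmaMap ht contDiffAt_snd.fst hz).prodMk
    (hP.smooth_potentialMap ht hx contDiffAt_snd.snd hz))

/-- Projectability reduces to a direction with vanishing `(t, x, ψ)`-part. Along it the base point
is fixed and the map is affine in `(σ, V)` with invertible linear part. -/
lemma Regular.fderiv_fullMap_injective (hP : P.Regular I) (hκ : 0 < P.κ) {zw : Pt × Val}
    (hz : zw.1.1 ∈ I) {v : Pt × Val} (h : fderiv ℝ (P.fullMap γ) zw v = 0) : v = 0 := by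
  have hd := (hP.smooth_fullMap (γ := γ) hz).differentiableAt (by simp)
  have h1 : v.1 = 0 := by
    refine hP.fderiv_pointMap_injective hz ?_
    have e1 : HasFDerivAt (fun y => (P.fullMap γ y).1) _ zw := hd.hasFDerivAt.fst
    have e2 : HasFDerivAt (fun y : Pt × Val => P.pointMap y.1) _ zw :=
      (hasFDerivAt_of_smooth (hP.smooth_pointMap hz)).comp zw hasFDerivAt_fst
    have e3 := DFunLike.congr_fun (e2.unique e1) v
    refine e3.trans ?_
    simp [h]
  have hv : v = (0, v.2) := Prod.ext h1 rfl
  have e1 := hasDerivAt_comp_line hd v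
  rw [h] at e1
  have e2 := e1.hasFDerivAt.snd.hasDerivAt
  have hconj : ∀ (a b : ℂ), HasDerivAt (fun r : ℝ => conjIf (P.T1 zw.1.1) (a + r • b))
      (conjIf (P.T1 zw.1.1) b) 0 := fun a b =>
    ((conjIf (P.T1 zw.1.1)).hasFDerivAt (x := a + (0:ℝ) • b)).comp_hasDerivAt 0
      (hasDerivAt_line a b 0)
  have e3 := ((hconj zw.2.1 v.2.1).div_const ((P.κ ^ γ : ℝ) : ℂ)).prodMk
    (((hconj zw.2.2 v.2.2).div_const ((|P.T1 zw.1.1| : ℝ) : ℂ)).add_const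
      (P.potentialShift γ zw.1.1 zw.1.2.1))
  have e4 : (fun r : ℝ => (P.fullMap γ (zw + r • v)).2) = fun r : ℝ =>
      (conjIf (P.T1 zw.1.1) (zw.2.1 + r • v.2.1) / ((P.κ ^ γ : ℝ) : ℂ),
        conjIf (P.T1 zw.1.1) (zw.2.2 + r • v.2.2) / ((|P.T1 zw.1.1| : ℝ) : ℂ)
          + P.potentialShift γ zw.1.1 zw.1.2.1) := by
    funext r
    rw [hv]
    simp [fullMap, sigmaMap, potentialMap_eq, hat_eq]
  rw [← e4] at e3
  have e5 := e3.unique e2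
  have hκ' : ((P.κ ^ γ : ℝ) : ℂ) ≠ 0 := by exact_mod_cast (Real.rpow_pos_of_pos hκ γ).ne'
  have hT : ((|P.T1 zw.1.1| : ℝ) : ℂ) ≠ 0 := by exact_mod_cast abs_ne_zero.2 (hP.T1_ne _ hz)
  have e6 : conjIf (P.T1 zw.1.1) v.2.1 / ((P.κ ^ γ : ℝ) : ℂ) = 0 := by
    simpa using congrArg Prod.fst e5
  have e7 : conjIf (P.T1 zw.1.1) v.2.2 / ((|P.T1 zw.1.1| : ℝ) : ℂ) = 0 := by
    simpa using congrArg Prod.snd e5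
  refine Prod.ext h1 (Prod.ext ?_ ?_)
  · exact conjIf_eq_zero.1 ((div_eq_zero_iff.1 e6).resolve_right hκ')
  · exact conjIf_eq_zero.1 ((div_eq_zero_iff.1 e7).resolve_right hT)

lemma Regular.injOn_fullMap (hP : P.Regular I) (hκ : 0 < P.κ) (hc : IsPreconnected I)
    {z y : Pt × Val} (hz : z.1.1 ∈ I) (hy : y.1.1 ∈ I) (h : P.fullMap γ z = P.fullMap γ y) :
    z = y := by
  have h1 := hP.injOn_pointMap hc hz hy (congrArg Prod.fst h)
  have hκ' : ((P.κ ^ γ : ℝ) : ℂ) ≠ 0 := by exact_mod_cast (Real.rpow_pos_of_pos hκ γ).ne'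
  have hT : ((|P.T1 y.1.1| : ℝ) : ℂ) ≠ 0 := by exact_mod_cast abs_ne_zero.2 (hP.T1_ne _ hy)
  have h2 : P.sigmaMap γ z.1.1 z.2.1 = P.sigmaMap γ y.1.1 y.2.1 :=
    congrArg (fun w : Pt × Val => w.2.1) h
  have h3 : P.potentialMap γ z.1.1 z.1.2.1 z.2.2 = P.potentialMap γ y.1.1 y.1.2.1 y.2.2 :=
    congrArg (fun w : Pt × Val => w.2.2) h
  rw [h1, sigmaMap, sigmaMap, hat_eq, hat_eq, div_left_inj' hκ'] at h2
  rw [h1, potentialMap_eq, potentialMap_eq, add_left_inj, div_left_inj' hT] at h3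
  have h4 := congrArg (conjIf (P.T1 y.1.1)) h2
  have h5 := congrArg (conjIf (P.T1 y.1.1)) h3
  rw [conjIf_conjIf, conjIf_conjIf] at h4 h5
  exact Prod.ext h1 (Prod.ext h4 h5)

lemma Allowed.isPointTransformation_fullMap {D : Set Pt} (hD : IsDomain D)
    (hP : P.Allowed γ (times D)) {Φ : Pt × Val → Pt × Val}
    (hΦ : Set.EqOn Φ (P.fullMap γ) (D ×ˢ valSet)) : IsPointTransformation (D ×ˢ valSet) Φ := by
  have hR := hP.regular hD.isOpen_times
  have hopen : IsOpen (D ×ˢ valSet) := hD.isOpen.prod isOpen_valSet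
  refine ⟨hopen, ?_, ?_, ?_⟩
  · refine ContDiffOn.congr (fun zw hzw => ?_) hΦ
    exact (hR.smooth_fullMap (IsDomain.mem_times hzw.1)).contDiffWithinAt
  · intro z hz y hy h
    rw [hΦ hz, hΦ hy] at h
    exact hR.injOn_fullMap hP.κ_pos hD.isPreconnected_times (IsDomain.mem_times hz.1)
      (IsDomain.mem_times hy.1) h
  · intro z hz
    rw [(hΦ.eventuallyEq_of_mem (hopen.mem_nhds hz)).fderiv_eq]
    exact det_ne_zero_of_ker fun _ =>
      hR.fderiv_fullMap_injective hP.κ_pos (IsDomain.mem_times hz.1)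

/-- The transformation rules give an admissible transformation of every equation. -/
lemma Allowed.exists_isAdmissible {D : Set Pt} (hD : IsDomain D) (hγ : γ ≠ 0)
    (hP : P.Allowed γ (times D)) {θ : ArbElt} (hθ : θ.InClass D) :
    ∃ θ' : ArbElt, (∀ z ∈ D, P.fullMap γ (z, θ.val z) = (P.pointMap z, θ'.val (P.pointMap z))) ∧
      IsAdmissible γ θ θ' D P.pointMap := by
  classical
  have hI := hD.isOpen_times
  have hc := hD.isPreconnected_times
  have hR := hP.regular hI
  obtain ⟨z₀, hz₀⟩ := hD.isConnected.nonempty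
  -- The potential is transported through an arbitrary preimage; `base_injective` makes the result
  -- independent of the choice.
  let V' : ℝ × ℝ → ℂ := fun q => if h : ∃ z ∈ D, base (P.pointMap z) = q then
    P.potentialMap γ h.choose.1 h.choose.2.1 (θ.V (base h.choose)) else 0
  have hV' : ∀ z ∈ D, V' (base (P.pointMap z)) = P.potentialMap γ z.1 z.2.1 (θ.V (base z)) := by
    intro z hz
    have h : ∃ y ∈ D, base (P.pointMap y) = base (P.pointMap z) := ⟨z, hz, rfl⟩
    have h1 := hR.base_injective hc (IsDomain.mem_times h.choose_spec.1) (IsDomain.mem_times hz)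
      h.choose_spec.2
    have h2 : h.choose.1 = z.1 := (Prod.ext_iff.1 h1).1
    have h3 : h.choose.2.1 = z.2.1 := (Prod.ext_iff.1 h1).2
    simp only [V', dif_pos h]
    rw [h1, h2, h3]
  -- Evaluation at the single point `z₀` is harmless: the sign of `T_t`, hence the hat, is constant
  -- on the connected projection of `D` to the time axis.
  let θ' : ArbElt := ⟨P.sigmaMap γ z₀.1 θ.σ, V'⟩
  have hσ : ∀ z ∈ D, P.sigmaMap γ z.1 θ.σ = θ'.σ := by
    intro z hz
    change _ = P.sigmaMap γ z₀.1 θ.σ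
    rw [sigmaMap, sigmaMap, hat_eq, hat_eq,
      hR.conjIf_eq hc (IsDomain.mem_times hz) (IsDomain.mem_times hz₀)]
  have hκ' : ((P.κ ^ γ : ℝ) : ℂ) ≠ 0 := by exact_mod_cast (Real.rpow_pos_of_pos hP.κ_pos γ).ne'
  have hσ0 : θ'.σ ≠ 0 := by
    change P.hat z₀.1 θ.σ / _ ≠ 0
    rw [hat_eq]
    exact div_ne_zero (fun h => hθ.1 (conjIf_eq_zero.1 h)) hκ'
  have hB : IsOpen (base '' D) := (IsOpenMap.id.prodMap isOpenMap_fst) _ hD.isOpen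
  have hsV : ContDiffOn ℝ ∞ V' (base '' (P.pointMap '' D)) := by
    rintro _ ⟨_, ⟨z, hz, rfl⟩, rfl⟩
    have ht := IsDomain.mem_times hz
    obtain ⟨τ, hτs, hτ, hTτ⟩ := exists_local_inverse (hR.smooth_T _ ht) (hR.T1_ne _ ht)
    have hτ' : τ (P.pointMap z).1 = z.1 := hτ
    set q₀ := base (P.pointMap z) with hq₀
    -- The old space variable as a function of the new `(t, x)`, using the local inverse `τ` of `T`;
    -- it exhibits the transported potential as a smooth composition.
    let x : ℝ × ℝ → ℝ := fun q => (q.2 - P.X (τ q.1)) / (P.ε * Real.sqrt |P.T1 (τ q.1)|)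
    have hx0 : x q₀ = z.2.1 := by
      have h : (P.pointMap z).2.1 = P.ε * z.2.1 * Real.sqrt |P.T1 z.1| + P.X z.1 := rfl
      simp only [x, q₀, base, hτ', h]
      have h1 := (hR.sqrt_pos ht).ne'
      have h2 := hR.ε_ne
      field_simp
      ring
    have ha : ContDiffAt ℝ ∞ (fun q : ℝ × ℝ => τ q.1) q₀ :=
      ContDiffAt.comp (g := τ) q₀ hτs contDiffAt_fst
    have hat : τ q₀.1 = z.1 := hτ'
    have hmem : τ q₀.1 ∈ times D := by rw [hat]; exact ht
    have hx : ContDiffAt ℝ ∞ x q₀ := by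
      have h1 := ContDiffAt.comp (g := P.X) q₀ (hR.smooth_X _ hmem) ha
      have h2 := ContDiffAt.comp (g := fun s => Real.sqrt |P.T1 s|) q₀ (hR.smooth_sqrt hmem) ha
      exact (contDiffAt_snd.sub h1).div (contDiffAt_const.mul h2)
        (mul_ne_zero hR.ε_ne (hR.sqrt_pos hmem).ne')
    have hpair : ContDiffAt ℝ ∞ (fun q => (τ q.1, x q)) q₀ := ha.prodMk hx
    have hpair0 : (τ q₀.1, x q₀) = base z := by rw [hat, hx0]; rfl
    have hVs : ContDiffAt ℝ ∞ (fun q => θ.V (τ q.1, x q)) q₀ := by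
      refine ContDiffAt.comp (g := θ.V) q₀ ?_ hpair
      rw [hpair0]
      exact hθ.2.contDiffAt (hB.mem_nhds ⟨z, hz, rfl⟩)
    refine ((hR.smooth_potentialMap (γ := γ) ha hx hVs hmem).congr_of_eventuallyEq ?_).contDiffWithinAt
    have hlift : ContinuousAt (fun q => ((τ q.1, x q, z.2.2) : Pt)) q₀ :=
      ha.continuousAt.prodMk (hx.continuousAt.prodMk continuousAt_const)
    have hlift0 : ((τ q₀.1, x q₀, z.2.2) : Pt) = z := by rw [hat, hx0]
    -- The value of `ψ` is kept at that of `z`, so that nearby old `(t, x)` lift to points of `D`.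
    have hD' : ∀ᶠ q in 𝓝 q₀, ((τ q.1, x q, z.2.2) : Pt) ∈ D :=
      hlift.eventually (hD.isOpen.mem_nhds (hlift0.symm ▸ hz))
    have hTq : ∀ᶠ q : ℝ × ℝ in 𝓝 q₀, P.T (τ q.1) = q.1 :=
      (continuous_fst.continuousAt (x := q₀)).eventually hTτ
    filter_upwards [hD', hTq] with q hq hq'
    have hbq : base (P.pointMap (τ q.1, x q, z.2.2)) = q := by
      refine Prod.ext hq' ?_
      change P.ε * x q * Real.sqrt |P.T1 (τ q.1)| + P.X (τ q.1) = q.2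
      have h1 := (hR.sqrt_pos (IsDomain.mem_times hq)).ne'
      have h2 := hR.ε_ne
      simp only at h1
      simp only [x]
      field_simp
      ring
    have := hV' _ hq
    rw [hbq] at this
    exact this
  have hval : ∀ z ∈ D, P.fullMap γ (z, θ.val z) = (P.pointMap z, θ'.val (P.pointMap z)) :=
    fun z hz => Prod.ext rfl (Prod.ext (hσ z hz) (hV' z hz).symm)
  have hne : ∀ z ∈ D, (P.pointMap z).2.2 ≠ 0 := by
    intro z hz
    rw [pointMap_psi']
    exact mul_ne_zero (fun h => hD.ne_zero z hz (conjIf_eq_zero.1 h)) (P.factor_ne_zero _ _)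
  refine ⟨θ', hval, hD, hR.isPointTransformation_pointMap hD, hne, hθ, ⟨hσ0, hsV⟩, ?_⟩
  intro p f g hp hf hg hfg
  have ht : p.1 ∈ times D := IsDomain.mem_times hp
  have hS : θ'.S γ (P.pointMap (p.1, p.2, f p)) = P.sMap p.1 p.2 (θ.S γ (p.1, p.2, f p)) := by
    have h1 := hP.S_rule hI hγ (z := (p.1, p.2, f p)) ht θ.σ (θ.V (base (p.1, p.2, f p)))
    rw [hσ _ hp, ← hV' _ hp] at h1
    exact h1
  -- With `S` transformed by its rule, the new left-hand side is a nonzero multiple of the old one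
  -- or of its conjugate, so both vanish together.
  rw [lhs_pointMap hR θ θ' hD.isOpen (fun _ _ => rfl) hp ht hf hg hfg, hS, sub_self, zero_mul,
    add_zero, mul_eq_zero, or_iff_right, conjIf_eq_zero]
  exact div_ne_zero (P.factor_ne_zero _ _) (by simpa using hR.T1_ne _ ht)

lemma Allowed.mem_equivalenceGroup {D : Set Pt} (hD : IsDomain D) (hγ : γ ≠ 0)
    (hP : P.Allowed γ (times D)) {Φ : Pt × Val → Pt × Val}
    (hΦ : Set.EqOn Φ (P.fullMap γ) (D ×ˢ valSet)) : (D, Φ) ∈ equivalenceGroup γ := by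
  refine ⟨hD, hP.isPointTransformation_fullMap hD hΦ, P.pointMap, ?_, ?_⟩
  · intro z hz w hw
    exact congrArg Prod.fst (hΦ (Set.mk_mem_prod hz hw))
  · intro θ hθ
    obtain ⟨θ', h1, h2⟩ := hP.exists_isAdmissible hD hγ hθ
    refine ⟨θ', fun z hz => ?_, h2⟩
    exact (hΦ (Set.mk_mem_prod hz hθ.1)).trans (h1 z hz)

end Params

/-! ### Normalization and description of the equivalence group -/

theorem isNormalized {γ : ℝ} (hγ : γ ≠ 0) : IsNormalized γ := by
  intro θ θ' D φ hA
  obtain ⟨P, hP, hφ⟩ := hA.exists_allowed hγ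
  exact ⟨P.fullMap γ, hP.mem_equivalenceGroup hA.isDomain hγ (fun _ _ => rfl),
    fun z hz w _ => (hφ z hz).symm, fun z hz => hA.fullMap_val hγ hP hφ hz⟩

/-- All arbitrary elements share the projection `φ`, so the parameters found from one admissible
equation serve for every other. -/
theorem exists_params_of_mem_equivalenceGroup {γ : ℝ} (hγ : γ ≠ 0) {D : Set Pt}
    {Φ : Pt × Val → Pt × Val} (h : (D, Φ) ∈ equivalenceGroup γ) :
    ∃ P : Params, P.Allowed γ (times D) ∧ Set.EqOn Φ (P.fullMap γ) (D ×ˢ valSet) := by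
  obtain ⟨-, -, φ, -, hφ⟩ := h
  have hmem : ∀ w ∈ valSet, (⟨w.1, fun _ => w.2⟩ : ArbElt).InClass D := fun w hw =>
    ⟨hw, contDiffOn_const⟩
  -- The choice `σ = 1`, `V = 0` is a sample; any arbitrary elements would do.
  obtain ⟨θ₀, -, hA₀⟩ := hφ _ (hmem (1, 0) (one_ne_zero (α := ℂ)))
  obtain ⟨P, hP, hPφ⟩ := hA₀.exists_allowed hγ
  refine ⟨P, hP, ?_⟩
  rintro ⟨z, w⟩ ⟨hz, hw⟩
  -- Constant potentials realise every value `w` over `z`, which determines `Φ` pointwise.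
  obtain ⟨θ', hact, hA⟩ := hφ _ (hmem w hw)
  exact (hact z hz).trans (hA.fullMap_val hγ hP hPφ hz).symm

end NSchE

theorem mainTheorem8 (γ : ℝ) (hγ : γ ≠ 0) :
    -- the class is normalized
    NSchE.IsNormalized γ ∧
    -- its equivalence group consists exactly of the transformations of the stated form
    (∀ (D : Set NSchE.Pt) (Φ : NSchE.Pt × NSchE.Val → NSchE.Pt × NSchE.Val),
      (D, Φ) ∈ NSchE.equivalenceGroup γ ↔
        NSchE.IsDomain D ∧ ∃ P : NSchE.Params, P.Allowed γ (NSchE.times D) ∧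
          Set.EqOn Φ (P.fullMap γ) (D ×ˢ NSchE.valSet)) ∧
    -- the rules for `σ` and `V` correspond to the rule for `S = σ |ψ|^γ + V`
    (∀ (D : Set NSchE.Pt) (P : NSchE.Params), NSchE.IsDomain D →
      P.Allowed γ (NSchE.times D) → ∀ z ∈ D, ∀ σ V : ℂ,
        P.sigmaMap γ z.1 σ * ((‖(P.pointMap z).2.2‖ ^ γ : ℝ) : ℂ) + P.potentialMap γ z.1 z.2.1 V
          = P.sMap z.1 z.2.1 (σ * ((‖z.2.2‖ ^ γ : ℝ) : ℂ) + V)) := by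
  refine ⟨NSchE.isNormalized hγ, fun D Φ => ⟨fun h => ⟨h.1,
    NSchE.exists_params_of_mem_equivalenceGroup hγ h⟩, ?_⟩, ?_⟩
  · rintro ⟨hD, P, hP, hΦ⟩
    exact hP.mem_equivalenceGroup hD hγ hΦ
  · intro D P hD hP z hz σ V
    exact hP.S_rule hD.isOpen_times hγ (NSchE.IsDomain.mem_times hz) σ V
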